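/- **Setting.** Use coordinates $(n,x)$ ($n$ vertical, $x$ horizontal). The grid has its vertices at integer heights and half-integer $x$, and its edges are horizontal, vertical, or lie on lines $n+x=\text{const}$ (diagonals of unit squares). It cuts the plane into unit triangles; a lozenge is a union of two unit triangles sharing an edge, and it is called red, blue or green according as the shared edge is horizontal, diagonal or vertical. The midpoint of a red lozenge (a point of $\mathbb Z^2$) is its red dot. Let $N,M\ge 0$ and $d\ge1$ be integers, and let $\widetilde{\mathbf P}$ be the quadrilateral bounded by $n=0$, $n=N$, $n+x=-d-\frac12$, $x=M-\frac12$. Let $y_1>\dots>y_d$ be integers in $[-d,M-1]$ (the integers in the cuts of the lower edge $n=0$) and $x_1>\dots>x_{d+N}$ integers in $[-d-N,M-1]$ (the integers in the cuts of the upper edge $n=N$, including the left and right triangles that complete the hexagon to $\widetilde{\mathbf P}$). A cut is a maximal run $\{p,\dots,p+b-1\}$ of consecutive integers among the $x_i$ (resp. $y_i$); it is the triangle with vertices (written $(x,n)$) $(p-\frac12,N),(p+b-\frac12,N),(p+b-\frac12,N-b)$ (resp. $(p-\frac12,0),(p+b-\frac12,0),(p-\frac12,b)$). Let $\mathbf P$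 be $\widetilde{\mathbf P}$ with all these triangles removed (the hexagon with cuts, "multicut model"). Assume that $\mathbf P$ has a lozenge tiling and that $y_1-y_d\le N-1$. Choose a lozenge tiling of $\mathbf P$ uniformly at random. The red dots are the midpoints of its red lozenges, together with the fixed dots at all integer points of the cut triangles. **Notation.** $(z)_k=z(z+1)\cdots(z+k-1)$, $\Delta_k(u)=\prod_{i<j}(u_i-u_j)$, $Q_S(z)=P_S(z)=\prod_{a\in S}(z-a)$, $P(z)=(z-y_d+1)_{N-(y_1-y_d+1)}$, and $$\mathcal L=\{x_i<y_1-N+1\},\quad \mathcal R=\{x_i\ge y_d\},\quad \mathcal C=\{x_i\}\setminus(\mathcal L\cup\mathcal R),\quad \mathcal G=\{y_1-N+1,\dots,y_d-1\}\setminus\mathcal C ,$$ $h(u)=\dfrac{Q_{\mathcal R}(u)}{P_{\mathcal G}(u)Q_{\mathcal L}(u)}$. Assume $r:=|\mathcal L|-d\ge 0$. Let $E$ be the symmetric polynomial in $d$ variables with $$\det\Big(\tfrac{(w_\alpha-y_\beta+1)_{N-1}}{(N-1)!}\Big)_{\alpha,\beta=1}^d=C_{N,d}\,\Delta_d(w)\,E(w)\prod_{\alpha=1}^dP(w_\alpha),\qquad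 C_{N,d}=\prod_{j=1}^d\frac1{(N-j)!}\cdot\frac{\Delta_d(y_1,\dots,y_d)}{\prod_{j=1}^d(d-j)!},$$ and let $F$ be a polynomial with $E(w)=F(t_0(w),t_1(w),\dots)$, where $t_a(w)=\sum_iw_i^a$. Put $t_a(\mathcal L)=\sum_{b\in\mathcal L}b^a$, $$\widetilde E(u_1,\dots,u_k)=F\Big(\big(t_a(\mathcal L)-\textstyle\sum_iu_i^a\big)_{a\ge0}\Big),\qquad \widetilde E(z;u_1,\dots,u_k)=F\Big(\big(z^a+t_a(\mathcal L)-\textstyle\sum_iu_i^a\big)_{a\ge0}\Big),$$ and $$\Omega^{+}_k(v,z)=\Big(\prod_{\alpha=1}^k\oint_{\Gamma(\mathcal L)}\frac{du_\alpha\,h(u_\alpha)(z-u_\alpha)}{2\pi i\,(v-u_\alpha)}\Big)\Delta_k^2(u)\,\widetilde E(u_1,\dots,u_k),$$ $$\Omega^{-}_k(v,z)=\Big(\prod_{\alpha=1}^k\oint_{\Gamma(\mathcal L)}\frac{du_\alpha\,h(u_\alpha)}{2\pi i\,(v-u_\alpha)(z-u_\alpha)}\Big)\Delta_k^2(u)\,\widetilde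 E(z;u_1,\dots,u_k).$$ Contours: for a finite set $S\subset\mathbb Z$, $\Gamma(S)$ consists of positively oriented circles of a common radius about the points of $S$, of radius $\varepsilon$ for the $u$-integrals and $\delta$ for the $v$- and $z$-integrals over such contours, where $0<\varepsilon<\delta$ and $\delta+\varepsilon<1$. $\Gamma(x+\mathbb N)$ means $\Gamma(\{x,x+1,\dots,M-1\})$ (there are no poles at larger integers). $\Gamma_\infty$ is the circle $|z|=R_\infty$ with $R_\infty\ge d+N+M+1$. With $\tau=(y+n)-(y_1+1)$, $\Gamma_\tau=\Gamma(\{y+n-N,\dots,\min(y_1-N,y)\})$ if $\tau<0$ and $\Gamma_\tau=\emptyset$ if $\tau\ge0$. **Theorem.** Such a polynomial $F$ exists. For every such $F$ and all $\varepsilon,\delta,R_\infty$ as above, $\Omega_r^+(0,0)\neq0$, and the point process of red dots is determinantal with the kernel $$\begin{aligned}\mathbb K^{\rm red}(m,x;n,y)=&-\frac{(y-x+1)_{n-m-1}}{(n-m-1)!}\mathbf 1_{n>m}\mathbf 1_{y\ge x}+\frac{(N-n)!}{(N-m-1)!}\oint_{\Gamma(x+\mathbb N)}\frac{dv\,(v-x+1)_{N-m-1}}{2\pi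 i\,Q_{\mathcal R}(v)Q_{\mathcal C}(v)}\\&\times\Big(\oint_{\Gamma_\infty}\frac{dz\,Q_{\mathcal R}(z)Q_{\mathcal C}(z)}{2\pi i\,(z-v)(z-y)_{N-n+1}}\frac{\Omega^+_r(v,z)}{\Omega^+_r(0,0)}+\frac1{r+1}\oint_{\Gamma_\tau}\frac{dz\,P(z)Q_{\mathcal L}(z)}{2\pi i\,(z-y)_{N-n+1}}\frac{\Omega^-_{r+1}(v,z)}{\Omega^+_r(0,0)}\Big)\end{aligned}$$ (with $1/(-1)!:=0$, so that the second term vanishes for $m=N$); it involves at most $r+3$ integrations. That is, for all $k\ge0$ and all distinct integer points $p_1,\dots,p_k$ of $\widetilde{\mathbf P}$, none of which is one of the fixed upper points $(N,x_i)$ (so in particular for all distinct integer points of $\mathbf P$), $$\Pr(\text{there is a red dot at each of }p_1,\dots,p_k)=\det\big(\mathbb K^{\rm red}(p_i;p_j)\big)_{1\le i,j\le k}.$$ -/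

import Mathlib

/-!
Coordinates: a point of the plane has a horizontal coordinate `x` and a height `n`.  The grid has
its vertices at integer heights and half-integer horizontal coordinates, and three families of
edges: horizontal, vertical, and the diagonals `n + x = const` of the unit squares.
-/

noncomputable section

namespace RedDots

open Finset

/-- The unit triangles of the grid. -/
inductive UnitTriangle where
  /-- `lower k x` has the vertices `(x - 1/2, k)`, `(x + 1/2, k)`, `(x - 1/2, k + 1)`. -/
  | lower (k : ℕ) (x : ℤ)
  /-- `upper k x` has the vertices `(x - 1/2, k)`, `(x + 1/2, k)`, `(x + 1/2, k - 1)`. -/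
  | upper (k : ℕ) (x : ℤ)

/-- The lozenges, i.e. the unions of two unit triangles with a common edge. -/
inductive Lozenge where
  /-- The common edge is horizontal, with midpoint `(x, k)`: this midpoint is the red dot. -/
  | red (k : ℕ) (x : ℤ)
  /-- The common edge is a diagonal, with midpoint `(x, k + 1/2)`. -/
  | blue (k : ℕ) (x : ℤ)
  /-- The common edge is vertical, with midpoint `(x - 1/2, k + 1/2)`. -/
  | green (k : ℕ) (x : ℤ)

/-- The two unit triangles that make up a lozenge. -/
def Lozenge.triangles : Lozenge → Set UnitTriangle
  | .red k x => {.lower k x, .upper k x}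
  | .blue k x => {.lower k x, .upper (k + 1) x}
  | .green k x => {.lower k x, .upper (k + 1) (x - 1)}

/-- `T` is a lozenge tiling of the region made of the unit triangles in `A`: its lozenges lie in
the region and each unit triangle of the region is covered exactly once. -/
def IsLozengeTiling (A : Set UnitTriangle) (T : Finset Lozenge) : Prop :=
  (∀ t ∈ T, t.triangles ⊆ A) ∧ ∀ c ∈ A, ∃! t, t ∈ T ∧ c ∈ t.triangles

/-- The data of a hexagon with cuts along its lower edge (at height `0`) and its upper edge (at
height `N`).  With `d = |Y|`, the surrounding quadrilateral is bounded by the lines `n = 0`,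
`n = N`, `n + x = - d - 1/2` and `x = M - 1/2`.  The integers in the lower cuts are the elements
of `Y`, those in the upper cuts (including the two triangles that complete the hexagon to the
quadrilateral) are the elements of `X`; a cut is a maximal run of consecutive elements.
The total length of the intervals between the cuts is `M` on either edge. -/
structure CutHexagon where
  /-- the distance between the lower and the upper edge -/
  N : ℕ
  /-- the total length of the intervals between the cuts -/
  M : ℕ
  /-- the integer points `y₁ > ⋯ > y_d` in the lower cuts -/
  Y : Finset ℤ
  /-- the integer points `x₁ > ⋯ > x_{d+N}` in the upper cuts -/
  X : Finset ℤ
  Y_nonempty : Y.Nonempty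
  Y_subset : Y ⊆ Icc (-(Y.card : ℤ)) ((M : ℤ) - 1)
  X_subset : X ⊆ Icc (-(Y.card : ℤ) - (N : ℤ)) ((M : ℤ) - 1)
  X_card : X.card = Y.card + N

namespace CutHexagon

variable (H : CutHexagon)

/-- The total size `d` of the lower cuts. -/
def d : ℕ := H.Y.card

/-- `y₁`, the largest integer in the lower cuts. -/
def yFirst : ℤ := H.Y.max' H.Y_nonempty

/-- `y_d`, the smallest integer in the lower cuts. -/
def yLast : ℤ := H.Y.min' H.Y_nonempty

/-- The decreasing enumeration `y₁ > ⋯ > y_d`, indexed from `0`. -/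
def y (i : Fin H.d) : ℤ := H.Y.orderEmbOfFin rfl (Fin.rev i)

/-- The integer points of the quadrilateral. -/
def InQuad (k : ℕ) (x : ℤ) : Prop :=
  k ≤ H.N ∧ -(H.d : ℤ) ≤ k + x ∧ x ≤ (H.M : ℤ) - 1

/-- The integer point at height `k` and horizontal position `x` lies in one of the triangles that
are cut out.  An upper cut `{p, …, p + b - 1}` removes the triangle with the vertices
`(p - 1/2, N)`, `(p + b - 1/2, N)`, `(p + b - 1/2, N - b)`; a lower cut `{p, …, p + b - 1}`
removes the triangle with the vertices `(p - 1/2, 0)`, `(p + b - 1/2, 0)`, `(p - 1/2, b)`. -/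
def InCut (k : ℕ) (x : ℤ) : Prop :=
  (∀ j : ℤ, x - ((H.N : ℤ) - k) ≤ j → j ≤ x → j ∈ H.X) ∨
    (∀ j : ℤ, x ≤ j → j ≤ x + k → j ∈ H.Y)

/-- The polygon `P`, i.e. the quadrilateral without the cuts, as a set of unit triangles. -/
def region : Set UnitTriangle := fun c =>
  match c with
  | .lower k x => k < H.N ∧ H.InQuad k x ∧ ¬ H.InCut k x
  | .upper k x => 0 < k ∧ H.InQuad k x ∧ ¬ H.InCut k x

/-- The set of all lozenge tilings of the polygon. -/
def tilings : Set (Finset Lozenge) := {T | IsLozengeTiling H.region T}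

/-- The red dots of a tiling: the midpoints of the red lozenges, together with the fixed dots in
the cuts, which are thought of as being covered by red lozenges.
The point at height `k` and horizontal position `x` is written `(k, x)`. -/
def redDots (T : Finset Lozenge) : Set (ℕ × ℤ) :=
  {p | Lozenge.red p.1 p.2 ∈ T ∨ (H.InQuad p.1 p.2 ∧ H.InCut p.1 p.2)}

/-- The probability, under the uniform measure on the lozenge tilings of the polygon, that there
is a red dot at each of the points `p i`. -/
def correlation {k : ℕ} (p : Fin k → ℕ × ℤ) : ℝ :=
  ({T ∈ H.tilings | ∀ i, p i ∈ H.redDots T}.ncard : ℝ) / (H.tilings.ncard : ℝ)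

/-- The points at which the process is observed: the integer points of the quadrilateral, except
for the fixed dots in the upper edge.  They include all integer points of the polygon. -/
def IsSite (p : ℕ × ℤ) : Prop :=
  H.InQuad p.1 p.2 ∧ (p.1 = H.N → p.2 ∉ H.X)

/-- `𝓛 = {xᵢ : xᵢ < y₁ - N + 1}`. -/
def setL : Finset ℤ := H.X.filter (fun a => a < H.yFirst - H.N + 1)

/-- `𝓡 = {xᵢ : xᵢ ≥ y_d}`. -/
def setR : Finset ℤ := H.X.filter (fun a => H.yLast ≤ a)

/-- `𝓒 = {x₁, …, x_{d+N}} \ (𝓛 ∪ 𝓡)`. -/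
def setC : Finset ℤ := H.X \ (H.setL ∪ H.setR)

/-- `𝓖 = {y₁ - N + 1, …, y_d - 1} \ 𝓒`. -/
def setG : Finset ℤ := Icc (H.yFirst - H.N + 1) (H.yLast - 1) \ H.setC

end CutHexagon

/-- The rising factorial `(z)_k = z (z + 1) ⋯ (z + k - 1)`. -/
def rising (z : ℂ) (k : ℕ) : ℂ := (ascPochhammer ℂ k).eval z

/-- The monic polynomial with the simple roots `S`. -/
def rootPoly (S : Finset ℤ) (z : ℂ) : ℂ := ∏ a ∈ S, (z - (a : ℂ))

/-- The Vandermonde product `∏_{i < j} (uᵢ - uⱼ)`. -/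
def vandermondeProd {k : ℕ} (u : Fin k → ℂ) : ℂ := ∏ i, ∏ j ∈ Ioi i, (u i - u j)

/-- `(2πi)⁻¹ ∮ f(u) du` over the positively oriented circle of radius `ρ` about `c`. -/
def circleInt (c : ℂ) (ρ : ℝ) (f : ℂ → ℂ) : ℂ :=
  (2 * (Real.pi : ℂ) * Complex.I)⁻¹ * ∮ u in C(c, ρ), f u

/-- `(2πi)⁻¹ ∮ f(u) du` over `Γ(S)`, the contour that consists of the positively oriented circles
of radius `ρ` about the points of `S`. -/
def contourInt (S : Finset ℤ) (ρ : ℝ) (f : ℂ → ℂ) : ℂ :=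
  ∑ p ∈ S, circleInt (p : ℂ) ρ f

/-- The `k`-fold iterated integral `(2πi)⁻ᵏ ∮ ⋯ ∮ f(u₁, …, u_k) du₁ ⋯ du_k` over `Γ(S)`. -/
def multiContourInt (S : Finset ℤ) (ρ : ℝ) : (k : ℕ) → ((Fin k → ℂ) → ℂ) → ℂ
  | 0, f => f Fin.elim0
  | k + 1, f => contourInt S ρ fun u => multiContourInt S ρ k fun w => f (Fin.cons u w)

namespace CutHexagon

variable (H : CutHexagon)

/-- `P(z) = (z - y_d + 1)_{N - (y₁ - y_d + 1)}`. -/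
def P (z : ℂ) : ℂ :=
  rising (z - (H.yLast : ℂ) + 1) ((H.N : ℤ) - (H.yFirst - H.yLast + 1)).toNat

/-- `h(u) = Q_𝓡(u) / (P_𝓖(u) Q_𝓛(u))`. -/
def h (u : ℂ) : ℂ := rootPoly H.setR u / (rootPoly H.setG u * rootPoly H.setL u)

/-- The constant `C_{N,d} = ∏_{j=1}^d 1/(N-j)! · Δ_d(y₁, …, y_d) / ∏_{j=1}^d (d-j)!`. -/
def cutConst : ℂ :=
  (∏ j ∈ Icc 1 H.d, (1 : ℂ) / ((H.N - j).factorial : ℂ)) *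
    (vandermondeProd (fun i => (H.y i : ℂ)) / ∏ j ∈ Icc 1 H.d, ((H.d - j).factorial : ℂ))

/-- The polynomial `F` in the variables `t₀, t₁, t₂, …` expresses the symmetric polynomial `E` of
the lower cuts in `d` variables through power sums, `E(w) = F(t₀(w), t₁(w), …)` with
`t_a(w) = ∑ wᵢ^a`; here `E` is determined by
`det ((w_α - y_β + 1)_{N-1} / (N-1)!) = C_{N,d} Δ_d(w) E(w) ∏ P(w_α)`. -/
def ExpressesCutPoly (F : MvPolynomial ℕ ℂ) : Prop :=
  ∀ w : Fin H.d → ℂ,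
    (Matrix.of fun α β : Fin H.d =>
        rising (w α - (H.y β : ℂ) + 1) (H.N - 1) / ((H.N - 1).factorial : ℂ)).det =
      H.cutConst * vandermondeProd w * MvPolynomial.eval (fun a : ℕ => ∑ i, w i ^ a) F *
        ∏ α, H.P (w α)

/-- The power sum `t_a(𝓛)`. -/
def powerSumL (a : ℕ) : ℂ := ∑ b ∈ H.setL, (b : ℂ) ^ a

/-- The complementary symmetric function `Ẽ(u₁, …, u_k)`: the power sums of the variables of `E`
are replaced by `t_a(𝓛) - ∑ uᵢ^a`. -/
def compl (F : MvPolynomial ℕ ℂ) {k : ℕ} (u : Fin k → ℂ) : ℂ :=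
  MvPolynomial.eval (fun a : ℕ => H.powerSumL a - ∑ i, u i ^ a) F

/-- The complementary symmetric function `Ẽ(z; u₁, …, u_k)`: the power sums of the variables of `E`
are replaced by `z^a + t_a(𝓛) - ∑ uᵢ^a`. -/
def complWith (F : MvPolynomial ℕ ℂ) (z : ℂ) {k : ℕ} (u : Fin k → ℂ) : ℂ :=
  MvPolynomial.eval (fun a : ℕ => z ^ a + H.powerSumL a - ∑ i, u i ^ a) F

/-- The `k`-fold contour integral `Ω⁺_k(v, z)` over `Γ(𝓛)`. -/
def omegaPlus (F : MvPolynomial ℕ ℂ) (ε : ℝ) (k : ℕ) (v z : ℂ) : ℂ :=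
  multiContourInt H.setL ε k fun u =>
    (∏ α, H.h (u α) * (z - u α) / (v - u α)) * vandermondeProd u ^ 2 * H.compl F u

/-- The `k`-fold contour integral `Ω⁻_k(v, z)` over `Γ(𝓛)`. -/
def omegaMinus (F : MvPolynomial ℕ ℂ) (ε : ℝ) (k : ℕ) (v z : ℂ) : ℂ :=
  multiContourInt H.setL ε k fun u =>
    (∏ α, H.h (u α) * (z - u α)⁻¹ / (v - u α)) * vandermondeProd u ^ 2 * H.complWith F z u

/-- The integers enclosed by `Γ_τ`, with `τ = (y + n) - (y₁ + 1)`. -/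
def tauSet (n : ℕ) (y : ℤ) : Finset ℤ :=
  if (y + n) - (H.yFirst + 1) < 0 then
    Icc (y + (n : ℤ) - H.N) (min (H.yFirst - H.N) y)
  else ∅

/-- The kernel `K^red(m, x; n, y)` with `p = (m, x)` and `q = (n, y)`.  The radii of the circles are
`ε` for the `u`-contours `Γ(𝓛)`, `δ` for the `v`-contour `Γ(x + ℕ)` and the `z`-contour `Γ_τ`, and
`R` for `Γ_∞`.  All poles of the `v`-integrand in `x + ℕ` are at most `M - 1`.
For `m = N` the factor `1 / (N - m - 1)! = 1 / (-1)!` is `0`. -/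
def kernel (r : ℕ) (F : MvPolynomial ℕ ℂ) (ε δ R : ℝ) (p q : ℕ × ℤ) : ℂ :=
  let m := p.1
  let x := p.2
  let n := q.1
  let y := q.2
  (if m < n ∧ x ≤ y then
      -(rising ((y : ℂ) - x + 1) (n - m - 1) / ((n - m - 1).factorial : ℂ)) else 0) +
    (if m < H.N then ((H.N - n).factorial : ℂ) / ((H.N - m - 1).factorial : ℂ) else 0) *
      contourInt (Icc x ((H.M : ℤ) - 1)) δ fun v =>
        rising (v - x + 1) (H.N - m - 1) / (rootPoly H.setR v * rootPoly H.setC v) *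
          (circleInt 0 R (fun z =>
              rootPoly H.setR z * rootPoly H.setC z /
                ((z - v) * rising (z - y) (H.N - n + 1)) *
                (H.omegaPlus F ε r v z / H.omegaPlus F ε r 0 0)) +
            1 / ((r : ℂ) + 1) * contourInt (H.tauSet n y) δ (fun z =>
              H.P z * rootPoly H.setL z / rising (z - y) (H.N - n + 1) *
                (H.omegaMinus F ε (r + 1) v z / H.omegaPlus F ε r 0 0)))

end CutHexagon

end RedDots

end

/-! ### Minors of an inverse matrix and signed counts of permutations. -/

noncomputable section

namespace RedDots

open Finset

/-! A tiling is encoded by a permutation of the integer points of the quadrilateral: a red dot is a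
fixed point, a blue or green lozenge moves its point up one level, and the `j`-th free point of the
upper edge returns to the `j`-th free point of the lower edge. The non-fixed points form `M`
non-colliding paths. They keep their order, so each closes to a cycle of length `N + 1` and all
these permutations have the same sign (`IsAllowed.sign_eq`). Hence the determinant of the matrix of
allowed moves (`kasteleyn`) is, up to this sign, the number of tilings. Prescribing red dots
replaces rows by unit vectors, and Jacobi's identity `det_pinRows` turns the resulting ratio of
determinants into a minor of the inverse matrix (`correlation_eq_det_inv`).

It remains to invert `kasteleyn`. With the gauge signs its rows are a triangular recurrence with
boundary conditions. A combination of truncated binomials with an arbitrary mass `c a` at each `a ∈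
X` solves the recurrence with a point source and vanishes on the right. The other boundary
conditions become two families of linear equations for `c` (`kasteleyn_mulVec_column`): `c` acts on
polynomials of degree less than `N` as a backward difference of order `N - n`, and it has prescribed
sums against the `d` truncated functions of the lower cuts. By the span condition each truncated
function is a polynomial off `𝓛` and zero on `𝓛`, so the second family only prescribes sums over
`𝓛`.

These equations are solved by averages over tuples of points of `𝓛`. Interpolating at the `N` nodes
of `X` left after removing `d` points of `𝓛` reproduces the polynomials. With weight residues ×
Vandermonde × determinant of the cut functions, the average is annihilated by the cut functions by
antisymmetry (`interpCoeff`). Averaged divided differences (`diffCoeff`) kill the polynomials and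
take the prescribed values on the cut functions by Cramer's rule. Both carry the partition function
`ensembleSum` as a factor. It is nonzero, since otherwise a nonzero vector would lie in the null
space of the invertible matrix (`ensembleSum_ne_zero`).

Finally the contour integrals are these averages. The `u`-residues give sums over `r`-tuples (or `(r
+ 1)`-tuples) in `𝓛`; `sum_complement` passes to the complementary `d`-tuples (or `(d - 1)`-tuples),
where `P`, `E` and one Vandermonde factor recombine into the determinant that defines `E`. The
`z`-integrals produce the divided differences and the `v`-integral takes residues at `X`
(`kernel_eq_column`). The polynomial `F` exists because an alternating determinant of polynomials is
the Vandermonde product times a polynomial in the power sums (`exists_powerSum_det_eq`). -/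

theorem det_toSquareBlockProp_range {ι κ : Type*} [Fintype ι] [DecidableEq ι] [Fintype κ]
    [DecidableEq κ] (B : Matrix ι ι ℂ) (q : ι → Prop) [DecidablePred q] (p : κ → ι)
    (hp : Function.Injective p) (hq : ∀ i, q i ↔ i ∈ Set.range p) :
    (B.toSquareBlockProp q).det = (B.submatrix p p).det := by
  let e : κ ≃ {i // q i} := Equiv.ofBijective (fun k => ⟨p k, (hq _).2 ⟨k, rfl⟩⟩)
    ⟨fun a b h => hp (congrArg Subtype.val h), fun ⟨i, hi⟩ => by
      obtain ⟨k, rfl⟩ := (hq i).1 hi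
      exact ⟨k, rfl⟩⟩
  rw [← Matrix.det_submatrix_equiv_self e]
  rfl

/-- The matrix `A` with the rows `p i` replaced by the corresponding unit vectors. -/
def pinRows {ι κ : Type*} [DecidableEq ι] (A : Matrix ι ι ℂ) (p : κ → ι) : Matrix ι ι ℂ :=
  open Classical in Matrix.of fun i j => if i ∈ Set.range p then (1 : Matrix ι ι ℂ) i j else A i j

/-- Jacobi's identity: multiplied by `A⁻¹`, the pinned rows become rows of `A⁻¹` and the others
become unit vectors, so the product is block triangular with the wanted minor as its only nontrivial
block. -/
theorem det_pinRows {ι κ : Type*} [Fintype ι] [DecidableEq ι] [Fintype κ] [DecidableEq κ]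
    (A : Matrix ι ι ℂ) (hA : A.det ≠ 0) (p : κ → ι) (hp : Function.Injective p) :
    (pinRows A p).det = A.det * (A⁻¹.submatrix p p).det := by
  classical
  have hu : IsUnit A.det := hA.isUnit
  have hC : pinRows A p * A⁻¹ = Matrix.of fun i j =>
      if i ∈ Set.range p then A⁻¹ i j else (1 : Matrix ι ι ℂ) i j := by
    ext i j
    by_cases hi : i ∈ Set.range p
    · have : ∀ k, pinRows A p i k = (1 : Matrix ι ι ℂ) i k := fun k => by
        simp only [pinRows, Matrix.of_apply, if_pos hi]
      rw [Matrix.mul_apply, Matrix.of_apply, if_pos hi]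
      simp only [this]
      rw [← Matrix.mul_apply, one_mul]
    · have : ∀ k, pinRows A p i k = A i k := fun k => by
        simp only [pinRows, Matrix.of_apply, if_neg hi]
      rw [Matrix.mul_apply, Matrix.of_apply, if_neg hi]
      simp only [this]
      rw [← Matrix.mul_apply, Matrix.mul_nonsing_inv _ hu]
  have hdet : (pinRows A p * A⁻¹).det = (A⁻¹.submatrix p p).det := by
    rw [hC, Matrix.twoBlockTriangular_det _ (fun i => i ∈ Set.range p)]
    · have h2 : (Matrix.toSquareBlockProp (Matrix.of fun i j =>
          if i ∈ Set.range p then A⁻¹ i j else (1 : Matrix ι ι ℂ) i j)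
            (fun i => ¬ i ∈ Set.range p)) = 1 := by
        ext ⟨i, hi⟩ ⟨j, hj⟩
        simp only [Matrix.toSquareBlockProp_def, Matrix.of_apply, if_neg hi, Matrix.one_apply,
          Subtype.mk.injEq]
      rw [h2, Matrix.det_one, mul_one]
      rw [det_toSquareBlockProp_range _ _ p hp (fun i => Iff.rfl)]
      congr 1
      ext i j
      simp
    · intro i hi j hj
      have : i ≠ j := by rintro rfl; exact hi hj
      simp only [Matrix.of_apply, if_neg hi, Matrix.one_apply_ne this]
  have := congrArg (fun t => t * A.det) hdet
  simp only [Matrix.det_mul, mul_assoc] at this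
  rw [← Matrix.det_mul, Matrix.nonsing_inv_mul _ hu, Matrix.det_one, mul_one] at this
  rw [this, mul_comm]

/-- A signed count: all permutations supported by the relation `S` have the same sign and weight. -/
theorem det_eq_sign_mul_card {ι : Type*} [Fintype ι] [DecidableEq ι] (S : ι → ι → Prop)
    [DecidableRel S] (g : ι → ℂ) (hg : ∀ i, g i * g i = 1) (s : ℤˣ)
    (hs : ∀ σ : Equiv.Perm ι, (∀ a, S a (σ a)) → Equiv.Perm.sign σ = s) :
    (Matrix.of fun b a => if S a b then g b * g a else 0).det =
      ((s : ℤ) : ℂ) * ((univ.filter fun σ : Equiv.Perm ι => ∀ a, S a (σ a)).card : ℂ) := by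
  rw [Matrix.det_apply, card_filter]
  push_cast
  rw [mul_sum]
  refine sum_congr rfl fun σ _ => ?_
  simp only [Matrix.of_apply]
  split_ifs with h
  -- Since `σ` is a bijection, `∏ g (σ i) = ∏ g i`, so the gauge factors square to `1`.
  · rw [hs σ h, prod_congr rfl (fun i _ => if_pos (h i)), prod_mul_distrib, Equiv.prod_comp σ g,
      ← prod_mul_distrib, prod_congr rfl (fun i _ => hg i)]
    simp [Units.smul_def]
  · push Not at h
    obtain ⟨a, ha⟩ := h
    rw [prod_eq_zero (mem_univ a) (if_neg ha)]
    simp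

/-! ### Permutations encoding tilings, and their paths. -/

namespace CutHexagon

variable (H : CutHexagon)

/-- The integer points of the quadrilateral, as a finite set. -/
def quad : Finset (ℕ × ℤ) :=
  (range (H.N + 1) ×ˢ Icc (-((H.d : ℤ) + H.N)) ((H.M : ℤ) - 1)).filter
    fun p => -(H.d : ℤ) ≤ p.1 + p.2

variable {H} in
theorem mem_quad {p : ℕ × ℤ} : p ∈ H.quad ↔ H.InQuad p.1 p.2 := by
  simp only [quad, InQuad, mem_filter, mem_product, mem_range, mem_Icc]
  omega

/-- The type of the integer points of the quadrilateral. -/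
abbrev Site : Type := {p : ℕ × ℤ // p ∈ H.quad}

/-- The points of the lower edge outside the cuts. -/
def freeLower : Finset ℤ := Icc (-(H.d : ℤ)) ((H.M : ℤ) - 1) \ H.Y

/-- The points of the upper edge outside the cuts. -/
def freeUpper : Finset ℤ := Icc (-(H.d : ℤ) - H.N) ((H.M : ℤ) - 1) \ H.X

theorem card_freeLower : H.freeLower.card = H.M := by
  have : H.d = H.Y.card := rfl
  rw [freeLower, this, card_sdiff_of_subset H.Y_subset, Int.card_Icc]
  omega

theorem card_freeUpper : H.freeUpper.card = H.M := by
  have : H.d = H.Y.card := rfl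
  rw [freeUpper, this, card_sdiff_of_subset H.X_subset, Int.card_Icc, H.X_card]
  omega

/-- The free points of the lower edge in increasing order. -/
def lowerEnum (j : Fin H.M) : ℤ := H.freeLower.orderEmbOfFin H.card_freeLower j

/-- The free points of the upper edge in increasing order. -/
def upperEnum (j : Fin H.M) : ℤ := H.freeUpper.orderEmbOfFin H.card_freeUpper j

theorem lowerEnum_strictMono : StrictMono H.lowerEnum :=
  (H.freeLower.orderEmbOfFin H.card_freeLower).strictMono

theorem upperEnum_strictMono : StrictMono H.upperEnum :=
  (H.freeUpper.orderEmbOfFin H.card_freeUpper).strictMono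

theorem lowerEnum_mem (j : Fin H.M) : H.lowerEnum j ∈ H.freeLower := orderEmbOfFin_mem _ _ _

theorem upperEnum_mem (j : Fin H.M) : H.upperEnum j ∈ H.freeUpper := orderEmbOfFin_mem _ _ _

theorem exists_lowerEnum {x : ℤ} (hx : x ∈ H.freeLower) : ∃ j, H.lowerEnum j = x := by
  have := range_orderEmbOfFin H.freeLower H.card_freeLower
  have hx' : x ∈ (H.freeLower : Set ℤ) := hx
  rw [← this] at hx'
  exact hx'

theorem exists_upperEnum {x : ℤ} (hx : x ∈ H.freeUpper) : ∃ j, H.upperEnum j = x := by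
  have := range_orderEmbOfFin H.freeUpper H.card_freeUpper
  have hx' : x ∈ (H.freeUpper : Set ℤ) := hx
  rw [← this] at hx'
  exact hx'

/-- The possible moves of a point in the permutation that encodes a tiling.  A red lozenge fixes
its dot, a blue or green lozenge moves to the next level; the free points of the upper edge return
to those of the lower edge. -/
def Step (a b : ℕ × ℤ) : Prop :=
  (b = a ∧ (a.1 = 0 → a.2 ∈ H.Y) ∧ (a.1 = H.N → a.2 ∈ H.X)) ∨
    (b.1 = a.1 + 1 ∧ (b.2 = a.2 ∨ b.2 = a.2 - 1)) ∨
      ∃ j, a = (H.N, H.upperEnum j) ∧ b = (0, H.lowerEnum j)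

/-- The permutations that encode the tilings. -/
def IsAllowed (σ : Equiv.Perm H.Site) : Prop := ∀ a, H.Step a.1 (σ a).1

variable {H}

theorem Site.inQuad (a : H.Site) : H.InQuad a.1.1 a.1.2 := mem_quad.1 a.2

/-- The starting point of the `j`-th path. -/
def start (j : Fin H.M) : H.Site := ⟨(0, H.lowerEnum j), mem_quad.2 <| by
  have := H.lowerEnum_mem j
  simp only [freeLower, mem_sdiff, mem_Icc] at this
  simp only [InQuad]
  omega⟩

namespace IsAllowed

variable {σ : Equiv.Perm H.Site} (hσ : H.IsAllowed σ)
include hσ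

theorem step_up {a : H.Site} (ha : σ a ≠ a) (hN : a.1.1 < H.N) :
    (σ a).1.1 = a.1.1 + 1 ∧ ((σ a).1.2 = a.1.2 ∨ (σ a).1.2 = a.1.2 - 1) := by
  rcases hσ a with h | h | ⟨j, h, -⟩
  · exact absurd (Subtype.ext h.1) ha
  · exact h
  · rw [h] at hN
    exact absurd hN (lt_irrefl _)

theorem step_top {a : H.Site} (ha : σ a ≠ a) (hN : a.1.1 = H.N) :
    ∃ j, a.1 = (H.N, H.upperEnum j) ∧ (σ a).1 = (0, H.lowerEnum j) := by
  rcases hσ a with h | h | h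
  · exact absurd (Subtype.ext h.1) ha
  · have := (σ a).inQuad.1
    omega
  · exact h

theorem symm_step {b : H.Site} (hb : σ b ≠ b) (h0 : 0 < b.1.1) :
    ∃ a, σ a = b ∧ σ a ≠ a ∧ b.1.1 = a.1.1 + 1 := by
  obtain ⟨a, rfl⟩ := σ.surjective b
  have ha : σ a ≠ a := fun h => hb (congrArg σ h)
  refine ⟨a, rfl, ha, ?_⟩
  rcases hσ a with h | h | ⟨j, -, h⟩
  · exact absurd (Subtype.ext h.1) ha
  · exact h.1
  · rw [h] at h0
    exact absurd h0 (lt_irrefl _)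

theorem symm_step_bot {b : H.Site} (hb : σ b ≠ b) (h0 : b.1.1 = 0) : ∃ j, b = start j := by
  obtain ⟨a, rfl⟩ := σ.surjective b
  have ha : σ a ≠ a := fun h => hb (congrArg σ h)
  rcases hσ a with h | h | ⟨j, -, h⟩
  · exact absurd (Subtype.ext h.1) ha
  · omega
  · exact ⟨j, Subtype.ext h⟩

theorem start_ne (hN : 0 < H.N) (j : Fin H.M) : σ (start j) ≠ start j := by
  intro h
  have hs := hσ (start j)
  rw [h] at hs
  rcases hs with h | h | ⟨i, h, -⟩
  · have := H.lowerEnum_mem j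
    simp only [freeLower, mem_sdiff] at this
    exact this.2 (h.2.1 rfl)
  · have := h.1
    omega
  · have := congrArg Prod.fst h
    simp only [start] at this
    omega

/-- In one step a path moves by `0` or `-1`, so two neighbours can only lose their strict order by
meeting, which the injectivity of `σ` forbids. -/
theorem path (hN : 0 < H.N) (k : ℕ) (hk : k ≤ H.N) :
    (∀ j, ((σ ^ k) (start j)).1.1 = k ∧ σ ((σ ^ k) (start j)) ≠ (σ ^ k) (start j)) ∧
      StrictMono fun j => ((σ ^ k) (start j)).1.2 := by
  induction k with
  | zero =>
    refine ⟨fun j => ⟨rfl, hσ.start_ne hN j⟩, fun i j hij => ?_⟩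
    exact H.lowerEnum_strictMono hij
  | succ k ih =>
    obtain ⟨h1, h2⟩ := ih (by omega)
    have hs : ∀ j, (σ ^ (k + 1)) (start j) = σ ((σ ^ k) (start j)) := fun j => by
      rw [pow_succ', Equiv.Perm.mul_apply]
    simp only [hs]
    have hu := fun j => hσ.step_up (h1 j).2 (by rw [(h1 j).1]; omega)
    refine ⟨fun j => ⟨by rw [(hu j).1, (h1 j).1], fun h => (h1 j).2 (σ.injective h)⟩, ?_⟩
    intro i j hij
    have h3 := h2 hij
    have h4 := (hu i).2
    have h5 := (hu j).2
    have h6 : (σ ((σ ^ k) (start i))).1.2 ≠ (σ ((σ ^ k) (start j))).1.2 := by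
      intro h
      have : σ ((σ ^ k) (start i)) = σ ((σ ^ k) (start j)) := by
        refine Subtype.ext (Prod.ext ?_ h)
        rw [(hu i).1, (hu j).1, (h1 i).1, (h1 j).1]
      simp only [σ.injective this] at h3
      exact lt_irrefl _ h3
    simp only at h3 ⊢
    omega

/-- The order-preserving paths induce a strictly increasing self-map of `Fin H.M`, which is the
identity. So path `j` ends at the `j`-th free upper point and is sent back to its own start. -/
theorem path_closes (hN : 0 < H.N) (j : Fin H.M) :
    σ ((σ ^ H.N) (start j)) = start j := by
  obtain ⟨h1, h2⟩ := hσ.path hN H.N le_rfl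
  choose f hf hf' using fun j => hσ.step_top (h1 j).2 (h1 j).1
  have hmono : StrictMono f := by
    intro i j hij
    have h3 := h2 hij
    simp only [hf] at h3
    exact H.upperEnum_strictMono.lt_iff_lt.1 h3
  have hid : f = id := by
    refine (hmono.range_inj strictMono_id).1 ?_
    rw [(Finite.injective_iff_surjective.1 hmono.injective).range_eq, Set.range_id]
  refine Subtype.ext ?_
  rw [hf', hid]
  rfl

/-- Tracing a moved point back level by level ends on the lower edge, where moved points are
starting points. So no cycles exist besides the `M` paths. -/
theorem exists_path (k : ℕ) :
    ∀ b : H.Site, σ b ≠ b → b.1.1 = k → ∃ j, b = (σ ^ k) (start j) := by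
  induction k with
  | zero => exact fun b hb h0 => hσ.symm_step_bot hb h0
  | succ k ih =>
    intro b hb hk
    obtain ⟨a, rfl, ha, hab⟩ := hσ.symm_step hb (by omega)
    obtain ⟨j, hj⟩ := ih a ha (by omega)
    exact ⟨j, by rw [pow_succ', Equiv.Perm.mul_apply, ← hj]⟩

/-- All permutations that encode tilings have the same sign, since each of the `M` paths closes up
to a cycle through all levels. -/
theorem sign_eq (hN : 0 < H.N) :
    Equiv.Perm.sign σ = Equiv.Perm.sign
      ((finRotate (H.N + 1)).prodCongr (Equiv.refl (Fin H.M))) := by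
  have hle : ∀ k : Fin (H.N + 1), (k : ℕ) ≤ H.N := fun k => by omega
  let θ : Fin (H.N + 1) × Fin H.M ↪ H.Site := ⟨fun q => (σ ^ (q.1 : ℕ)) (start q.2), by
    rintro ⟨k, i⟩ ⟨l, j⟩ h
    simp only at h
    have h1 := ((hσ.path hN k (hle k)).1 i).1
    rw [h, ((hσ.path hN l (hle l)).1 j).1] at h1
    have hkl : k = l := Fin.ext h1.symm
    subst hkl
    have := (hσ.path hN k (hle k)).2.injective (congrArg (fun s => s.1.2) h)
    rw [this]⟩
  -- `σ` is the level rotation transported along `θ` and extended by the identity, so its sign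
  -- depends only on `N` and `M`.
  rw [← Equiv.Perm.viaFintypeEmbedding_sign _ θ]
  congr 1
  ext1 b
  by_cases hb : σ b = b
  · rw [Equiv.Perm.viaFintypeEmbedding_apply_notMem_range, hb]
    rintro ⟨⟨k, j⟩, rfl⟩
    exact ((hσ.path hN k (hle k)).1 j).2 hb
  · obtain ⟨j, hj⟩ := hσ.exists_path b.1.1 b hb rfl
    have hk : b.1.1 < H.N + 1 := Nat.lt_succ_of_le b.inQuad.1
    have hb' : b = θ (⟨b.1.1, hk⟩, j) := hj
    generalize (⟨b.1.1, hk⟩ : Fin (H.N + 1)) = k at hb'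
    rw [hb', Equiv.Perm.viaFintypeEmbedding_apply_image]
    simp only [Equiv.prodCongr_apply, Prod.map, Equiv.refl_apply, finRotate_apply]
    change σ ((σ ^ (k : ℕ)) (start j)) = (σ ^ ((k + 1 : Fin (H.N + 1)) : ℕ)) (start j)
    rcases (Fin.le_last k).lt_or_eq with h | h
    · rw [Fin.val_add_one_of_lt h, pow_succ', Equiv.Perm.mul_apply]
    · rw [h, Fin.last_add_one, Fin.val_zero, pow_zero, Equiv.Perm.one_apply, Fin.val_last]
      exact hσ.path_closes hN j

end IsAllowed

end CutHexagon

/-! ### The bijection between tilings and allowed permutations. -/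

/-- The midpoint of the horizontal edge of the lower triangle of a lozenge. -/
def Lozenge.lo : Lozenge → ℕ × ℤ
  | .red k x => (k, x)
  | .blue k x => (k, x)
  | .green k x => (k, x)

/-- The midpoint of the horizontal edge of the upper triangle of a lozenge. -/
def Lozenge.up : Lozenge → ℕ × ℤ
  | .red k x => (k, x)
  | .blue k x => (k + 1, x)
  | .green k x => (k + 1, x - 1)

theorem Lozenge.triangles_eq (t : Lozenge) :
    t.triangles = {.lower t.lo.1 t.lo.2, .upper t.up.1 t.up.2} := by
  cases t <;> rfl

theorem Lozenge.lower_mem {t : Lozenge} {a : ℕ × ℤ} :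
    UnitTriangle.lower a.1 a.2 ∈ t.triangles ↔ t.lo = a := by
  rw [Lozenge.triangles_eq, Set.mem_insert_iff, Set.mem_singleton_iff, Prod.ext_iff]
  simp only [reduceCtorEq, or_false, UnitTriangle.lower.injEq]
  exact and_congr eq_comm eq_comm

theorem Lozenge.upper_mem {t : Lozenge} {a : ℕ × ℤ} :
    UnitTriangle.upper a.1 a.2 ∈ t.triangles ↔ t.up = a := by
  rw [Lozenge.triangles_eq, Set.mem_insert_iff, Set.mem_singleton_iff, Prod.ext_iff]
  simp only [reduceCtorEq, false_or, UnitTriangle.upper.injEq]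
  exact and_congr eq_comm eq_comm

theorem Lozenge.ext' {s t : Lozenge} (h1 : s.lo = t.lo) (h2 : s.up = t.up) : s = t := by
  cases s <;> cases t <;> simp only [Lozenge.lo, Lozenge.up, Prod.mk.injEq] at h1 h2 <;>
    first | (obtain ⟨rfl, rfl⟩ := h1; rfl) | (exfalso; omega)

theorem Lozenge.up_cases (t : Lozenge) :
    t.up = t.lo ∨ (t.up.1 = t.lo.1 + 1 ∧ (t.up.2 = t.lo.2 ∨ t.up.2 = t.lo.2 - 1)) := by
  cases t <;> simp [Lozenge.lo, Lozenge.up]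

/-- The lozenge whose lower triangle is at `a` and whose upper triangle is at `b`. -/
def stepLozenge (a b : ℕ × ℤ) : Lozenge :=
  if b = a then .red a.1 a.2 else if b.2 = a.2 then .blue a.1 a.2 else .green a.1 a.2

theorem stepLozenge_lo (a b : ℕ × ℤ) : (stepLozenge a b).lo = a := by
  unfold stepLozenge
  split_ifs <;> rfl

theorem stepLozenge_up {a b : ℕ × ℤ}
    (h : b = a ∨ (b.1 = a.1 + 1 ∧ (b.2 = a.2 ∨ b.2 = a.2 - 1))) : (stepLozenge a b).up = b := by
  unfold stepLozenge
  split_ifs with h1 h2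
  · exact h1.symm
  · rcases h with h | h
    · exact absurd h h1
    · exact Prod.ext h.1.symm h2.symm
  · rcases h with h | h
    · exact absurd h h1
    · exact Prod.ext h.1.symm (h.2.resolve_left h2).symm

namespace CutHexagon

variable {H : CutHexagon}

theorem lower_mem_region {a : ℕ × ℤ} :
    UnitTriangle.lower a.1 a.2 ∈ H.region ↔ a.1 < H.N ∧ H.InQuad a.1 a.2 ∧ ¬ H.InCut a.1 a.2 :=
  Iff.rfl

theorem upper_mem_region {a : ℕ × ℤ} :
    UnitTriangle.upper a.1 a.2 ∈ H.region ↔ 0 < a.1 ∧ H.InQuad a.1 a.2 ∧ ¬ H.InCut a.1 a.2 :=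
  Iff.rfl

theorem upperEnum_notMem (j : Fin H.M) : H.upperEnum j ∉ H.X :=
  (mem_sdiff.1 (H.upperEnum_mem j)).2

theorem lowerEnum_notMem (j : Fin H.M) : H.lowerEnum j ∉ H.Y :=
  (mem_sdiff.1 (H.lowerEnum_mem j)).2

theorem inCut_bot {x : ℤ} (hx : x ∈ H.Y) : H.InCut 0 x := by
  right
  intro j h1 h2
  have : j = x := by push_cast at h2; omega
  rwa [this]

theorem inCut_top {x : ℤ} (hx : x ∈ H.X) : H.InCut H.N x := by
  left
  intro j h1 h2
  have : j = x := by omega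
  rwa [this]

theorem d_le_N (hspan : H.yFirst - H.yLast ≤ (H.N : ℤ) - 1) : H.d ≤ H.N := by
  have h : H.Y ⊆ Icc H.yLast H.yFirst := fun y hy =>
    mem_Icc.2 ⟨H.Y.min'_le y hy, H.Y.le_max' y hy⟩
  have h2 := card_le_card h
  rw [Int.card_Icc] at h2
  have : H.d = H.Y.card := rfl
  omega

theorem d_pos : 0 < H.d := card_pos.2 H.Y_nonempty

/-- A lower cut reaching height `N` would contain `N + 1 > d` integers. -/
theorem not_inCut_top (hd : H.d ≤ H.N) {x : ℤ} (hx : x ∉ H.X) : ¬ H.InCut H.N x := by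
  rintro (h | h)
  · exact hx (h x (by omega) le_rfl)
  · have h1 : Icc x (x + H.N) ⊆ H.Y := fun j hj => h j (mem_Icc.1 hj).1 (mem_Icc.1 hj).2
    have h2 := card_le_card h1
    rw [Int.card_Icc] at h2
    have : H.d = H.Y.card := rfl
    omega

namespace IsAllowed

variable {σ : Equiv.Perm H.Site} (hσ : H.IsAllowed σ)
include hσ

/-- A moving point of an upper cut triangle would step to a point of the same triangle one level up.
That point is fixed by induction, so two points would have the same image. -/
theorem fixed_of_upperCut (i : ℕ) : ∀ b : H.Site, b.1.1 + i = H.N →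
    (∀ j : ℤ, b.1.2 - i ≤ j → j ≤ b.1.2 → j ∈ H.X) → σ b = b := by
  induction i with
  | zero =>
    intro b hb hX
    by_contra hne
    obtain ⟨j, hj, -⟩ := hσ.step_top hne (by omega)
    refine upperEnum_notMem j ?_
    have := hX b.1.2 (by simp) le_rfl
    rwa [hj] at this
  | succ i ih =>
    intro b hb hX
    by_contra hne
    obtain ⟨h1, h2⟩ := hσ.step_up hne (by omega)
    refine hne (σ.injective (ih _ (by omega) fun j hj hj' => hX j ?_ ?_))
    · push_cast
      omega
    · omega

/-- The mirror argument: the preimage of a moving point lies in the same triangle one level down. -/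
theorem fixed_of_lowerCut (k : ℕ) : ∀ b : H.Site, b.1.1 = k →
    (∀ j : ℤ, b.1.2 ≤ j → j ≤ b.1.2 + k → j ∈ H.Y) → σ b = b := by
  induction k with
  | zero =>
    intro b hb hY
    by_contra hne
    obtain ⟨j, rfl⟩ := hσ.symm_step_bot hne hb
    exact lowerEnum_notMem j (hY _ le_rfl (by simp [start]))
  | succ k ih =>
    intro b hb hY
    by_contra hne
    obtain ⟨a, rfl, ha, hab⟩ := hσ.symm_step hne (by omega)
    have hN := (σ a).inQuad.1
    have h2 := (hσ.step_up ha (by omega)).2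
    refine ha (ih a (by omega) fun j hj hj' => hY j ?_ ?_)
    · omega
    · push_cast
      omega

theorem fixed_of_inCut (b : H.Site) (hb : H.InCut b.1.1 b.1.2) : σ b = b := by
  have hN := b.inQuad.1
  rcases hb with h | h
  · refine hσ.fixed_of_upperCut (H.N - b.1.1) b (by omega) fun j hj hj' => h j ?_ hj'
    push_cast [hN] at hj
    exact hj
  · exact hσ.fixed_of_lowerCut b.1.1 b rfl h

end IsAllowed

/-- The tiling that is encoded by a permutation. -/
def tilingOf (σ : Equiv.Perm H.Site) : Finset Lozenge :=
  open Classical in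
  (univ.filter fun a : H.Site => a.1.1 < H.N ∧ ¬ H.InCut a.1.1 a.1.2).image
    fun a => stepLozenge a.1 (σ a).1

theorem mem_tilingOf {σ : Equiv.Perm H.Site} (hσ : H.IsAllowed σ) {t : Lozenge} :
    t ∈ tilingOf σ ↔ ∃ a : H.Site, a.1.1 < H.N ∧ ¬ H.InCut a.1.1 a.1.2 ∧
      t.lo = a.1 ∧ t.up = (σ a).1 := by
  have hup : ∀ a : H.Site, a.1.1 < H.N → (stepLozenge a.1 (σ a).1).up = (σ a).1 := by
    intro a ha
    refine stepLozenge_up ?_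
    by_cases h : σ a = a
    · exact Or.inl (congrArg Subtype.val h)
    · exact Or.inr (hσ.step_up h ha)
  simp only [tilingOf, mem_image, mem_filter, mem_univ, true_and]
  constructor
  · rintro ⟨a, ⟨h1, h2⟩, rfl⟩
    exact ⟨a, h1, h2, stepLozenge_lo _ _, hup a h1⟩
  · rintro ⟨a, h1, h2, h3, h4⟩
    exact ⟨a, ⟨h1, h2⟩, Lozenge.ext' ((stepLozenge_lo _ _).trans h3.symm)
      ((hup a h1).trans h4.symm)⟩

theorem tilingOf_mem (hN : 0 < H.N) {σ : Equiv.Perm H.Site} (hσ : H.IsAllowed σ) :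
    tilingOf σ ∈ H.tilings := by
  have hbot : ∀ a : H.Site, ¬ H.InCut a.1.1 a.1.2 → σ a = a → 0 < a.1.1 ∧ a.1.1 ≠ H.N := by
    intro a ha h
    rcases hσ a with h' | h' | ⟨j, h1, h2⟩
    · refine ⟨Nat.pos_of_ne_zero fun h0 => ha ?_, fun h0 => ha ?_⟩
      · rw [h0]
        exact inCut_bot (h'.2.1 h0)
      · rw [h0]
        exact inCut_top (h'.2.2 h0)
    · rw [h] at h'
      omega
    · rw [h, h1] at h2
      have := congrArg Prod.fst h2
      simp only at this
      omega
  refine ⟨fun t ht => ?_, fun c hc => ?_⟩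
  · obtain ⟨a, haN, haC, h1, h2⟩ := (mem_tilingOf hσ).1 ht
    rw [Lozenge.triangles_eq, h1, h2]
    rintro c (rfl | rfl)
    · exact lower_mem_region.2 ⟨haN, a.inQuad, haC⟩
    · refine upper_mem_region.2 ⟨?_, (σ a).inQuad, fun hC => ?_⟩
      · by_cases h : σ a = a
        · rw [h]
          exact (hbot a haC h).1
        · rw [(hσ.step_up h haN).1]
          omega
      · have h3 : σ a = a := σ.injective (hσ.fixed_of_inCut _ hC)
        rw [h3] at hC
        exact haC hC
  · cases c with
    | lower k x =>
      obtain ⟨h1, h2, h3⟩ := (lower_mem_region (a := (k, x))).1 hc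
      let a : H.Site := ⟨(k, x), mem_quad.2 h2⟩
      have ht : stepLozenge a.1 (σ a).1 ∈ tilingOf σ := by
        classical
        exact mem_image.2 ⟨a, mem_filter.2 ⟨mem_univ _, h1, h3⟩, rfl⟩
      refine ⟨_, ⟨ht, (Lozenge.lower_mem (a := (k, x))).2 (stepLozenge_lo _ _)⟩, ?_⟩
      rintro s ⟨hs, hs'⟩
      obtain ⟨b, hbN, hbC, h4, h5⟩ := (mem_tilingOf hσ).1 hs
      obtain ⟨b', hbN', hbC', h4', h5'⟩ := (mem_tilingOf hσ).1 ht
      have h6 := (Lozenge.lower_mem (a := (k, x))).1 hs'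
      have h7 : b = a := Subtype.ext (h4.symm.trans h6)
      have h8 : b' = a := Subtype.ext (h4'.symm.trans (stepLozenge_lo _ _))
      rw [h7] at h4 h5
      rw [h8] at h4' h5'
      exact Lozenge.ext' (h4.trans h4'.symm) (h5.trans h5'.symm)
    | upper k x =>
      obtain ⟨h1, h2, h3⟩ := (upper_mem_region (a := (k, x))).1 hc
      obtain ⟨a, ha⟩ := σ.surjective ⟨(k, x), mem_quad.2 h2⟩
      have ha' : (σ a).1 = (k, x) := by rw [ha]
      have haC : ¬ H.InCut a.1.1 a.1.2 := fun hC => by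
        rw [hσ.fixed_of_inCut a hC] at ha'
        rw [ha'] at hC
        exact h3 hC
      have haN : a.1.1 < H.N := by
        refine lt_of_le_of_ne a.inQuad.1 fun hN' => ?_
        by_cases h : σ a = a
        · exact (hbot a haC h).2 hN'
        · obtain ⟨j, -, h4⟩ := hσ.step_top h hN'
          rw [h4] at ha'
          have := congrArg Prod.fst ha'
          simp only at this h1
          omega
      have ht : stepLozenge a.1 (σ a).1 ∈ tilingOf σ := by
        classical
        exact mem_image.2 ⟨a, mem_filter.2 ⟨mem_univ _, haN, haC⟩, rfl⟩
      have huniq : ∀ s ∈ tilingOf σ, s.up = (k, x) → s.lo = a.1 ∧ s.up = (σ a).1 := by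
        intro s hs h6
        obtain ⟨b, hbN, hbC, h4, h5⟩ := (mem_tilingOf hσ).1 hs
        have h7 : b = a := σ.injective (Subtype.ext (h5.symm.trans (h6.trans ha'.symm)))
        rw [h7] at h4 h5
        exact ⟨h4, h5⟩
      have htu : (stepLozenge a.1 (σ a).1).up = (k, x) := by
        obtain ⟨b, hbN, hbC, h4, h5⟩ := (mem_tilingOf hσ).1 ht
        have h8 : b = a := Subtype.ext (h4.symm.trans (stepLozenge_lo _ _))
        rw [h8] at h5
        exact h5.trans ha'
      refine ⟨_, ⟨ht, (Lozenge.upper_mem (a := (k, x))).2 htu⟩, ?_⟩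
      rintro s ⟨hs, hs'⟩
      have h6 := huniq s hs ((Lozenge.upper_mem (a := (k, x))).1 hs')
      have h7 := huniq _ ht htu
      exact Lozenge.ext' (h6.1.trans h7.1.symm) (h6.2.trans h7.2.symm)

theorem mem_redDots_tilingOf (hN : 0 < H.N) {σ : Equiv.Perm H.Site}
    (hσ : H.IsAllowed σ) (a : H.Site) : a.1 ∈ H.redDots (tilingOf σ) ↔ σ a = a := by
  constructor
  · rintro (h | h)
    · obtain ⟨b, -, -, h1, h2⟩ := (mem_tilingOf hσ).1 h
      have h3 : b = a := Subtype.ext h1.symm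
      rw [h3] at h2
      exact Subtype.ext h2.symm
    · exact hσ.fixed_of_inCut a h.2
  · intro h
    by_cases hC : H.InCut a.1.1 a.1.2
    · exact Or.inr ⟨a.inQuad, hC⟩
    · left
      refine (mem_tilingOf hσ).2 ⟨a, lt_of_le_of_ne a.inQuad.1 fun hN' => ?_, hC, rfl, ?_⟩
      · rcases hσ a with h' | h' | ⟨j, h1, h2⟩
        · rw [hN'] at hC
          exact hC (inCut_top (h'.2.2 hN'))
        · rw [h] at h'
          omega
        · rw [h, h1] at h2
          have := congrArg Prod.fst h2
          simp only at this
          omega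
      · rw [h]
        rfl

theorem tilingOf_injOn (hN0 : 0 < H.N) :
    Set.InjOn (tilingOf (H := H)) {σ | H.IsAllowed σ} := by
  intro σ hσ τ hτ h
  ext1 a
  by_cases hC : H.InCut a.1.1 a.1.2
  · rw [IsAllowed.fixed_of_inCut hσ a hC, IsAllowed.fixed_of_inCut hτ a hC]
  rcases lt_or_eq_of_le a.inQuad.1 with hN | hN
  · have ht : stepLozenge a.1 (σ a).1 ∈ tilingOf σ := by
      classical
      exact mem_image.2 ⟨a, mem_filter.2 ⟨mem_univ _, hN, hC⟩, rfl⟩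
    have ht' := ht
    rw [h] at ht'
    obtain ⟨b, -, -, h1, h2⟩ := (mem_tilingOf hσ).1 ht
    obtain ⟨c, -, -, h3, h4⟩ := (mem_tilingOf hτ).1 ht'
    have hb : b = a := Subtype.ext (h1.symm.trans (stepLozenge_lo _ _))
    have hc : c = a := Subtype.ext (h3.symm.trans (stepLozenge_lo _ _))
    rw [hb] at h2
    rw [hc] at h4
    exact Subtype.ext (h2.symm.trans h4)
  · have key : ∀ {ρ : Equiv.Perm H.Site}, H.IsAllowed ρ → ρ a ≠ a := by
      intro ρ hρ h'
      rcases hρ a with h1 | h1 | ⟨j, h1, h2⟩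
      · rw [hN] at hC
        exact hC (inCut_top (h1.2.2 hN))
      · have := (ρ a).inQuad.1
        omega
      · rw [h', h1] at h2
        have h3 := congrArg Prod.fst h2
        simp only at h3
        omega
    obtain ⟨i, h1, h2⟩ := IsAllowed.step_top hσ (key hσ) hN
    obtain ⟨j, h3, h4⟩ := IsAllowed.step_top hτ (key hτ) hN
    rw [h1] at h3
    have : i = j := H.upperEnum_strictMono.injective (congrArg Prod.snd h3)
    rw [this] at h2
    exact Subtype.ext (h2.trans h4.symm)

/-- The permutation fixes the cuts, sends the lower triangle of each lozenge to its upper triangle,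
and closes the paths at the top. It is surjective because every upper triangle of the region is
covered, and finiteness makes it bijective. -/
theorem exists_isAllowed (hN : 0 < H.N) (hd : H.d ≤ H.N) {T : Finset Lozenge}
    (hT : T ∈ H.tilings) : ∃ σ : Equiv.Perm H.Site, H.IsAllowed σ ∧ tilingOf σ = T := by
  have hlo : ∀ t ∈ T, t.lo.1 < H.N ∧ H.InQuad t.lo.1 t.lo.2 ∧ ¬ H.InCut t.lo.1 t.lo.2 :=
    fun t ht => lower_mem_region.1 (hT.1 t ht (Lozenge.lower_mem.2 rfl))
  have hup : ∀ t ∈ T, 0 < t.up.1 ∧ H.InQuad t.up.1 t.up.2 ∧ ¬ H.InCut t.up.1 t.up.2 :=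
    fun t ht => upper_mem_region.1 (hT.1 t ht (Lozenge.upper_mem.2 rfl))
  have hex : ∀ a : H.Site, ∃ b : H.Site,
      (H.InCut a.1.1 a.1.2 ∧ b = a) ∨
      (¬ H.InCut a.1.1 a.1.2 ∧ a.1.1 < H.N ∧ ∃ t ∈ T, t.lo = a.1 ∧ t.up = b.1) ∨
      (¬ H.InCut a.1.1 a.1.2 ∧ ∃ j, a.1 = (H.N, H.upperEnum j) ∧ b = start j) := by
    intro a
    by_cases hC : H.InCut a.1.1 a.1.2
    · exact ⟨a, Or.inl ⟨hC, rfl⟩⟩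
    rcases lt_or_eq_of_le a.inQuad.1 with hN' | hN'
    · obtain ⟨t, ⟨ht, ht'⟩, -⟩ := hT.2 _ (lower_mem_region.2 ⟨hN', a.inQuad, hC⟩)
      exact ⟨⟨t.up, mem_quad.2 (hup t ht).2.1⟩,
        Or.inr (Or.inl ⟨hC, hN', t, ht, Lozenge.lower_mem.1 ht', rfl⟩)⟩
    · have hX : a.1.2 ∉ H.X := fun h => hC (by rw [hN']; exact inCut_top h)
      have hq := a.inQuad
      obtain ⟨j, hj⟩ := H.exists_upperEnum (x := a.1.2) (by
        simp only [freeUpper, mem_sdiff, mem_Icc]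
        unfold InQuad at hq
        refine ⟨?_, hX⟩
        omega)
      exact ⟨start j, Or.inr (Or.inr ⟨hC, j, Prod.ext hN' hj.symm, rfl⟩)⟩
  choose s hs using hex
  have htop : ∀ j, s ⟨(H.N, H.upperEnum j), mem_quad.2 (by
      have := H.upperEnum_mem j
      simp only [freeUpper, mem_sdiff, mem_Icc] at this
      simp only [InQuad]
      omega)⟩ = start j := by
    intro j
    rcases hs ⟨(H.N, H.upperEnum j), _⟩ with h | h | ⟨-, i, h, h'⟩
    · exact absurd h.1 (not_inCut_top hd (upperEnum_notMem j))
    · exact absurd h.2.1 (lt_irrefl _)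
    · rw [h']
      have : j = i := H.upperEnum_strictMono.injective (congrArg Prod.snd h)
      rw [this]
  have hsurj : Function.Surjective s := by
    intro b
    by_cases hC : H.InCut b.1.1 b.1.2
    · refine ⟨b, ?_⟩
      rcases hs b with h | h | h
      · exact h.2
      · exact absurd hC h.1
      · exact absurd hC h.1
    rcases Nat.eq_zero_or_pos b.1.1 with h0 | h0
    · have hY : b.1.2 ∉ H.Y := fun h => hC (by rw [h0]; exact inCut_bot h)
      have hq := b.inQuad
      obtain ⟨j, hj⟩ := H.exists_lowerEnum (x := b.1.2) (by
        simp only [freeLower, mem_sdiff, mem_Icc]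
        unfold InQuad at hq
        refine ⟨?_, hY⟩
        omega)
      refine ⟨_, (htop j).trans (Subtype.ext ?_)⟩
      exact Prod.ext h0.symm hj
    · obtain ⟨t, ⟨ht, ht'⟩, -⟩ := hT.2 _ (upper_mem_region.2 ⟨h0, b.inQuad, hC⟩)
      have hl := hlo t ht
      refine ⟨⟨t.lo, mem_quad.2 hl.2.1⟩, ?_⟩
      rcases hs ⟨t.lo, mem_quad.2 hl.2.1⟩ with h | ⟨-, -, t', ht1, ht2, ht3⟩ | ⟨-, j, h, -⟩
      · exact absurd h.1 hl.2.2
      · have : t' = t := (hT.2 _ (lower_mem_region.2 hl)).unique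
          ⟨ht1, Lozenge.lower_mem.2 ht2⟩ ⟨ht, Lozenge.lower_mem.2 rfl⟩
        rw [this, Lozenge.upper_mem.1 ht'] at ht3
        exact Subtype.ext ht3.symm
      · have h1 := congrArg Prod.fst h
        simp only at h1
        omega
  have hinj : Function.Injective s := Finite.injective_iff_surjective.2 hsurj
  have hbij : Function.Bijective s := ⟨hinj, hsurj⟩
  have hσ : H.IsAllowed (Equiv.ofBijective s hbij) := by
    intro a
    rw [Equiv.ofBijective_apply]
    rcases hs a with ⟨hC, h⟩ | ⟨-, -, t, ht, h1, h2⟩ | ⟨-, j, h1, h2⟩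
    · refine Or.inl ⟨congrArg Subtype.val h, fun h0 => ?_, fun hN' => ?_⟩
      -- A point of the lower edge outside `Y` could only lie in an upper cut that reaches height
      -- `0`. It would then be fixed and also be the image of a free upper point, against
      -- injectivity.
      · by_contra hY
        have hq := a.inQuad
        obtain ⟨j, hj⟩ := H.exists_lowerEnum (x := a.1.2) (by
          simp only [freeLower, mem_sdiff, mem_Icc]
          unfold InQuad at hq
          refine ⟨?_, hY⟩
          omega)
        have ha : a = start j := Subtype.ext (Prod.ext h0 hj.symm)
        have h2 := hinj ((htop j).trans (ha.symm.trans h.symm))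
        have h3 := congrArg (fun c : H.Site => c.1.1) h2
        simp only at h3
        omega
      · by_contra hX
        rw [hN'] at hC
        exact not_inCut_top hd hX hC
    · rw [← h1, ← h2]
      rcases t.up_cases with h | h
      · refine Or.inl ⟨h, fun h0 => ?_, fun h0 => ?_⟩
        · have := (hup t ht).1
          rw [h] at this
          omega
        · have := (hlo t ht).1
          omega
      · exact Or.inr (Or.inl h)
    · exact Or.inr (Or.inr ⟨j, h1, congrArg Subtype.val h2⟩)
  refine ⟨_, hσ, ?_⟩
  ext t
  rw [mem_tilingOf hσ]
  constructor
  · rintro ⟨a, haN, haC, h1, h2⟩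
    rw [Equiv.ofBijective_apply] at h2
    rcases hs a with h | ⟨-, -, t', ht, h3, h4⟩ | ⟨-, j, h, -⟩
    · exact absurd h.1 haC
    · have : t = t' := Lozenge.ext' (h1.trans h3.symm) (h2.trans h4.symm)
      rwa [this]
    · rw [h] at haN
      exact absurd haN (lt_irrefl _)
  · intro ht
    have hl := hlo t ht
    refine ⟨⟨t.lo, mem_quad.2 hl.2.1⟩, hl.1, hl.2.2, rfl, ?_⟩
    rw [Equiv.ofBijective_apply]
    rcases hs ⟨t.lo, mem_quad.2 hl.2.1⟩ with h | ⟨-, -, t', ht1, ht2, ht3⟩ | ⟨-, j, h, -⟩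
    · exact absurd h.1 hl.2.2
    · have : t' = t := (hT.2 _ (lower_mem_region.2 hl)).unique
        ⟨ht1, Lozenge.lower_mem.2 ht2⟩ ⟨ht, Lozenge.lower_mem.2 rfl⟩
      rw [← ht3, this]
    · have h1 := congrArg Prod.fst h
      have h2 := hl.1
      simp only at h1
      omega

theorem ncard_tilings (hN : 0 < H.N) (hd : H.d ≤ H.N) {κ : Type*} (p : κ → H.Site) :
    {T ∈ H.tilings | ∀ i, (p i).1 ∈ H.redDots T}.ncard =
      {σ : Equiv.Perm H.Site | H.IsAllowed σ ∧ ∀ i, σ (p i) = p i}.ncard := by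
  rw [← ((tilingOf_injOn hN).mono fun σ hσ => hσ.1).ncard_image]
  congr 1
  ext T
  constructor
  · rintro ⟨hT, hp⟩
    obtain ⟨σ, hσ, rfl⟩ := exists_isAllowed hN hd hT
    exact ⟨σ, ⟨hσ, fun i => (mem_redDots_tilingOf hN hσ _).1 (hp i)⟩, rfl⟩
  · rintro ⟨σ, ⟨hσ, hp⟩, rfl⟩
    exact ⟨tilingOf_mem hN hσ, fun i => (mem_redDots_tilingOf hN hσ _).2 (hp i)⟩

/-! ### The Kasteleyn matrix and its inverse as correlation kernel. -/

/-- The gauge sign of a point. -/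
def gauge (a : ℕ × ℤ) : ℂ := (-1) ^ ((a.1 : ℤ) + a.2)

theorem gauge_mul_self (a : ℕ × ℤ) : gauge a * gauge a = 1 := by
  rw [gauge, ← mul_zpow]
  simp

theorem gauge_succ (k : ℕ) (x : ℤ) : gauge (k + 1, x) * gauge (k, x) = -1 := by
  have : gauge (k + 1, x) = -gauge (k, x) := by
    simp only [gauge]
    rw [show ((k + 1 : ℕ) : ℤ) + x = ((k : ℤ) + x) + 1 by push_cast; ring,
      zpow_add_one₀ (by norm_num)]
    ring
  rw [this, neg_mul, gauge_mul_self]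

theorem gauge_diag (k : ℕ) (x : ℤ) : gauge (k + 1, x) * gauge (k, x + 1) = 1 := by
  have : gauge (k + 1, x) = gauge (k, x + 1) := by
    simp only [gauge]
    congr 1
    push_cast
    ring
  rw [this, gauge_mul_self]

variable (H) in
/-- The Kasteleyn matrix of the quadrilateral. -/
def kasteleyn : Matrix H.Site H.Site ℂ :=
  open Classical in
  Matrix.of fun b a => if H.Step a.1 b.1 then gauge b.1 * gauge a.1 else 0

theorem det_eq_sign_mul_ncard (hN : 0 < H.N) (S : H.Site → H.Site → Prop)
    (hS : ∀ a b, S a b → H.Step a.1 b.1) :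
    (open Classical in
      Matrix.of fun b a : H.Site => if S a b then gauge b.1 * gauge a.1 else 0).det =
      ((Equiv.Perm.sign ((finRotate (H.N + 1)).prodCongr (Equiv.refl (Fin H.M))) : ℤ) : ℂ) *
        ({σ : Equiv.Perm H.Site | ∀ a, S a (σ a)}.ncard : ℂ) := by
  classical
  rw [Set.ncard_eq_toFinset_card']
  convert det_eq_sign_mul_card S (fun a : H.Site => gauge a.1) (fun a => gauge_mul_self _) _
    (fun σ h => IsAllowed.sign_eq (fun a => hS _ _ (h a)) hN) using 3
  congr 1
  ext σ
  simp

theorem det_kasteleyn_ne_zero (hN : 0 < H.N) (hd : H.d ≤ H.N) (hT : H.tilings.Nonempty) :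
    H.kasteleyn.det ≠ 0 := by
  unfold kasteleyn
  rw [det_eq_sign_mul_ncard hN _ fun a b h => h]
  obtain ⟨T, hT⟩ := hT
  obtain ⟨σ, hσ, -⟩ := exists_isAllowed hN hd hT
  refine mul_ne_zero (by norm_cast; exact Units.ne_zero _) ?_
  rw [Nat.cast_ne_zero]
  exact Set.ncard_ne_zero_of_mem (a := σ) hσ

/-- The red dots form a determinantal process whose kernel is the inverse Kasteleyn matrix. -/
theorem correlation_eq_det_inv (hN : 0 < H.N) (hd : H.d ≤ H.N) (hT : H.tilings.Nonempty) {k : ℕ}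
    (p : Fin k → H.Site) (hp : Function.Injective p) (hstep : ∀ i, H.Step (p i).1 (p i).1) :
    (H.correlation (fun i => (p i).1) : ℂ) = (H.kasteleyn⁻¹.submatrix p p).det := by
  classical
  have hdet := det_kasteleyn_ne_zero hN hd hT
  have h1 := det_pinRows _ hdet p hp
  -- A pinned row keeps only its diagonal entry `1`, which is the gauge weight of an allowed fixed
  -- point. So the pinned matrix is again a signed count, for the smaller set of moves.
  have h2 : pinRows H.kasteleyn p = Matrix.of fun b a : H.Site =>
      if (H.Step a.1 b.1 ∧ (b ∈ Set.range p → b = a)) then gauge b.1 * gauge a.1 else 0 := by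
    ext b a
    simp only [pinRows, kasteleyn, Matrix.of_apply]
    by_cases hb : b ∈ Set.range p
    · rw [if_pos hb]
      by_cases hba : b = a
      · subst hba
        obtain ⟨i, rfl⟩ := hb
        rw [Matrix.one_apply_eq, if_pos ⟨hstep i, fun _ => rfl⟩, gauge_mul_self]
      · rw [Matrix.one_apply_ne hba, if_neg fun h => hba (h.2 hb)]
    · rw [if_neg hb]
      simp [hb]
  have h3 := det_eq_sign_mul_ncard hN
    (fun a b : H.Site => H.Step a.1 b.1 ∧ (b ∈ Set.range p → b = a)) fun a b h => h.1
  have h4 : {σ : Equiv.Perm H.Site | ∀ a, H.Step a.1 (σ a).1 ∧ (σ a ∈ Set.range p → σ a = a)} =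
      {σ : Equiv.Perm H.Site | H.IsAllowed σ ∧ ∀ i, σ (p i) = p i} := by
    ext σ
    constructor
    · intro h
      refine ⟨fun a => (h a).1, fun i => ?_⟩
      have := (h (σ.symm (p i))).2 (by rw [Equiv.apply_symm_apply]; exact ⟨i, rfl⟩)
      rw [Equiv.apply_symm_apply] at this
      nth_rewrite 1 [this]
      rw [Equiv.apply_symm_apply]
    · rintro ⟨h, h'⟩ a
      refine ⟨h a, ?_⟩
      rintro ⟨i, hi⟩
      rw [← h' i] at hi
      rw [← σ.injective hi, h' i]
  have h5 := ncard_tilings hN hd p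
  have h6 := ncard_tilings hN hd (fun i : Fin 0 => i.elim0 : Fin 0 → H.Site)
  simp only [IsEmpty.forall_iff, and_true, Set.ofPred_mem_eq] at h6
  have h7 : H.kasteleyn.det = _ := det_eq_sign_mul_ncard hN _ fun a b h => h
  have h8 : {σ : Equiv.Perm H.Site | ∀ a, H.Step a.1 (σ a).1} = {σ | H.IsAllowed σ} := rfl
  have h3' : (pinRows H.kasteleyn p).det = _ := (by rw [h2]; convert rfl : _ = _).trans h3
  rw [h3', h4, ← h5, h7, h8, ← h6, mul_assoc] at h1
  have hs : (((Equiv.Perm.sign ((finRotate (H.N + 1)).prodCongr (Equiv.refl (Fin H.M))) : ℤˣ) : ℤ)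
      : ℂ) ≠ 0 := by
    norm_cast
    exact Units.ne_zero _
  have h9 := mul_left_cancel₀ hs h1
  have h10 : (H.tilings.ncard : ℂ) ≠ 0 := by
    rw [h7, h8, ← h6] at hdet
    exact right_ne_zero_of_mul hdet
  rw [correlation]
  push_cast
  rw [h9, mul_div_cancel_left₀ _ h10]

/-- At a free point of the lower or upper edge there is no red dot. -/
theorem correlation_eq_zero (hN : 0 < H.N) (hd : H.d ≤ H.N) {k : ℕ}
    (p : Fin k → H.Site) (i : Fin k) (hi : ¬ H.Step (p i).1 (p i).1) :
    H.correlation (fun i => (p i).1) = 0 := by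
  rw [correlation, ncard_tilings hN hd p]
  have : {σ : Equiv.Perm H.Site | H.IsAllowed σ ∧ ∀ i, σ (p i) = p i} = ∅ := by
    ext σ
    simp only [Set.mem_ofPred_eq, Set.mem_empty_iff_false, iff_false, not_and]
    intro hσ h
    have := hσ (p i)
    rw [h i] at this
    exact hi this
  rw [this]
  simp

/-- The triangular recurrence with its boundary conditions is the linear system of the Kasteleyn
matrix. -/
theorem kasteleyn_mulVec (φ s : ℕ → ℤ → ℂ) (hN : 0 < H.N)
    (hrec : ∀ k x, k < H.N → H.InQuad (k + 1) x → φ (k + 1) x - φ k x + φ k (x + 1) = s (k + 1) x)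
    (hleft : ∀ k, k < H.N → φ k (-(H.d : ℤ) - k - 1) = 0)
    (hright : ∀ k, k < H.N → φ k H.M = 0)
    (hbot : ∀ y ∈ H.Y, φ 0 y = s 0 y) (hbot' : ∀ y ∉ H.Y, s 0 y = 0)
    (htop : ∀ x ∉ H.X, φ H.N x = 0) :
    H.kasteleyn.mulVec (fun a => φ a.1.1 a.1.2) = fun a => s a.1.1 a.1.2 := by
  classical
  have hsum : ∀ k x, k ≤ H.N → (¬ H.InQuad k x → φ k x = 0) →
      ∑ a : H.Site, (if a.1 = (k, x) then φ a.1.1 a.1.2 else 0) = φ k x := by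
    intro k x hk h
    by_cases hq : H.InQuad k x
    · rw [sum_eq_single (⟨(k, x), mem_quad.2 hq⟩ : H.Site), if_pos rfl]
      · intro b _ hb
        exact if_neg fun h' => hb (Subtype.ext h')
      · exact fun h' => absurd (mem_univ _) h'
    · rw [h hq]
      refine sum_eq_zero fun a _ => if_neg fun h' => hq ?_
      have := a.inQuad
      rwa [h'] at this
  funext b
  obtain ⟨⟨k, x⟩, hb⟩ := b
  have hq : H.InQuad k x := mem_quad.1 hb
  rw [Matrix.mulVec, dotProduct]
  rcases k with _ | k
  · by_cases hY : x ∈ H.Y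
    · rw [← hbot x hY, ← hsum 0 x (Nat.zero_le _) fun h => absurd hq h]
      refine sum_congr rfl fun a _ => ?_
      simp only [kasteleyn, Matrix.of_apply]
      by_cases ha : a.1 = (0, x)
      · rw [if_pos ha, if_pos, ha, gauge_mul_self, one_mul]
        left
        rw [ha]
        exact ⟨rfl, fun _ => hY, fun h => by simp only at h; omega⟩
      · rw [if_neg ha, if_neg, zero_mul]
        rintro (h | h | ⟨j, h1, h2⟩)
        · exact ha h.1.symm
        · simp at h
        · have := congrArg Prod.snd h2
          simp only at this
          exact lowerEnum_notMem j (this ▸ hY)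
    · rw [hbot' x hY]
      refine sum_eq_zero fun a _ => ?_
      simp only [kasteleyn, Matrix.of_apply]
      split_ifs with h
      · rcases h with h | h | ⟨j, h1, h2⟩
        · rw [← h.1] at h
          exact absurd (h.2.1 rfl) hY
        · simp at h
        -- The row of a free lower point contains only the closing move, which reads `φ` at a free
        -- upper point.
        · rw [h1, htop _ (upperEnum_notMem j), mul_zero]
      · rw [zero_mul]
  · have hk : k < H.N := hq.1
    rw [← hrec k x hk hq]
    have e1 := hsum (k + 1) x hk fun h => absurd hq h
    have e2 := hsum k x hk.le fun h => by
      have : x = -(H.d : ℤ) - k - 1 := by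
        unfold InQuad at h hq
        push_cast at hq
        omega
      rw [this]
      exact hleft k hk
    have e3 := hsum k (x + 1) hk.le fun h => by
      have : x + 1 = H.M := by
        unfold InQuad at h hq
        push_cast at hq
        omega
      rw [this]
      exact hright k hk
    rw [← e1, ← e2, ← e3, ← sum_sub_distrib, ← sum_add_distrib]
    refine sum_congr rfl fun a _ => ?_
    simp only [kasteleyn, Matrix.of_apply]
    by_cases h1 : a.1 = (k + 1, x)
    · have h2 : a.1 ≠ (k, x) := by rw [h1]; simp
      have h3 : a.1 ≠ (k, x + 1) := by rw [h1]; simp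
      rw [if_pos h1, if_neg h2, if_neg h3, h1]
      simp only [sub_zero, add_zero]
      split_ifs with h
      · rw [gauge_mul_self, one_mul]
      · rw [zero_mul]
        have : k + 1 = H.N ∧ x ∉ H.X := by
          by_contra hc
          refine h (Or.inl ⟨rfl, fun h => by simp at h, fun h => ?_⟩)
          by_contra hx
          exact hc ⟨h, hx⟩
        rw [this.1]
        exact (htop x this.2).symm
    · by_cases h2 : a.1 = (k, x)
      · have h3 : a.1 ≠ (k, x + 1) := by rw [h2]; simp
        have hs : H.Step (k, x) (k + 1, x) := Or.inr (Or.inl ⟨rfl, Or.inl rfl⟩)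
        rw [if_neg h1, if_pos h2, if_neg h3, h2, if_pos hs,
          gauge_succ]
        ring
      · by_cases h3 : a.1 = (k, x + 1)
        · have hs : H.Step (k, x + 1) (k + 1, x) := Or.inr (Or.inl ⟨rfl, Or.inr (by simp)⟩)
          rw [if_neg h1, if_neg h2, if_pos h3, h3, if_pos hs, gauge_diag]
          ring
        · rw [if_neg h1, if_neg h2, if_neg h3, if_neg]
          · ring
          · rintro (h | h | ⟨j, -, h⟩)
            · exact h1 h.1.symm
            · have e : a.1 = (a.1.1, a.1.2) := rfl
              simp only at h
              rcases h.2 with h' | h'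
              · exact h2 (Prod.ext (by simp only; omega) h'.symm)
              · exact h3 (Prod.ext (by simp only; omega) (by simp only; omega))
            · simp at h

end CutHexagon

/-! ### Binomial polynomials, their truncations and backward differences. -/

theorem rising_succ_right (z : ℂ) (k : ℕ) : rising z (k + 1) = rising z k * (z + k) := by
  simp [rising, ascPochhammer_succ_eval]

theorem rising_succ_left (z : ℂ) (k : ℕ) : rising z (k + 1) = z * rising (z + 1) k := by
  simp [rising, ascPochhammer_succ_left, Polynomial.eval_comp]

theorem rising_zero (z : ℂ) : rising z 0 = 1 := by simp [rising]

theorem rising_eq_prod (z : ℂ) (k : ℕ) : rising z k = ∏ i ∈ range k, (z + i) := by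
  induction k with
  | zero => simp [rising_zero]
  | succ k ih => rw [rising_succ_right, prod_range_succ, ih]

/-- The polynomial `(s + 1)_J / J!`. -/
def binom (J : ℕ) (s : ℂ) : ℂ := rising (s + 1) J / (J.factorial : ℂ)

/-- The function `(s + 1)_J / J!` on the integers, cut off at negative integers. -/
def truncBinom (J : ℕ) (s : ℤ) : ℂ := if 0 ≤ s then binom J s else 0

theorem binom_zero (s : ℂ) : binom 0 s = 1 := by simp [binom, rising_zero]

theorem binom_succ_sub (J : ℕ) (s : ℂ) : binom (J + 1) s - binom (J + 1) (s - 1) = binom J s := by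
  have hJ : (J.factorial : ℂ) ≠ 0 := by exact_mod_cast J.factorial_ne_zero
  have hJ' : ((J : ℂ) + 1) ≠ 0 := by exact_mod_cast J.succ_ne_zero
  have h2 : rising (s - 1 + 1) (J + 1) = s * rising (s + 1) J := by
    rw [rising_succ_left]
    congr 2 <;> ring
  rw [binom, binom, binom, rising_succ_right, h2, Nat.factorial_succ]
  push_cast
  field_simp
  ring

theorem binom_eq_zero {J : ℕ} {s : ℤ} (h1 : -(J : ℤ) ≤ s) (h2 : s < 0) : binom J s = 0 := by
  rw [binom, rising_eq_prod, prod_eq_zero (i := (-s - 1).toNat), zero_div]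
  · rw [mem_range]
    omega
  · have h3 : (((-s - 1).toNat : ℤ) : ℂ) = ((-s - 1 : ℤ) : ℂ) := by
      rw [Int.toNat_of_nonneg (by omega)]
    rw [← Int.cast_natCast, h3]
    push_cast
    ring

/-- The zeros `-1, …, -J` of the polynomial hide the truncation; all boundary conditions rest on
this. -/
theorem truncBinom_eq_binom {J : ℕ} {s : ℤ} (h : -(J : ℤ) ≤ s) : truncBinom J s = binom J s := by
  unfold truncBinom
  split_ifs with h0
  · rfl
  · exact (binom_eq_zero h (by omega)).symm

theorem truncBinom_of_neg {J : ℕ} {s : ℤ} (h : s < 0) : truncBinom J s = 0 :=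
  if_neg (by omega)

theorem truncBinom_succ_sub (J : ℕ) (s : ℤ) :
    truncBinom (J + 1) s - truncBinom (J + 1) (s - 1) = truncBinom J s := by
  by_cases h : 0 ≤ s
  · rw [truncBinom_eq_binom (by omega), truncBinom_eq_binom (by push_cast; omega),
      truncBinom_eq_binom (by omega), ← binom_succ_sub J]
    push_cast
    rfl
  · rw [truncBinom_of_neg (by omega), truncBinom_of_neg (by omega), truncBinom_of_neg (by omega),
      sub_zero]

theorem truncBinom_zero_sub (s : ℤ) :
    truncBinom 0 s - truncBinom 0 (s - 1) = if s = 0 then 1 else 0 := by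
  simp only [truncBinom, binom_zero]
  split_ifs <;> first | omega | simp

/-- The `k`-th backward difference of `g` at `y`, written as a divided difference. -/
def backDiff (k : ℕ) (y : ℤ) (g : ℤ → ℂ) : ℂ :=
  (k.factorial : ℂ) *
    ∑ ζ ∈ Icc (y - k) y, g ζ / ∏ ζ' ∈ (Icc (y - k) y).erase ζ, ((ζ : ℂ) - ζ')

theorem backDiff_zero (y : ℤ) (g : ℤ → ℂ) : backDiff 0 y g = g y := by
  simp [backDiff]

theorem prod_erase_sub_ne_zero (S : Finset ℤ) (a : ℤ) : ∏ b ∈ S.erase a, ((a : ℂ) - b) ≠ 0 := by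
  refine prod_ne_zero_iff.2 fun b hb => ?_
  rw [sub_ne_zero]
  exact fun h => (mem_erase.1 hb).1 (by exact_mod_cast h.symm)

/-- Removing a node from a divided difference. -/
theorem sum_div_prod_erase (S : Finset ℤ) (g : ℤ → ℂ) {b : ℤ} (hb : b ∈ S) :
    ∑ ζ ∈ S.erase b, g ζ / ∏ ζ' ∈ (S.erase b).erase ζ, ((ζ : ℂ) - ζ') =
      ∑ ζ ∈ S, g ζ * ((ζ : ℂ) - b) / ∏ ζ' ∈ S.erase ζ, ((ζ : ℂ) - ζ') := by
  rw [← add_sum_erase S _ hb, sub_self, mul_zero, zero_div, zero_add]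
  refine sum_congr rfl fun ζ hζ => ?_
  have h1 : b ∈ S.erase ζ := mem_erase.2 ⟨(mem_erase.1 hζ).1.symm, hb⟩
  rw [← mul_prod_erase _ _ h1, erase_right_comm]
  have h2 : (ζ : ℂ) - b ≠ 0 := by
    rw [sub_ne_zero]
    exact_mod_cast (mem_erase.1 hζ).1
  have h3 := prod_erase_sub_ne_zero (S.erase b) ζ
  rw [erase_right_comm] at h3
  field_simp

theorem backDiff_succ (k : ℕ) (y : ℤ) (g : ℤ → ℂ) :
    backDiff (k + 1) y g = backDiff k y g - backDiff k (y - 1) g := by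
  have h1 : Icc (y - k) y = (Icc (y - (k + 1 : ℕ)) y).erase (y - (k + 1 : ℕ)) := by
    ext a
    simp only [mem_erase, mem_Icc]
    push_cast
    omega
  have h2 : Icc (y - 1 - k) (y - 1) = (Icc (y - (k + 1 : ℕ)) y).erase y := by
    ext a
    simp only [mem_erase, mem_Icc]
    push_cast
    omega
  rw [backDiff, backDiff, backDiff, h1, h2,
    sum_div_prod_erase _ _ (by rw [mem_Icc]; push_cast; omega),
    sum_div_prod_erase _ _ (by rw [mem_Icc]; push_cast; omega), ← mul_sub, ← sum_sub_distrib,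
    Nat.factorial_succ, mul_comm (k + 1)]
  push_cast
  rw [mul_assoc, mul_sum]
  congr 1
  refine sum_congr rfl fun ζ _ => ?_
  ring

theorem backDiff_binom (k J : ℕ) (x y : ℤ) :
    backDiff k y (fun t => binom J ((t : ℂ) - x)) =
      if k ≤ J then binom (J - k) ((y : ℂ) - x) else 0 := by
  induction k generalizing y with
  | zero => simp [backDiff_zero]
  | succ k ih =>
    rw [backDiff_succ, ih, ih]
    rcases lt_trichotomy k J with h | h | h
    · obtain ⟨i, rfl⟩ : ∃ i, J = k + 1 + i := ⟨J - k - 1, by omega⟩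
      rw [if_pos (by omega), if_pos (by omega), if_pos (by omega),
        show k + 1 + i - k = i + 1 by omega, show k + 1 + i - (k + 1) = i by omega,
        ← binom_succ_sub i]
      push_cast
      ring_nf
    · rw [if_pos (by omega), if_pos (by omega), if_neg (by omega), h, Nat.sub_self, binom_zero,
        binom_zero, sub_self]
    · rw [if_neg (by omega), if_neg (by omega), if_neg (by omega), sub_self]

theorem backDiff_truncBinom {k J : ℕ} (hk : k ≤ J) (x y : ℤ) :
    backDiff k y (fun t => truncBinom J (t - x)) = truncBinom (J - k) (y - x) := by
  induction k generalizing y with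
  | zero => simp [backDiff_zero]
  | succ k ih =>
    rw [backDiff_succ, ih (by omega), ih (by omega)]
    obtain ⟨i, rfl⟩ : ∃ i, J = k + 1 + i := ⟨J - k - 1, by omega⟩
    rw [show k + 1 + i - k = i + 1 by omega, show k + 1 + i - (k + 1) = i by omega,
      ← truncBinom_succ_sub i, sub_right_comm y 1 x]

theorem backDiff_truncBinom_succ (J : ℕ) (x y : ℤ) :
    backDiff (J + 1) y (fun t => truncBinom J (t - x)) = if y = x then 1 else 0 := by
  rw [backDiff_succ, backDiff_truncBinom le_rfl, backDiff_truncBinom le_rfl, Nat.sub_self,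
    sub_right_comm, truncBinom_zero_sub]
  simp only [sub_eq_zero]

theorem exists_polynomial_binom (J : ℕ) (x : ℤ) :
    ∃ g : Polynomial ℂ, g.natDegree ≤ J ∧ ∀ z, g.eval z = binom J (z - x) := by
  refine ⟨Polynomial.C ((J.factorial : ℂ)⁻¹) *
    (ascPochhammer ℂ J).comp (Polynomial.X + Polynomial.C (1 - (x : ℂ))), ?_, fun z => ?_⟩
  · refine (Polynomial.natDegree_C_mul_le _ _).trans ?_
    refine Polynomial.natDegree_comp_le.trans ?_
    rw [ascPochhammer_natDegree, Polynomial.natDegree_X_add_C, mul_one]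
  · simp only [Polynomial.eval_mul, Polynomial.eval_C, Polynomial.eval_comp, Polynomial.eval_add,
      Polynomial.eval_X, binom, rising]
    rw [show z + (1 - (x : ℂ)) = z - x + 1 by ring, div_eq_inv_mul]

/-! ### Columns of the inverse Kasteleyn matrix. -/

namespace CutHexagon

variable {H : CutHexagon}

variable (H) in
/-- The column of the kernel with the second argument `(n, y)`, where `c` is the vector of the
coefficients of the point masses at the points of the upper cuts. -/
def column (κ : ℂ) (n : ℕ) (y : ℤ) (c : ℤ → ℂ) (m : ℕ) (x : ℤ) : ℂ :=
  if m < H.N then -(κ * if m < n then truncBinom (n - m - 1) (y - x) else 0) +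
    ∑ a ∈ H.X, truncBinom (H.N - m - 1) (a - x) * c a
  else if x ∈ H.X then c x else 0

/-- The recurrence holds for every `c` by the difference rules of `truncBinom`, and the right
boundary condition because all nodes are at most `M - 1`. `hA` is what the left boundary needs, `hB`
what the points of the lower cuts need. -/
theorem kasteleyn_mulVec_column (hN : 0 < H.N) (κ : ℂ) {n : ℕ} {y : ℤ} (hq : H.InQuad n y)
    (hn : n < H.N) (c : ℤ → ℂ)
    (hA : ∀ (x : ℤ) (J : ℕ), J < H.N → ∑ a ∈ H.X, binom J ((a : ℂ) - x) * c a =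
      κ * backDiff (H.N - n) y (fun t => binom J ((t : ℂ) - x)))
    (hB : ∀ y' ∈ H.Y, ∑ a ∈ H.X, truncBinom (H.N - 1) (a - y') * c a =
      κ * backDiff (H.N - n) y (fun t => truncBinom (H.N - 1) (t - y'))) :
    H.kasteleyn.mulVec (fun a => H.column κ n y c a.1.1 a.1.2) =
      fun a => if a.1 = (n, y) ∧ (n = 0 → y ∈ H.Y) then κ else 0 := by
  refine kasteleyn_mulVec _ (fun k x => if (k, x) = (n, y) ∧ (n = 0 → y ∈ H.Y) then κ else 0) hN
    ?_ ?_ ?_ ?_ ?_ ?_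
  · intro k x hk hkx
    have hk1 : (k + 1, x) = (n, y) ∧ (n = 0 → y ∈ H.Y) ↔ n = k + 1 ∧ y - x = 0 := by
      rw [Prod.mk.injEq]
      constructor
      · rintro ⟨⟨rfl, rfl⟩, -⟩
        exact ⟨rfl, sub_self _⟩
      · rintro ⟨rfl, h⟩
        exact ⟨⟨rfl, by omega⟩, fun h => absurd h (Nat.succ_ne_zero _)⟩
    rw [if_congr hk1 rfl rfl]
    simp only [column, if_pos hk]
    rcases Nat.lt_or_ge (k + 1) H.N with h | h
    · obtain ⟨J, hJ⟩ : ∃ J, H.N = k + 2 + J := ⟨H.N - k - 2, by omega⟩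
      rw [if_pos h, show H.N - (k + 1) - 1 = J by omega, show H.N - k - 1 = J + 1 by omega]
      have h1 : ∑ a ∈ H.X, truncBinom J (a - x) * c a -
          ∑ a ∈ H.X, truncBinom (J + 1) (a - x) * c a +
          ∑ a ∈ H.X, truncBinom (J + 1) (a - (x + 1)) * c a = 0 := by
        rw [← sum_sub_distrib, ← sum_add_distrib]
        refine sum_eq_zero fun a _ => ?_
        rw [← truncBinom_succ_sub J, ← sub_sub]
        ring
      have h2 : -(κ * if k + 1 < n then truncBinom (n - (k + 1) - 1) (y - x) else 0) +
          (κ * if k < n then truncBinom (n - k - 1) (y - x) else 0) -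
          (κ * if k < n then truncBinom (n - k - 1) (y - (x + 1)) else 0) =
          if n = k + 1 ∧ y - x = 0 then κ else 0 := by
        rcases lt_trichotomy n (k + 1) with h3 | h3 | h3
        · rw [if_neg (by omega), if_neg (by omega), if_neg (by omega), if_neg (by omega)]
          ring
        · rw [if_neg (by omega), if_pos (by omega), if_pos (by omega),
            show n - k - 1 = 0 by omega, ← sub_sub]
          have := truncBinom_zero_sub (y - x)
          simp only [h3, true_and]
          rw [mul_zero, neg_zero, zero_add, ← mul_sub, this]
          split_ifs <;> simp
        · obtain ⟨i, rfl⟩ : ∃ i, n = k + 2 + i := ⟨n - k - 2, by omega⟩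
          rw [if_pos h3, if_pos (by omega), if_pos (by omega), if_neg (by omega),
            show k + 2 + i - (k + 1) - 1 = i by omega, show k + 2 + i - k - 1 = i + 1 by omega,
            ← truncBinom_succ_sub i, ← sub_sub]
          ring
      rw [← h2]
      linear_combination h1
    · rw [if_neg (by omega), if_neg (by omega : ¬ k < n), if_neg (by omega : ¬ (n = k + 1 ∧ _)),
        show H.N - k - 1 = 0 by omega, if_neg (by omega : ¬ k < n)]
      have : ∀ a : ℤ, truncBinom 0 (a - x) * c a - truncBinom 0 (a - (x + 1)) * c a =
          if a = x then c a else 0 := by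
        intro a
        rw [← sub_mul, ← sub_sub, truncBinom_zero_sub]
        simp only [sub_eq_zero]
        split_ifs <;> simp
      have h1 : ∑ a ∈ H.X, truncBinom 0 (a - x) * c a -
          ∑ a ∈ H.X, truncBinom 0 (a - (x + 1)) * c a = if x ∈ H.X then c x else 0 := by
        rw [← sum_sub_distrib, sum_congr rfl fun a _ => this a, sum_ite_eq' H.X x c]
      rw [← h1]
      ring
  · intro k hk
    simp only [column, if_pos hk]
    -- All nodes are at least `-d - N`, so the argument is at least `-(N - k - 1)` and the
    -- truncation is not felt on the left boundary.
    have hX : ∀ a ∈ H.X, truncBinom (H.N - k - 1) (a - (-(H.d : ℤ) - k - 1)) * c a =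
        binom (H.N - k - 1) ((a : ℂ) - (-(H.d : ℤ) - k - 1 : ℤ)) * c a := by
      intro a ha
      have := (mem_Icc.1 (H.X_subset ha)).1
      have hd : H.d = H.Y.card := rfl
      rw [truncBinom_eq_binom (by omega)]
      push_cast
      ring_nf
    rw [sum_congr rfl hX, hA _ _ (by omega), backDiff_binom, ← mul_neg, ← mul_add]
    have : k < n ↔ H.N - n ≤ H.N - k - 1 := by omega
    rw [if_congr this.symm rfl rfl]
    split_ifs with h
    · unfold InQuad at hq
      rw [truncBinom_eq_binom (by omega), show H.N - k - 1 - (H.N - n) = n - k - 1 by omega]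
      push_cast
      ring
    · simp
  · intro k hk
    simp only [column, if_pos hk]
    rw [truncBinom_of_neg (by unfold InQuad at hq; omega), sum_eq_zero]
    · simp
    · intro a ha
      have := (mem_Icc.1 (H.X_subset ha)).2
      rw [truncBinom_of_neg (by omega), zero_mul]
  · intro y' hy'
    simp only [column, if_pos hN, Nat.sub_zero]
    rw [hB y' hy']
    rcases Nat.eq_zero_or_pos n with h | h
    · subst h
      obtain ⟨J, hJ⟩ : ∃ J, H.N = J + 1 := ⟨H.N - 1, by omega⟩
      -- For `n = 0` the difference has order `N`, one more than the degree of the truncated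
      -- binomial, and leaves the unit source at `y'`.
      rw [Nat.sub_zero, hJ, Nat.add_sub_cancel, backDiff_truncBinom_succ]
      by_cases h : y = y'
      · subst h
        simp [hy']
      · have : y' ≠ y := fun h' => h h'.symm
        simp [h, this]
    · rw [if_pos h, backDiff_truncBinom (by omega), if_neg, show H.N - 1 - (H.N - n) = n - 1 by omega]
      · ring
      · rintro ⟨h1, -⟩
        rw [Prod.mk.injEq] at h1
        omega
  · intro x hx
    refine if_neg ?_
    rintro ⟨h1, h2⟩
    rw [Prod.mk.injEq] at h1
    rw [← h1.2] at h2
    exact hx (h2 h1.1.symm)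
  · intro x hx
    simp [column, hx]

end CutHexagon

/-! ### Contour integrals as sums of residues. -/

theorem circleInt_congr {c : ℂ} {ρ : ℝ} (hρ : 0 ≤ ρ) {f g : ℂ → ℂ}
    (h : ∀ u ∈ Metric.sphere c ρ, f u = g u) : circleInt c ρ f = circleInt c ρ g := by
  rw [circleInt, circleInt, circleIntegral.integral_congr hρ h]

theorem circleInt_div_sub {c w : ℂ} {ρ : ℝ} {G : ℂ → ℂ}
    (hG : DifferentiableOn ℂ G (Metric.closedBall c ρ)) (hw : w ∈ Metric.ball c ρ) :
    circleInt c ρ (fun u => G u / (u - w)) = G w := by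
  have h := hG.circleIntegral_sub_inv_smul hw
  have h2 : (2 * (Real.pi : ℂ) * Complex.I) ≠ 0 := Complex.two_pi_I_ne_zero
  have h3 : (fun u => G u / (u - w)) = fun u => (u - w)⁻¹ • G u := by
    funext u
    rw [smul_eq_mul, div_eq_inv_mul]
  rw [circleInt, h3, h, smul_eq_mul, inv_mul_cancel_left₀ h2]

/-- Cauchy's formula at the centre, applied to `(u - c) G u`, which vanishes there. -/
theorem circleInt_eq_zero {c : ℂ} {ρ : ℝ} (hρ : 0 < ρ) {G : ℂ → ℂ}
    (hG : DifferentiableOn ℂ G (Metric.closedBall c ρ)) : circleInt c ρ G = 0 := by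
  have h : circleInt c ρ G = circleInt c ρ (fun u => (u - c) * G u / (u - c)) := by
    refine circleInt_congr hρ.le fun u hu => ?_
    have : u - c ≠ 0 := by
      rw [sub_ne_zero]
      exact Metric.ne_of_mem_sphere hu hρ.ne'
    field_simp
  rw [h, circleInt_div_sub (G := fun u => (u - c) * G u)
    ((by fun_prop : DifferentiableOn ℂ (fun u => u - c) _).mul hG) (Metric.mem_ball_self hρ)]
  simp

theorem ne_intCast_of_mem_closedBall {p a : ℤ} {ρ : ℝ} (hρ : ρ < 1) (ha : a ≠ p) {u : ℂ}
    (hu : u ∈ Metric.closedBall (p : ℂ) ρ) : u ≠ a := by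
  rintro rfl
  rw [Metric.mem_closedBall, Complex.dist_eq, ← Int.cast_sub, Complex.norm_intCast] at hu
  have h1 : (1 : ℤ) ≤ |a - p| := Int.one_le_abs (sub_ne_zero.2 ha)
  have h2 : (1 : ℝ) ≤ |((a - p : ℤ) : ℝ)| := by exact_mod_cast h1
  linarith

theorem ne_intCast_of_mem_sphere {p : ℤ} {ρ : ℝ} (h0 : 0 < ρ) (hρ : ρ < 1) (a : ℤ) {u : ℂ}
    (hu : u ∈ Metric.sphere (p : ℂ) ρ) : u ≠ a := by
  by_cases ha : a = p
  · rw [ha]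
    exact Metric.ne_of_mem_sphere hu h0.ne'
  · exact ne_intCast_of_mem_closedBall hρ ha (Metric.sphere_subset_closedBall hu)

/-- `ε < δ` separates the circles about the same integer, and `δ + ε < 1` those about different
integers. -/
theorem ne_of_mem_closedBall_of_mem_sphere {p q : ℤ} {ε δ : ℝ} (h1 : ε < δ)
    (h2 : δ + ε < 1) {u v : ℂ} (hu : u ∈ Metric.closedBall (p : ℂ) ε)
    (hv : v ∈ Metric.sphere (q : ℂ) δ) : u ≠ v := by
  rintro rfl
  rw [Metric.mem_closedBall] at hu
  rw [Metric.mem_sphere] at hv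
  by_cases hpq : p = q
  · rw [hpq] at hu
    linarith
  · have h3 : dist (p : ℂ) q ≤ ε + δ := by
      have := dist_triangle_left (p : ℂ) q u
      linarith
    have h4 : (1 : ℤ) ≤ |p - q| := Int.one_le_abs (sub_ne_zero.2 hpq)
    have h5 : (1 : ℝ) ≤ |((p - q : ℤ) : ℝ)| := by exact_mod_cast h4
    rw [Complex.dist_eq, ← Int.cast_sub, Complex.norm_intCast] at h3
    linarith

theorem rootPoly_ne_zero {S : Finset ℤ} {u : ℂ} (h : ∀ a ∈ S, u ≠ a) : rootPoly S u ≠ 0 :=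
  prod_ne_zero_iff.2 fun a ha => sub_ne_zero.2 (h a ha)

theorem differentiable_rootPoly (S : Finset ℤ) : Differentiable ℂ (rootPoly S) := by
  unfold rootPoly
  fun_prop

theorem rootPoly_erase_mul {S : Finset ℤ} {a : ℤ} (ha : a ∈ S) (u : ℂ) :
    (u - a) * rootPoly (S.erase a) u = rootPoly S u :=
  mul_prod_erase S (fun b : ℤ => u - (b : ℂ)) ha

/-- The residue at an integer of a function with simple poles at the points of `S`. -/
theorem circleInt_div_rootPoly {p : ℤ} {ρ : ℝ} (h0 : 0 < ρ) (h1 : ρ < 1) (S : Finset ℤ)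
    {f G : ℂ → ℂ} (hG : DifferentiableOn ℂ G (Metric.closedBall (p : ℂ) ρ))
    (hf : ∀ u ∈ Metric.sphere (p : ℂ) ρ, f u = G u / rootPoly S u) :
    circleInt p ρ f = if p ∈ S then G p / rootPoly (S.erase p) p else 0 := by
  rw [circleInt_congr h0.le hf]
  split_ifs with hp
  · have h2 : (fun u => G u / rootPoly S u) =
        fun u => (G u / rootPoly (S.erase p) u) / (u - p) := by
      funext u
      rw [← rootPoly_erase_mul hp, div_div, mul_comm]
    rw [h2, circleInt_div_sub _ (Metric.mem_ball_self h0)]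
    exact hG.div (differentiable_rootPoly _).differentiableOn fun u hu =>
      rootPoly_ne_zero fun a ha => ne_intCast_of_mem_closedBall h1 (mem_erase.1 ha).1 hu
  · refine circleInt_eq_zero h0 (hG.div (differentiable_rootPoly _).differentiableOn fun u hu =>
      rootPoly_ne_zero fun a ha => ne_intCast_of_mem_closedBall h1 ?_ hu)
    rintro rfl
    exact hp ha

/-- Residues are taken one variable at a time: after the inner integrations the coefficient of `g`
is still entire in the outer variable, so the one-variable rule `hg` applies again. -/
theorem multiContourInt_eq_sum (S : Finset ℤ) (ρ : ℝ) (g : ℂ → ℂ) (res : ℤ → ℂ)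
    (hg : ∀ p ∈ S, ∀ G : ℂ → ℂ, Differentiable ℂ G →
      circleInt p ρ (fun u => g u * G u) = res p * G p) (k : ℕ) :
    ∀ G : (Fin k → ℂ) → ℂ, Differentiable ℂ G →
    multiContourInt S ρ k (fun u => (∏ α, g (u α)) * G u) =
      ∑ w : Fin k → S, (∏ α, res (w α)) * G (fun α => ((w α : ℤ) : ℂ)) := by
  induction k with
  | zero =>
    intro G _
    simp only [multiContourInt, univ_eq_empty, prod_empty, one_mul, univ_unique, sum_singleton]
    congr 1
    funext i
    exact i.elim0
  | succ k ih =>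
    intro G hG
    have hcons : ∀ u : ℂ, Differentiable ℂ fun w : Fin k → ℂ => (Fin.cons u w : Fin (k + 1) → ℂ) := by
      intro u
      rw [differentiable_pi]
      intro i
      refine Fin.cases ?_ (fun i => ?_) i
      · simp
      · simp only [Fin.cons_succ]
        fun_prop
    have hcons' : ∀ w : Fin k → ℂ, Differentiable ℂ fun u : ℂ => (Fin.cons u w : Fin (k + 1) → ℂ) := by
      intro w
      rw [differentiable_pi]
      intro i
      refine Fin.cases ?_ (fun i => ?_) i
      · simp only [Fin.cons_zero]
        fun_prop
      · simp
    have h1 : ∀ u : ℂ, multiContourInt S ρ k (fun w => (∏ α, g ((Fin.cons u w : Fin (k + 1) → ℂ) α)) *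
        G (Fin.cons u w)) = g u * ∑ w : Fin k → S, (∏ α, res (w α)) *
          G (Fin.cons u fun α => ((w α : ℤ) : ℂ)) := by
      intro u
      have h2 : (fun w : Fin k → ℂ => (∏ α, g ((Fin.cons u w : Fin (k + 1) → ℂ) α)) *
          G (Fin.cons u w)) = fun w => (∏ α, g (w α)) * (g u * G (Fin.cons u w)) := by
        funext w
        rw [Fin.prod_univ_succ]
        simp only [Fin.cons_zero, Fin.cons_succ]
        ring
      rw [h2, ih (fun w => g u * G (Fin.cons u w)) ((hG.comp (hcons u)).const_mul _), mul_sum]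
      refine sum_congr rfl fun w _ => by ring
    have h3 : ∀ p ∈ S, circleInt (p : ℂ) ρ (fun u => g u * ∑ w : Fin k → S, (∏ α, res (w α)) *
          G (Fin.cons u fun α => ((w α : ℤ) : ℂ))) = res p * ∑ w : Fin k → S, (∏ α, res (w α)) *
          G (Fin.cons (p : ℂ) fun α => ((w α : ℤ) : ℂ)) := by
      intro p hp
      refine hg p hp (fun u => ∑ w : Fin k → S, (∏ α, res (w α)) *
          G (Fin.cons u fun α => ((w α : ℤ) : ℂ))) ?_
      refine Differentiable.fun_sum fun w _ => ?_
      exact (hG.comp (hcons' _)).const_mul _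
    simp only [multiContourInt, contourInt, h1]
    rw [sum_congr rfl h3, ← (Fin.consEquiv fun _ => S).sum_comp, Fintype.sum_prod_type,
      ← sum_coe_sort S]
    refine sum_congr rfl fun p _ => ?_
    rw [mul_sum]
    refine sum_congr rfl fun w _ => ?_
    rw [Fin.prod_univ_succ]
    simp only [Fin.consEquiv_apply, Fin.cons_zero, Fin.cons_succ]
    rw [mul_assoc]
    congr 3
    funext i
    refine Fin.cases ?_ (fun i => ?_) i <;> simp

theorem differentiable_eval_mvPolynomial {E : Type*} [NormedAddCommGroup E] [NormedSpace ℂ E]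
    (F : MvPolynomial ℕ ℂ) (f : ℕ → E → ℂ) (hf : ∀ a, Differentiable ℂ (f a)) :
    Differentiable ℂ fun u => MvPolynomial.eval (fun a => f a u) F := by
  induction F using MvPolynomial.induction_on with
  | C c => simp
  | add p q hp hq =>
    simp only [map_add]
    exact hp.add hq
  | mul_X p a hp =>
    simp only [map_mul, MvPolynomial.eval_X]
    exact hp.mul (hf a)

theorem differentiable_vandermondeProd (k : ℕ) :
    Differentiable ℂ fun u : Fin k → ℂ => vandermondeProd u := by
  unfold vandermondeProd
  fun_prop

namespace CutHexagon

variable (H : CutHexagon)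

/-- `num` is the part of the integrand holomorphic on the discs. It need only match on the circles,
so that at `v = z = 0` the quotient `(z - u) / (v - u)` can be replaced by `1` even if `0 ∈ 𝓛`. -/
theorem omegaPlus_eq_sum (F : MvPolynomial ℕ ℂ) {ε : ℝ} (h0 : 0 < ε) (h1 : ε < 1) (k : ℕ) (v z : ℂ)
    (num : ℂ → ℂ) (hnum : ∀ p ∈ H.setL, DifferentiableOn ℂ num (Metric.closedBall (p : ℂ) ε))
    (hsph : ∀ p ∈ H.setL, ∀ u ∈ Metric.sphere (p : ℂ) ε,
      H.h u * (z - u) / (v - u) = num u / rootPoly H.setL u) :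
    H.omegaPlus F ε k v z = ∑ w : Fin k → H.setL,
      (∏ α, num ((w α : ℤ) : ℂ) / rootPoly (H.setL.erase (w α)) ((w α : ℤ) : ℂ)) *
        (vandermondeProd (fun α => ((w α : ℤ) : ℂ)) ^ 2 *
          H.compl F (fun α => ((w α : ℤ) : ℂ))) := by
  have h := multiContourInt_eq_sum H.setL ε (fun u => H.h u * (z - u) / (v - u))
    (fun p => num p / rootPoly (H.setL.erase p) p) ?_ k
    (fun u => vandermondeProd u ^ 2 * H.compl F u) ?_
  · rw [← h, omegaPlus]
    congr 1
    funext u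
    rw [mul_assoc]
  · intro p hp G hG
    rw [circleInt_div_rootPoly h0 h1 H.setL ((hnum p hp).mul hG.differentiableOn)
      (fun u hu => by simp only [hsph p hp u hu, Pi.mul_apply]; ring), if_pos hp]
    simp only [Pi.mul_apply]
    ring
  · refine ((differentiable_vandermondeProd k).pow 2).mul ?_
    refine differentiable_eval_mvPolynomial F _ fun a => ?_
    fun_prop

theorem omegaMinus_eq_sum (F : MvPolynomial ℕ ℂ) {ε : ℝ} (h0 : 0 < ε) (h1 : ε < 1) (k : ℕ) (v z : ℂ)
    (num : ℂ → ℂ) (hnum : ∀ p ∈ H.setL, DifferentiableOn ℂ num (Metric.closedBall (p : ℂ) ε))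
    (hsph : ∀ p ∈ H.setL, ∀ u ∈ Metric.sphere (p : ℂ) ε,
      H.h u * (z - u)⁻¹ / (v - u) = num u / rootPoly H.setL u) :
    H.omegaMinus F ε k v z = ∑ w : Fin k → H.setL,
      (∏ α, num ((w α : ℤ) : ℂ) / rootPoly (H.setL.erase (w α)) ((w α : ℤ) : ℂ)) *
        (vandermondeProd (fun α => ((w α : ℤ) : ℂ)) ^ 2 *
          H.complWith F z (fun α => ((w α : ℤ) : ℂ))) := by
  have h := multiContourInt_eq_sum H.setL ε (fun u => H.h u * (z - u)⁻¹ / (v - u))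
    (fun p => num p / rootPoly (H.setL.erase p) p) ?_ k
    (fun u => vandermondeProd u ^ 2 * H.complWith F z u) ?_
  · rw [← h, omegaMinus]
    congr 1
    funext u
    rw [mul_assoc]
  · intro p hp G hG
    rw [circleInt_div_rootPoly h0 h1 H.setL ((hnum p hp).mul hG.differentiableOn)
      (fun u hu => by simp only [hsph p hp u hu, Pi.mul_apply]; ring), if_pos hp]
    simp only [Pi.mul_apply]
    ring
  · refine ((differentiable_vandermondeProd k).pow 2).mul ?_
    refine differentiable_eval_mvPolynomial F _ fun a => ?_
    fun_prop

end CutHexagon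

/-! ### Interpolation, partial fractions and divided differences. -/

/-- Lagrange interpolation at integer nodes. -/
theorem eval_eq_sum_lagrange (S : Finset ℤ) (g : Polynomial ℂ) (hg : g.degree < S.card) (z : ℂ) :
    g.eval z = ∑ a ∈ S, g.eval (a : ℂ) * (rootPoly (S.erase a) z / rootPoly (S.erase a) a) := by
  have hinj : Set.InjOn (fun a : ℤ => (a : ℂ)) S := fun a _ b _ h => Int.cast_injective h
  conv_lhs => rw [Lagrange.eq_interpolate hinj hg]
  rw [Lagrange.interpolate_apply, Polynomial.eval_finsetSum]
  refine sum_congr rfl fun a ha => ?_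
  rw [Polynomial.eval_mul, Polynomial.eval_C, Lagrange.basis, Polynomial.eval_prod, rootPoly,
    rootPoly, ← prod_div_distrib]
  congr 1
  refine prod_congr rfl fun b _ => ?_
  simp only [Lagrange.basisDivisor, Polynomial.eval_mul, Polynomial.eval_C, Polynomial.eval_sub,
    Polynomial.eval_X]
  rw [div_eq_inv_mul]

/-- Partial fractions. -/
theorem inv_rootPoly (S : Finset ℤ) (hS : S.Nonempty) {z : ℂ} (hz : ∀ a ∈ S, z ≠ a) :
    1 / rootPoly S z = ∑ a ∈ S, 1 / rootPoly (S.erase a) a * (1 / (z - a)) := by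
  have h := eval_eq_sum_lagrange S 1 (by
    rw [Polynomial.degree_one]
    exact_mod_cast hS.card_pos) z
  simp only [Polynomial.eval_one, one_mul] at h
  nth_rewrite 1 [h]
  rw [sum_div]
  refine sum_congr rfl fun a ha => ?_
  have h1 : z - a ≠ 0 := sub_ne_zero.2 (hz a ha)
  have h2 : rootPoly (S.erase a) z ≠ 0 := rootPoly_ne_zero fun b hb => hz b (mem_of_mem_erase hb)
  rw [← rootPoly_erase_mul ha]
  field_simp

/-- The integral over the large circle. -/
theorem circleInt_div_sub_mul_rootPoly {R : ℝ} (Z : Finset ℤ) (hZ : Z.Nonempty) {A : ℂ → ℂ}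
    (hA : Differentiable ℂ A) {v : ℂ} (hv : v ∈ Metric.ball (0 : ℂ) R) (hvZ : ∀ ζ ∈ Z, v ≠ ζ)
    (hZR : ∀ ζ ∈ Z, ((ζ : ℤ) : ℂ) ∈ Metric.ball (0 : ℂ) R) :
    circleInt 0 R (fun z => A z / ((z - v) * rootPoly Z z)) =
      ∑ ζ ∈ Z, 1 / rootPoly (Z.erase ζ) ζ * dslope A ζ v := by
  have hR : 0 < R := Metric.pos_of_mem_ball hv
  have hne : ∀ w ∈ Metric.ball (0 : ℂ) R, ∀ z ∈ Metric.sphere (0 : ℂ) R, z ≠ w := by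
    rintro w hw z hz rfl
    rw [Metric.mem_ball] at hw
    rw [Metric.mem_sphere] at hz
    linarith
  have hci : ∀ w ∈ Metric.ball (0 : ℂ) R,
      CircleIntegrable (fun z => A z / (z - w)) 0 R := fun w hw => by
    refine ContinuousOn.circleIntegrable hR.le ?_
    refine hA.continuous.continuousOn.div (by fun_prop) fun z hz => ?_
    exact sub_ne_zero.2 (hne w hw z hz)
  have h1 : circleInt 0 R (fun z => A z / ((z - v) * rootPoly Z z)) =
      circleInt 0 R (fun z => ∑ ζ ∈ Z, (1 / rootPoly (Z.erase ζ) ζ * (1 / (v - ζ))) *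
        (A z / (z - v) - A z / (z - ζ))) := by
    refine circleInt_congr hR.le fun z hz => ?_
    -- Partial fractions at `Z` leave pairs of simple poles `v`, `ζ`, whose residues give the slope
    -- of `A`. Written as `dslope`, the answer stays regular in `v` at the integers, where the
    -- `v`-residues are taken later.
    rw [← div_div, div_eq_mul_one_div, inv_rootPoly Z hZ fun a ha => hne _ (hZR a ha) z hz, mul_sum]
    refine sum_congr rfl fun ζ hζ => ?_
    have e1 : z - v ≠ 0 := sub_ne_zero.2 (hne v hv z hz)
    have e2 : z - ζ ≠ 0 := sub_ne_zero.2 (hne _ (hZR ζ hζ) z hz)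
    have e3 : v - ζ ≠ 0 := sub_ne_zero.2 (hvZ ζ hζ)
    rw [div_sub_div _ _ e1 e2, show A z * (z - ζ) - (z - v) * A z = A z * (v - ζ) by ring]
    field_simp
  rw [h1, circleInt, circleIntegral.integral_fun_sum, mul_sum]
  · refine sum_congr rfl fun ζ hζ => ?_
    have h2 := circleInt_div_sub (hA.differentiableOn (s := Metric.closedBall 0 R)) hv
    have h3 := circleInt_div_sub (hA.differentiableOn (s := Metric.closedBall 0 R)) (hZR ζ hζ)
    rw [circleInt] at h2 h3
    rw [circleIntegral.integral_const_mul, circleIntegral.integral_sub (hci v hv) (hci _ (hZR ζ hζ)),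
      mul_left_comm, mul_sub, h2, h3, dslope_of_ne _ (hvZ ζ hζ), slope_def_field]
    ring
  · intro ζ hζ
    exact ((hci v hv).sub (hci _ (hZR ζ hζ))).const_mul _

theorem rising_eq_rootPoly (z : ℂ) (y : ℤ) (k : ℕ) :
    rising (z - y) (k + 1) = rootPoly (Icc (y - k) y) z := by
  rw [rising_eq_prod, rootPoly]
  refine prod_bij (fun i _ => y - (i : ℤ)) ?_ ?_ ?_ ?_
  · intro i hi
    rw [mem_range] at hi
    rw [mem_Icc]
    omega
  · intro i _ j _ h
    simpa using h
  · intro a ha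
    rw [mem_Icc] at ha
    exact ⟨(y - a).toNat, by rw [mem_range]; omega, by omega⟩
  · intro i _
    push_cast
    ring

/-- At a root `p` the divided difference just cancels the factor `z - p`; this is how Lagrange
numerators appear. -/
theorem dslope_rootPoly (S : Finset ℤ) (ζ : ℂ) {p : ℤ} (hp : p ∈ S) :
    dslope (rootPoly S) ζ p = rootPoly (S.erase p) ζ := by
  have h : ∀ u, rootPoly S u = (u - p) * rootPoly (S.erase p) u := fun u =>
    (rootPoly_erase_mul hp u).symm
  by_cases hz : (p : ℂ) = ζ
  · rw [← hz, dslope_same]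
    have : HasDerivAt (rootPoly S) (1 * rootPoly (S.erase p) p +
        ((p : ℂ) - p) * deriv (rootPoly (S.erase p)) p) p := by
      rw [funext h]
      exact ((hasDerivAt_id _).sub_const _).mul (differentiable_rootPoly _ _).hasDerivAt
    rw [this.deriv]
    ring
  · rw [dslope_of_ne _ hz, slope_def_field, h p, h ζ, sub_self, zero_mul, zero_sub]
    have : (p : ℂ) - ζ ≠ 0 := sub_ne_zero.2 hz
    field_simp
    ring

/-! ### Vandermonde products and passage to complementary tuples. -/

/-- The sign `(-1)^(k choose 2)`. -/
def pairSign (k : ℕ) : ℂ := ∏ i : Fin k, ∏ _j ∈ Ioi i, (-1 : ℂ)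

theorem pairSign_succ (k : ℕ) : pairSign (k + 1) = (-1) ^ k * pairSign k := by
  rw [pairSign, Fin.prod_univ_succ, pairSign]
  congr 1
  · simp
  · refine prod_congr rfl fun i _ => ?_
    simp only [prod_const, Fin.card_Ioi]
    congr 1
    simp only [Fin.val_succ]
    omega

theorem pairSign_add (k n : ℕ) : pairSign (k + n) = pairSign k * pairSign n * (-1) ^ (k * n) := by
  induction n with
  | zero => simp [pairSign]
  | succ n ih =>
    rw [← add_assoc, pairSign_succ, ih, pairSign_succ, Nat.mul_succ, pow_add, pow_add]
    ring

theorem pairSign_mul_self (k : ℕ) : pairSign k * pairSign k = 1 := by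
  induction k with
  | zero => simp [pairSign]
  | succ k ih =>
    rw [pairSign_succ, mul_mul_mul_comm, ih, mul_one, ← mul_pow]
    simp

theorem vandermondeProd_eq_det {k : ℕ} (u : Fin k → ℂ) :
    vandermondeProd u = (Matrix.vandermonde fun i => -u i).det := by
  rw [Matrix.det_vandermonde, vandermondeProd]
  refine prod_congr rfl fun i _ => prod_congr rfl fun j _ => by ring

theorem vandermondeProd_comp {k : ℕ} (u : Fin k → ℂ) (σ : Equiv.Perm (Fin k)) :
    vandermondeProd (u ∘ σ) = (Equiv.Perm.sign σ : ℤ) * vandermondeProd u := by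
  rw [vandermondeProd_eq_det, vandermondeProd_eq_det, ← Matrix.det_permute σ]
  rfl

theorem vandermondeProd_cons {k : ℕ} (x : ℂ) (u : Fin k → ℂ) :
    vandermondeProd (Fin.cons x u : Fin (k + 1) → ℂ) = (∏ α, (x - u α)) * vandermondeProd u := by
  rw [vandermondeProd, Fin.prod_univ_succ, vandermondeProd]
  congr 1
  · rw [Fin.Ioi_zero_eq_map, prod_map]
    simp
  · refine prod_congr rfl fun i _ => ?_
    rw [Fin.Ioi_succ, prod_map]
    simp

theorem vandermondeProd_eq_zero {k : ℕ} {u : Fin k → ℂ} (h : ¬ Function.Injective u) :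
    vandermondeProd u = 0 := by
  rw [vandermondeProd_eq_det, ← not_ne_iff, Matrix.det_vandermonde_ne_zero_iff]
  exact fun h' => h fun a b hab => h' (by simp only [hab])

theorem vandermondeProd_ne_zero {k : ℕ} {u : Fin k → ℂ} (h : Function.Injective u) :
    vandermondeProd u ≠ 0 := by
  rw [vandermondeProd_eq_det, Matrix.det_vandermonde_ne_zero_iff]
  exact fun a b hab => h (neg_injective hab)

theorem vandermondeProd_sq {k : ℕ} (u : Fin k → ℂ) :
    vandermondeProd u ^ 2 = pairSign k * ∏ i, ∏ j ∈ {i}ᶜ, (u i - u j) := by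
  rw [← prod_prod_Ioi_mul_eq_prod_prod_off_diag (fun j i => u i - u j), pairSign, sq,
    vandermondeProd, ← prod_mul_distrib, ← prod_mul_distrib]
  refine prod_congr rfl fun i _ => ?_
  rw [← prod_mul_distrib, ← prod_mul_distrib]
  refine prod_congr rfl fun j _ => by ring

section Tuples

variable {L : Finset ℤ}

/-- The tuple of complex numbers underlying a tuple of elements of `L`. -/
def pt {k : ℕ} (w : Fin k → L) : Fin k → ℂ := fun α => ((w α : ℤ) : ℂ)

/-- The set of the entries of a tuple. -/
def tset {k : ℕ} (w : Fin k → L) : Finset ℤ := univ.image fun α => (w α : ℤ)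

theorem pt_injective {k : ℕ} {w : Fin k → L} : Function.Injective (pt w) ↔ Function.Injective w := by
  constructor
  · intro h a b hab
    exact h (by simp only [pt, hab])
  · intro h a b hab
    exact h (Subtype.ext (Int.cast_injective hab))

theorem tset_subset {k : ℕ} (w : Fin k → L) : tset w ⊆ L := by
  intro a ha
  obtain ⟨α, -, rfl⟩ := mem_image.1 ha
  exact (w α).2

theorem val_injective {k : ℕ} {w : Fin k → L} (hw : Function.Injective w) :
    Function.Injective fun α => (w α : ℤ) := fun _ _ hab => hw (Subtype.ext hab)

theorem card_tset {k : ℕ} {w : Fin k → L} (hw : Function.Injective w) : (tset w).card = k := by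
  rw [tset, card_image_of_injective _ (val_injective hw), card_univ, Fintype.card_fin]

theorem prod_tset {k : ℕ} {w : Fin k → L} (hw : Function.Injective w) (g : ℤ → ℂ) :
    ∏ a ∈ tset w, g a = ∏ α, g (w α) :=
  prod_image fun _ _ _ _ hab => val_injective hw hab

theorem sum_tset {k : ℕ} {w : Fin k → L} (hw : Function.Injective w) (g : ℤ → ℂ) :
    ∑ a ∈ tset w, g a = ∑ α, g (w α) :=
  sum_image fun _ _ _ _ hab => val_injective hw hab

theorem tset_comp {k : ℕ} (w : Fin k → L) (σ : Equiv.Perm (Fin k)) : tset (w ∘ σ) = tset w := by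
  ext a
  simp only [tset, mem_image, mem_univ, true_and, Function.comp]
  constructor
  · rintro ⟨α, h⟩
    exact ⟨σ α, h⟩
  · rintro ⟨α, h⟩
    exact ⟨σ.symm α, by rw [Equiv.apply_symm_apply, h]⟩

theorem vandermondeProd_sq_tset {k : ℕ} {w : Fin k → L} (hw : Function.Injective w) :
    vandermondeProd (pt w) ^ 2 =
      pairSign k * ∏ a ∈ tset w, rootPoly ((tset w).erase a) a := by
  rw [vandermondeProd_sq, prod_tset hw]
  congr 1
  refine prod_congr rfl fun i _ => ?_
  have : (tset w).erase (w i) = ({i}ᶜ : Finset (Fin k)).image fun α => (w α : ℤ) := by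
    ext a
    simp only [tset, mem_erase, mem_image, mem_univ, true_and, mem_compl, mem_singleton]
    constructor
    · rintro ⟨h1, α, rfl⟩
      exact ⟨α, fun h => h1 (by rw [h]), rfl⟩
    · rintro ⟨α, h1, rfl⟩
      exact ⟨fun h => h1 (val_injective hw h), α, rfl⟩
  rw [this, rootPoly, prod_image fun _ _ _ _ hab => val_injective hw hab]
  rfl

/-- A sum over injective tuples that depends only on the set of the entries. -/
theorem sum_injective_tuples (L : Finset ℤ) (k : ℕ) (G : Finset ℤ → ℂ) (T : (Fin k → L) → ℂ)
    (h1 : ∀ w, Function.Injective w → T w = G (tset w))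
    (h2 : ∀ w, ¬ Function.Injective w → T w = 0) :
    ∑ w, T w = (k.factorial : ℂ) * ∑ U ∈ powersetCard k L, G U := by
  classical
  rw [← sum_filter_add_sum_filter_not univ fun w : Fin k → L => Function.Injective w,
    sum_eq_zero (s := filter (fun w => ¬ _) _) fun w hw => h2 w (mem_filter.1 hw).2, add_zero,
    ← sum_fiberwise_of_maps_to (s := filter _ _) (t := powersetCard k L) (g := tset), mul_sum]
  · refine sum_congr rfl fun U hU => ?_
    obtain ⟨hUL, hUk⟩ := mem_powersetCard.1 hU
    rw [sum_congr rfl (g := fun _ => G U), sum_const, nsmul_eq_mul]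
    · congr 2
      have e0 : Fin k ≃ U := Fintype.equivOfCardEq (by simp [hUk])
      have hc : (univ : Finset (Fin k ≃ U)).card = k.factorial := by
        rw [card_univ, Fintype.card_equiv e0, Fintype.card_fin]
      rw [← hc]
      symm
      refine card_bij (fun e _ => fun α => ⟨(e α : ℤ), hUL (e α).2⟩) ?_ ?_ ?_
      · intro e _
        rw [mem_filter, mem_filter]
        refine ⟨⟨mem_univ _, fun a b hab => ?_⟩, ?_⟩
        · have h := congrArg (fun t : L => (t : ℤ)) hab
          exact e.injective (Subtype.ext h)
        · ext a
          simp only [tset, mem_image, mem_univ, true_and]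
          constructor
          · rintro ⟨α, rfl⟩
            exact (e α).2
          · intro ha
            exact ⟨e.symm ⟨a, ha⟩, by rw [Equiv.apply_symm_apply]⟩
      · intro e _ e' _ h
        ext α
        exact congrArg (fun t : L => (t : ℤ)) (congrFun h α)
      · intro w hw
        rw [mem_filter, mem_filter] at hw
        have hmem : ∀ α, (w α : ℤ) ∈ U := fun α => by
          rw [← hw.2]
          exact mem_image.2 ⟨α, mem_univ _, rfl⟩
        refine ⟨Equiv.ofBijective (fun α => ⟨(w α : ℤ), hmem α⟩) ⟨fun a b hab => ?_, ?_⟩,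
          mem_univ _, ?_⟩
        · exact val_injective hw.1.2 (congrArg (fun t : U => (t : ℤ)) hab)
        · rintro ⟨a, ha⟩
          rw [← hw.2] at ha
          obtain ⟨α, -, rfl⟩ := mem_image.1 ha
          exact ⟨α, rfl⟩
        · rfl
    · intro w hw
      rw [mem_filter, mem_filter] at hw
      rw [h1 w hw.1.2, hw.2]
  · intro w hw
    exact mem_powersetCard.2 ⟨tset_subset w, card_tset (mem_filter.1 hw).2⟩

theorem rootPoly_union {S T : Finset ℤ} (h : Disjoint S T) (z : ℂ) :
    rootPoly (S ∪ T) z = rootPoly S z * rootPoly T z := prod_union h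

theorem rootPoly_erase_ne_zero (S : Finset ℤ) (a : ℤ) : rootPoly (S.erase a) a ≠ 0 :=
  prod_erase_sub_ne_zero S a

/-- Sums over tuples in `L` weighted by the squared Vandermonde product can be rewritten as sums
over the complementary tuples. -/
theorem sum_complement (L : Finset ℤ) {k n : ℕ} (hL : L.card = k + n) (q : ℤ → ℂ)
    (hq : ∀ a ∈ L, q a ≠ 0) (Ψ : Finset ℤ → ℂ) :
    ∑ u : Fin k → L, (∏ α, q (u α) / rootPoly (L.erase (u α)) ((u α : ℤ) : ℂ)) *
        (vandermondeProd (pt u) ^ 2 * Ψ (tset u)) =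
      (k.factorial : ℂ) / (n.factorial : ℂ) * (pairSign L.card * ∏ a ∈ L, q a) *
        ∑ w : Fin n → L, (∏ α, 1 / (q (w α) * rootPoly (L.erase (w α)) ((w α : ℤ) : ℂ))) *
          (vandermondeProd (pt w) ^ 2 * Ψ (L \ tset w)) := by
  have hn : (n.factorial : ℂ) ≠ 0 := by exact_mod_cast n.factorial_ne_zero
  rw [sum_injective_tuples L k (fun U => (∏ a ∈ U, q a / rootPoly (L.erase a) a) *
      (pairSign k * (∏ a ∈ U, rootPoly (U.erase a) a) * Ψ U)),
    sum_injective_tuples L n (fun W => (∏ a ∈ W, 1 / (q a * rootPoly (L.erase a) a)) *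
      (pairSign n * (∏ a ∈ W, rootPoly (W.erase a) a) * Ψ (L \ W)))]
  · have h1 : ∑ U ∈ powersetCard k L, (∏ a ∈ U, q a / rootPoly (L.erase a) a) *
        (pairSign k * (∏ a ∈ U, rootPoly (U.erase a) a) * Ψ U) =
        (pairSign L.card * ∏ a ∈ L, q a) * ∑ W ∈ powersetCard n L,
          (∏ a ∈ W, 1 / (q a * rootPoly (L.erase a) a)) *
            (pairSign n * (∏ a ∈ W, rootPoly (W.erase a) a) * Ψ (L \ W)) := by
      rw [mul_sum]
      refine sum_bij' (fun U _ => L \ U) (fun W _ => L \ W) ?_ ?_ ?_ ?_ ?_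
      · intro U hU
        rw [mem_powersetCard] at hU ⊢
        refine ⟨sdiff_subset, ?_⟩
        rw [card_sdiff_of_subset hU.1]
        omega
      · intro U hU
        rw [mem_powersetCard] at hU ⊢
        refine ⟨sdiff_subset, ?_⟩
        rw [card_sdiff_of_subset hU.1]
        omega
      · intro U hU
        exact Finset.sdiff_sdiff_eq_self (mem_powersetCard.1 hU).1
      · intro U hU
        exact Finset.sdiff_sdiff_eq_self (mem_powersetCard.1 hU).1
      · intro U hU
        obtain ⟨hUL, hUk⟩ := mem_powersetCard.1 hU
        have hW : (L \ U).card = n := by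
          rw [card_sdiff_of_subset hUL]
          omega
        rw [Finset.sdiff_sdiff_eq_self hUL]
        -- Splitting the derivative of `Q_L` along `L = U ⊔ W` cancels the squared Vandermonde
        -- product of `U`. What remains is one over `∏ (a - b)` with `a ∈ U`, `b ∈ W`, symmetric in
        -- `U` and `W` up to `(-1)^(kn)`; the three signs combine to `pairSign L.card`.
        have hprod : ∀ (S T : Finset ℤ), Disjoint S T → S ∪ T = L →
            ∏ a ∈ S, rootPoly (L.erase a) a =
              (∏ a ∈ S, rootPoly (S.erase a) a) * ∏ a ∈ S, rootPoly T a := by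
          intro S T hST hL'
          rw [← prod_mul_distrib]
          refine prod_congr rfl fun a ha => ?_
          rw [← rootPoly_union (hST.mono_left (erase_subset _ _)), ← hL', erase_union_distrib,
            erase_eq_of_notMem (disjoint_left.1 hST ha)]
        have e1 := hprod U (L \ U) disjoint_sdiff (union_sdiff_of_subset hUL)
        have e2 := hprod (L \ U) U sdiff_disjoint (sdiff_union_of_subset hUL)
        have e3 : ∏ a ∈ L \ U, rootPoly U a = (-1) ^ (k * n) * ∏ a ∈ U, rootPoly (L \ U) a := by
          simp only [rootPoly]
          rw [prod_comm, mul_comm k, pow_mul, ← hUk, ← hW, ← prod_const, ← prod_const,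
            ← prod_mul_distrib]
          refine prod_congr rfl fun a _ => ?_
          rw [← prod_mul_distrib]
          refine prod_congr rfl fun b _ => by ring
        have n1 : ∏ a ∈ U, rootPoly (U.erase a) a ≠ 0 :=
          prod_ne_zero_iff.2 fun a _ => rootPoly_erase_ne_zero _ _
        have n2 : ∏ a ∈ L \ U, rootPoly ((L \ U).erase a) a ≠ 0 :=
          prod_ne_zero_iff.2 fun a _ => rootPoly_erase_ne_zero _ _
        have n3 : ∏ a ∈ U, rootPoly (L \ U) a ≠ 0 :=
          prod_ne_zero_iff.2 fun a ha => rootPoly_ne_zero fun b hb h => by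
            rw [Int.cast_injective h] at ha
            exact (mem_sdiff.1 hb).2 ha
        have n4 : ∏ a ∈ L \ U, q a ≠ 0 :=
          prod_ne_zero_iff.2 fun a ha => hq a (mem_sdiff.1 ha).1
        have e4 : ∏ a ∈ L, q a = (∏ a ∈ L \ U, q a) * ∏ a ∈ U, q a :=
          (prod_sdiff hUL).symm
        have e5 : ((-1 : ℂ) ^ (k * n)) * (-1) ^ (k * n) = 1 := by
          rw [← mul_pow]
          simp
        have n5 : ((-1 : ℂ) ^ (k * n)) ≠ 0 := by
          intro h
          rw [h] at e5
          simp at e5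
        rw [prod_div_distrib, prod_div_distrib, prod_mul_distrib, prod_const_one, e1, e2, e3, e4,
          hL, pairSign_add]
        have e6 := pairSign_mul_self n
        field_simp
        linear_combination (-pairSign k * Ψ U * ∏ x ∈ U, q x) * e6
    have h2 : ∀ c S : ℂ, (k.factorial : ℂ) * (c * S) =
        (k.factorial : ℂ) / (n.factorial : ℂ) * c * ((n.factorial : ℂ) * S) := fun c S => by
      field_simp
    rw [h1]
    exact h2 _ _
  · intro w hw
    rw [prod_tset hw, vandermondeProd_sq_tset hw]
  · intro w hw
    rw [vandermondeProd_eq_zero (fun h => hw (pt_injective.1 h))]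
    ring
  · intro w hw
    rw [prod_tset hw, vandermondeProd_sq_tset hw]
  · intro w hw
    rw [vandermondeProd_eq_zero (fun h => hw (pt_injective.1 h))]
    ring

end Tuples

/-! ### The ensemble of points in `𝓛` and its averaged coefficients. -/

/-- The determinant of the values of `n` functions at `n` points. -/
def valueDet {n : ℕ} (f : Fin n → ℂ → ℂ) (u : Fin n → ℂ) : ℂ :=
  (Matrix.of fun α β => f β (u α)).det

theorem valueDet_comp {n : ℕ} (f : Fin n → ℂ → ℂ) (u : Fin n → ℂ) (σ : Equiv.Perm (Fin n)) :
    valueDet f (u ∘ σ) = (Equiv.Perm.sign σ : ℤ) * valueDet f u := by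
  rw [valueDet, valueDet, ← Matrix.det_permute σ]
  rfl

/-- Expansion of an interpolated value: Cramer's rule. -/
theorem sum_mul_valueDet_update {n : ℕ} (f : Fin n → ℂ → ℂ) (u : Fin n → ℂ) (ζ : ℂ) (j : Fin n) :
    ∑ α, f j (u α) * valueDet f (Function.update u α ζ) = f j ζ * valueDet f u := by
  set A : Matrix (Fin n) (Fin n) ℂ := Matrix.of fun α β => f β (u α) with hA
  have h := congrFun (Matrix.mulVec_cramer A.transpose fun β => f β ζ) j
  rw [Matrix.det_transpose, Pi.smul_apply, smul_eq_mul, mul_comm] at h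
  rw [valueDet, ← hA, ← h, Matrix.mulVec, dotProduct]
  refine sum_congr rfl fun α _ => ?_
  rw [Matrix.cramer_transpose_apply, valueDet]
  congr 2
  ext a b
  by_cases h : a = α
  · subst h
    simp
  · simp [hA, Matrix.updateRow_ne h, Function.update_of_ne h]

theorem sum_comp_perm {ι : Type*} [Fintype ι] {k : ℕ} (σ : Equiv.Perm (Fin k))
    (T : (Fin k → ι) → ℂ) : ∑ w, T (w ∘ σ) = ∑ w, T w :=
  (σ.symm.arrowCongr (Equiv.refl ι)).sum_comp T

theorem sum_antisymm_mul_prod_eq_zero {ι : Type*} [Fintype ι] {k : ℕ} (T : (Fin k → ι) → ℂ)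
    (F : Fin k → ι → ℂ) {a b : Fin k} (hT : ∀ w, T (w ∘ Equiv.swap a b) = -T w) (hF : F a = F b) :
    ∑ w, T w * ∏ i, F i (w i) = 0 := by
  have h := sum_comp_perm (Equiv.swap a b) fun w : Fin k → ι => T w * ∏ i, F i (w i)
  have h2 : ∀ w : Fin k → ι, ∏ i, F i ((w ∘ Equiv.swap a b) i) = ∏ i, F i (w i) := by
    intro w
    rw [← Equiv.prod_comp (Equiv.swap a b)]
    refine prod_congr rfl fun i _ => ?_
    simp only [Function.comp, Equiv.swap_apply_self]
    have : F (Equiv.swap a b i) = F i := by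
      rcases eq_or_ne i a with rfl | ha
      · rw [Equiv.swap_apply_left, hF]
      rcases eq_or_ne i b with rfl | hb
      · rw [Equiv.swap_apply_right, hF]
      · rw [Equiv.swap_apply_of_ne_of_ne ha hb]
    rw [this]
  simp only [h2, hT, neg_mul, sum_neg_distrib] at h
  exact self_eq_neg.1 h.symm

variable {L : Finset ℤ}

/-- In each term of the expanded determinant the function `f j` is evaluated at two different
entries of `w`; exchanging them changes only the sign of `T`. -/
theorem sum_antisymm_mul_valueDet_tail {n : ℕ} (f : Fin n → ℂ → ℂ) (T : (Fin (n + 1) → L) → ℂ)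
    (hT : ∀ w, ∀ a b, a ≠ b → T (w ∘ Equiv.swap a b) = -T w) (j : Fin n) :
    ∑ w : Fin (n + 1) → L, T w * (f j (pt w 0) * valueDet f fun α => pt w α.succ) = 0 := by
  simp only [valueDet, Matrix.det_apply, mul_sum, Matrix.of_apply]
  rw [sum_comm]
  refine sum_eq_zero fun σ _ => ?_
  have h := sum_antisymm_mul_prod_eq_zero T
    (Fin.cons (fun a : L => f j (a : ℤ)) fun γ a => f (σ.symm γ) (a : ℤ)) (a := 0)
    (b := (σ j).succ) (fun w => hT w _ _ (Fin.succ_ne_zero _).symm) (by simp)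
  have h2 : ∀ w : Fin (n + 1) → L, T w * (f j (pt w 0) *
      (Equiv.Perm.sign σ • ∏ i, f i (pt w (σ i).succ))) = (Equiv.Perm.sign σ : ℤ) *
      (T w * ∏ i, (Fin.cons (fun a : L => f j (a : ℤ)) fun γ a => f (σ.symm γ) (a : ℤ) :
        Fin (n + 1) → L → ℂ) i (w i)) := by
    intro w
    rw [Fin.prod_univ_succ, ← Equiv.prod_comp σ fun γ => (Fin.cons (fun a : L => f j (a : ℤ))
      (fun γ a => f (σ.symm γ) (a : ℤ)) : Fin (n + 1) → L → ℂ) γ.succ (w γ.succ)]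
    simp only [Fin.cons_zero, Fin.cons_succ, Equiv.symm_apply_apply, pt, Units.smul_def,
      zsmul_eq_mul]
    ring
  rw [sum_congr rfl fun w _ => h2 w, ← mul_sum, h, mul_zero]

/-- By antisymmetry every position contributes as much as position `0`, and the sum over all
positions is Cramer's rule. -/
theorem sum_antisymm_mul_valueDet_update {n : ℕ} (f : Fin (n + 1) → ℂ → ℂ)
    (T : (Fin (n + 1) → L) → ℂ) (hT : ∀ w, ∀ a b, a ≠ b → T (w ∘ Equiv.swap a b) = -T w)
    (ζ : ℂ) (j : Fin (n + 1)) :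
    ((n : ℂ) + 1) * ∑ w : Fin (n + 1) → L,
        T w * (f j (pt w 0) * valueDet f (Function.update (pt w) 0 ζ)) =
      f j ζ * ∑ w : Fin (n + 1) → L, T w * valueDet f (pt w) := by
  have h : ∀ α : Fin (n + 1), ∑ w : Fin (n + 1) → L,
      T w * (f j (pt w α) * valueDet f (Function.update (pt w) α ζ)) = ∑ w : Fin (n + 1) → L,
        T w * (f j (pt w 0) * valueDet f (Function.update (pt w) 0 ζ)) := by
    intro α
    by_cases hα : α = 0
    · rw [hα]
    rw [← sum_comp_perm (Equiv.swap 0 α)]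
    refine sum_congr rfl fun w _ => ?_
    have h1 : pt (w ∘ Equiv.swap 0 α) α = pt w 0 := by simp [pt]
    have h2 : Function.update (pt (w ∘ Equiv.swap 0 α)) α ζ =
        Function.update (pt w) 0 ζ ∘ Equiv.swap 0 α := by
      funext i
      by_cases hi : i = α
      · subst hi
        simp
      · have : Equiv.swap 0 α i ≠ 0 := by
          rw [Ne, Equiv.swap_apply_eq_iff, Equiv.swap_apply_left]
          exact hi
        simp [Function.update_of_ne hi, Function.update_of_ne this, pt]
    rw [hT w _ _ (Ne.symm hα), h1, h2, valueDet_comp, Equiv.Perm.sign_swap (Ne.symm hα)]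
    push_cast
    ring
  have h3 : ∑ α : Fin (n + 1), ∑ w : Fin (n + 1) → L,
      T w * (f j (pt w α) * valueDet f (Function.update (pt w) α ζ)) =
      f j ζ * ∑ w : Fin (n + 1) → L, T w * valueDet f (pt w) := by
    rw [sum_comm, mul_sum]
    refine sum_congr rfl fun w _ => ?_
    rw [← mul_sum, sum_mul_valueDet_update]
    ring
  rw [← h3, sum_congr rfl fun α _ => h α, sum_const, card_univ, Fintype.card_fin, nsmul_eq_mul]
  push_cast
  rfl

/-- The weight of a tuple: the product of the residues of `1 / Q_X`. -/
def mass (X : Finset ℤ) {k : ℕ} (w : Fin k → L) : ℂ :=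
  ∏ α, 1 / rootPoly (X.erase (w α)) ((w α : ℤ) : ℂ)

theorem mass_comp (X : Finset ℤ) {k : ℕ} (w : Fin k → L) (σ : Equiv.Perm (Fin k)) :
    mass X (w ∘ σ) = mass X w :=
  Equiv.prod_comp σ fun α => 1 / rootPoly (X.erase (w α)) ((w α : ℤ) : ℂ)

theorem mass_succ (X : Finset ℤ) {k : ℕ} (w : Fin (k + 1) → L) :
    mass X w = 1 / rootPoly (X.erase (w 0)) ((w 0 : ℤ) : ℂ) * mass X fun α => w α.succ :=
  Fin.prod_univ_succ _

theorem sum_fin_succ {ι : Type*} [Fintype ι] {k : ℕ} (T : ι → (Fin k → ι) → ℂ) :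
    ∑ w : Fin (k + 1) → ι, T (w 0) (fun α => w α.succ) = ∑ a, ∑ w : Fin k → ι, T a w := by
  rw [← (Fin.consEquiv fun _ => ι).sum_comp, Fintype.sum_prod_type]
  simp only [Fin.consEquiv_apply, Fin.cons_zero, Fin.cons_succ]

/-- The partition function of the ensemble of `n` points in `L`. -/
def ensembleSum (X L : Finset ℤ) {n : ℕ} (f : Fin n → ℂ → ℂ) : ℂ :=
  ∑ w : Fin n → L, mass X w * vandermondeProd (pt w) * valueDet f (pt w)

/-- The averaged Lagrange interpolation coefficient. -/
def interpCoeff (X L : Finset ℤ) {n : ℕ} (f : Fin n → ℂ → ℂ) (x : ℤ) (ζ : ℂ) : ℂ :=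
  1 / rootPoly (X.erase x) x * ∑ w : Fin n → L,
    mass X w * vandermondeProd (Fin.cons (x : ℂ) (pt w) : Fin (n + 1) → ℂ) * valueDet f (pt w) *
      rootPoly (X \ insert x (tset w)) ζ

/-- The averaged divided difference coefficient. -/
def diffCoeff (X L : Finset ℤ) {n : ℕ} (f : Fin (n + 1) → ℂ → ℂ) (x : ℤ) (ζ : ℂ) : ℂ :=
  1 / rootPoly (X.erase x) x * (((n : ℂ) + 1) * ∑ w : Fin n → L,
    mass X w * vandermondeProd (Fin.cons (x : ℂ) (pt w) : Fin (n + 1) → ℂ) *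
      valueDet f (Fin.cons ζ (pt w)))

/-- For each `w` separately, the coefficients are those of Lagrange interpolation at `X \ tset w`,
up to the weight of `w`. Points of `tset w` drop out because the longer Vandermonde product vanishes
there. -/
theorem sum_eval_mul_interpCoeff {X : Finset ℤ} (hLX : L ⊆ X) {n : ℕ} (f : Fin n → ℂ → ℂ)
    (g : Polynomial ℂ) (hg : g.natDegree + n < X.card) (ζ : ℂ) :
    ∑ x ∈ X, g.eval (x : ℂ) * interpCoeff X L f x ζ = g.eval ζ * ensembleSum X L f := by
  simp only [interpCoeff, ensembleSum, mul_sum]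
  rw [sum_comm]
  refine sum_congr rfl fun w _ => ?_
  by_cases hw : Function.Injective w
  · have hsub : tset w ⊆ X := (tset_subset w).trans hLX
    have hcard : (X \ tset w).card = X.card - n := by
      rw [card_sdiff_of_subset hsub, card_tset hw]
    have hdeg : g.degree < ((X \ tset w).card : WithBot ℕ) := by
      rw [hcard]
      refine (Polynomial.degree_le_natDegree).trans_lt ?_
      exact_mod_cast (by omega : g.natDegree < X.card - n)
    rw [eval_eq_sum_lagrange _ g hdeg ζ, sum_mul, ← sum_sdiff hsub,
      sum_eq_zero (s := tset w), add_zero]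
    · refine sum_congr rfl fun x hx => ?_
      have hx' := (mem_sdiff.1 hx)
      have h1 : X \ insert x (tset w) = (X \ tset w).erase x := by
        ext a
        simp only [mem_sdiff, mem_insert, mem_erase]
        tauto
      have h2 : X.erase x = (X \ tset w).erase x ∪ tset w := by
        ext a
        simp only [mem_sdiff, mem_union, mem_erase]
        constructor
        · tauto
        · rintro (h | h)
          · exact ⟨h.1, h.2.1⟩
          · exact ⟨fun h' => hx'.2 (h' ▸ h), hsub h⟩
      have h3 : Disjoint ((X \ tset w).erase x) (tset w) :=
        sdiff_disjoint.mono_left (erase_subset _ _)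
      have h4 : rootPoly (tset w) x = ∏ α, ((x : ℂ) - pt w α) := prod_tset hw _
      have h5 : rootPoly (tset w) x ≠ 0 := rootPoly_ne_zero fun a ha h =>
        hx'.2 (by rw [Int.cast_injective h]; exact ha)
      have h6 := rootPoly_erase_ne_zero (X \ tset w) x
      rw [h1, h2, rootPoly_union h3, vandermondeProd_cons, ← h4]
      field_simp
    · intro x hx
      obtain ⟨α, -, rfl⟩ := mem_image.1 hx
      rw [vandermondeProd_cons, prod_eq_zero (mem_univ α) (sub_self _)]
      ring
  · have h1 : ¬ Function.Injective (pt w) := fun h => hw (pt_injective.1 h)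
    have h2 := vandermondeProd_eq_zero h1
    simp only [vandermondeProd_cons, h2, mul_zero, zero_mul, sum_const_zero]

/-- Divided differences annihilate polynomials of small degree. -/
theorem sum_eval_div_eq_zero (X : Finset ℤ) (g : Polynomial ℂ) (hg : g.natDegree + 1 < X.card) :
    ∑ x ∈ X, g.eval (x : ℂ) / rootPoly (X.erase x) x = 0 := by
  have hinj : Set.InjOn (fun a : ℤ => (a : ℂ)) X := fun a _ b _ h => Int.cast_injective h
  have h := Lagrange.coeff_eq_sum hinj (P := g) (by
    refine (Polynomial.degree_le_natDegree).trans_lt ?_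
    exact_mod_cast (by omega : g.natDegree < X.card))
  rw [Polynomial.coeff_eq_zero_of_natDegree_lt (by omega)] at h
  exact h.symm

/-- For fixed `w` the dependence on `x` is a polynomial of degree `n` over the derivative of `Q_X`
at `x`, that is, a divided difference over all of `X`. -/
theorem sum_eval_mul_diffCoeff {X : Finset ℤ} {n : ℕ} (f : Fin (n + 1) → ℂ → ℂ)
    (g : Polynomial ℂ) (hg : g.natDegree + (n + 1) < X.card) (ζ : ℂ) :
    ∑ x ∈ X, g.eval (x : ℂ) * diffCoeff X L f x ζ = 0 := by
  simp only [diffCoeff, mul_sum]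
  rw [sum_comm]
  refine sum_eq_zero fun w _ => ?_
  have h := sum_eval_div_eq_zero X (g * ∏ α, (Polynomial.X - Polynomial.C (pt w α))) (by
    have h1 := Polynomial.natDegree_mul_le (p := g)
      (q := ∏ α, (Polynomial.X - Polynomial.C (pt w α)))
    rw [Polynomial.natDegree_finsetProd_X_sub_C_eq_card] at h1
    simp only [card_univ, Fintype.card_fin] at h1
    omega)
  rw [← mul_zero (((n : ℂ) + 1) * (mass X w * vandermondeProd (pt w) *
    valueDet f (Fin.cons ζ (pt w)))), ← h, mul_sum]
  refine sum_congr rfl fun x _ => ?_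
  rw [vandermondeProd_cons, Polynomial.eval_mul, Polynomial.eval_prod]
  simp only [Polynomial.eval_sub, Polynomial.eval_X, Polynomial.eval_C]
  ring

theorem mass_mul_vandermonde_swap (X : Finset ℤ) {k : ℕ} (w : Fin k → L) {a b : Fin k} (hab : a ≠ b) :
    mass X (w ∘ Equiv.swap a b) * vandermondeProd (pt (w ∘ Equiv.swap a b)) =
      -(mass X w * vandermondeProd (pt w)) := by
  rw [mass_comp, show pt (w ∘ Equiv.swap a b) = pt w ∘ Equiv.swap a b from rfl,
    vandermondeProd_comp, Equiv.Perm.sign_swap hab]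
  push_cast
  ring

theorem cons_pt {k : ℕ} (w : Fin (k + 1) → L) :
    (Fin.cons ((w 0 : ℤ) : ℂ) (pt fun α => w α.succ) : Fin (k + 1) → ℂ) = pt w := by
  funext i
  refine Fin.cases ?_ (fun i => ?_) i <;> simp [pt]

/-- Joining `x ∈ L` to the tuple makes the weight antisymmetric in all `n + 1` points, while the
interpolation numerator depends only on their set. So `f j` cannot occur twice. -/
theorem sum_mul_interpCoeff_eq_zero (X : Finset ℤ) {n : ℕ} (f : Fin n → ℂ → ℂ) (j : Fin n)
    (ζ : ℂ) : ∑ x ∈ L, f j x * interpCoeff X L f x ζ = 0 := by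
  have h := sum_antisymm_mul_valueDet_tail f
    (fun w : Fin (n + 1) → L => mass X w * vandermondeProd (pt w) * rootPoly (X \ tset w) ζ) ?_ j
  · rw [← h, ← sum_coe_sort L]
    have hins : ∀ w : Fin (n + 1) → L, tset w = insert (w 0 : ℤ) (tset fun α => w α.succ) := by
      intro w
      ext a
      simp only [tset, mem_image, mem_univ, true_and, mem_insert, Fin.exists_fin_succ]
      rw [eq_comm]
    simp only [interpCoeff, mul_sum]
    rw [← sum_fin_succ]
    refine sum_congr rfl fun w _ => ?_
    have htail : (fun α : Fin n => pt w α.succ) = pt fun α => w α.succ := rfl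
    rw [cons_pt, mass_succ X w, hins w, htail]
    simp only [pt]
    ring
  · intro w a b hab
    rw [mass_mul_vandermonde_swap X w hab, tset_comp]
    ring

theorem sum_mul_diffCoeff (X : Finset ℤ) {n : ℕ} (f : Fin (n + 1) → ℂ → ℂ) (j : Fin (n + 1))
    (ζ : ℂ) : ∑ x ∈ L, f j x * diffCoeff X L f x ζ = f j ζ * ensembleSum X L f := by
  have h := sum_antisymm_mul_valueDet_update f
    (fun w : Fin (n + 1) → L => mass X w * vandermondeProd (pt w))
    (fun w a b hab => mass_mul_vandermonde_swap X w hab) ζ j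
  rw [ensembleSum, ← h, ← sum_coe_sort L, mul_sum]
  simp only [diffCoeff, mul_sum]
  rw [← sum_fin_succ]
  refine sum_congr rfl fun w _ => ?_
  have h2 : Function.update (pt w) 0 ζ = Fin.cons ζ (pt fun α => w α.succ) := by
    rw [← cons_pt w, Fin.update_cons_zero]
  rw [cons_pt, mass_succ X w, h2]
  simp only [pt]
  ring

/-- Andréief's identity. -/
theorem ensembleSum_eq_det (X : Finset ℤ) {n : ℕ} (f : Fin n → ℂ → ℂ) :
    ensembleSum X L f = (n.factorial : ℂ) * (Matrix.of fun a β : Fin n =>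
      ∑ x : L, 1 / rootPoly (X.erase x) ((x : ℤ) : ℂ) * f β (x : ℤ) * (-((x : ℤ) : ℂ)) ^ (a : ℕ)).det := by
  have h1 : ∀ σ : Equiv.Perm (Fin n), ∑ w : Fin n → L, mass X w * vandermondeProd (pt w) *
      ((Equiv.Perm.sign σ : ℤ) * ∏ i, f i (pt w (σ i))) =
      ∑ w : Fin n → L, mass X w * vandermondeProd (pt w) * ∏ i, f i (pt w i) := by
    intro σ
    rw [← sum_comp_perm σ fun w : Fin n → L => mass X w * vandermondeProd (pt w) *
      ∏ i, f i (pt w i)]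
    refine sum_congr rfl fun w _ => ?_
    rw [mass_comp, show pt (w ∘ σ) = pt w ∘ σ from rfl, vandermondeProd_comp]
    simp only [Function.comp]
    ring
  have h2 : ensembleSum X L f = (n.factorial : ℂ) *
      ∑ w : Fin n → L, mass X w * vandermondeProd (pt w) * ∏ i, f i (pt w i) := by
    simp only [ensembleSum, valueDet, Matrix.det_apply', Matrix.of_apply]
    simp only [mul_sum (univ : Finset (Equiv.Perm (Fin n)))]
    rw [sum_comm, sum_congr rfl fun σ _ => h1 σ, sum_const, card_univ, Fintype.card_perm,
      Fintype.card_fin, nsmul_eq_mul]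
  rw [h2]
  congr 1
  rw [Matrix.det_apply']
  simp only [Matrix.of_apply, prod_univ_sum, Fintype.piFinset_univ, mul_sum]
  rw [sum_comm]
  refine sum_congr rfl fun w _ => ?_
  have h3 : vandermondeProd (pt w) = ∑ σ : Equiv.Perm (Fin n), (Equiv.Perm.sign σ : ℤ) *
      ∏ i, (-((w i : ℤ) : ℂ)) ^ ((σ i : Fin n) : ℕ) := by
    rw [vandermondeProd_eq_det, ← Matrix.det_transpose, Matrix.det_apply']
    rfl
  rw [h3, mass, mul_sum, sum_mul]
  refine sum_congr rfl fun σ _ => ?_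
  rw [prod_mul_distrib, prod_mul_distrib]
  simp only [pt]
  ring

/-! ### The multiple integrals as averages over the ensemble. -/

namespace CutHexagon

variable {H : CutHexagon}

theorem mem_setL {a : ℤ} : a ∈ H.setL ↔ a ∈ H.X ∧ a < H.yFirst - H.N + 1 := mem_filter

theorem mem_setR {a : ℤ} : a ∈ H.setR ↔ a ∈ H.X ∧ H.yLast ≤ a := mem_filter

theorem mem_setC {a : ℤ} :
    a ∈ H.setC ↔ a ∈ H.X ∧ H.yFirst - H.N + 1 ≤ a ∧ a < H.yLast := by
  rw [setC, mem_sdiff, mem_union, mem_setL, mem_setR, not_or, not_and, not_and, not_lt, not_le]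
  tauto

theorem mem_setG {a : ℤ} :
    a ∈ H.setG ↔ (H.yFirst - H.N + 1 ≤ a ∧ a ≤ H.yLast - 1) ∧ a ∉ H.setC := by
  rw [setG, mem_sdiff, mem_Icc]

theorem setL_subset : H.setL ⊆ H.X := filter_subset _ _

theorem yLast_le_yFirst : H.yLast ≤ H.yFirst := H.Y.min'_le _ (H.Y.max'_mem _)

/-- These are the zeros common to all the cut functions, hence the factor pulled out of their
determinant. -/
theorem P_eq_rootPoly (hspan : H.yFirst - H.yLast ≤ (H.N : ℤ) - 1) (z : ℂ) :
    H.P z = rootPoly (Icc (H.yFirst - H.N + 1) (H.yLast - 1)) z := by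
  unfold P
  obtain ⟨k, hk⟩ : ∃ k : ℕ, ((H.N : ℤ) - (H.yFirst - H.yLast + 1)) = k :=
    Int.eq_ofNat_of_zero_le (by omega)
  rw [hk, Int.toNat_natCast]
  rcases k with _ | k
  · rw [rising_zero, Icc_eq_empty (by push_cast at hk; omega)]
    simp [rootPoly]
  · have h := rising_eq_rootPoly z (H.yLast - 1) k
    rw [show z - (H.yLast : ℂ) + 1 = z - ((H.yLast - 1 : ℤ) : ℂ) by push_cast; ring, h]
    congr 2
    push_cast at hk
    omega

theorem P_eq_mul (hspan : H.yFirst - H.yLast ≤ (H.N : ℤ) - 1) (z : ℂ) :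
    H.P z = rootPoly H.setC z * rootPoly H.setG z := by
  rw [P_eq_rootPoly hspan, ← rootPoly_union]
  · congr 1
    ext a
    rw [mem_union, mem_setG, mem_Icc]
    have := @mem_setC H a
    constructor
    · intro h
      by_cases h' : a ∈ H.setC
      · exact Or.inl h'
      · exact Or.inr ⟨h, h'⟩
    · rintro (h | h)
      · have := this.1 h
        omega
      · exact h.1
  · rw [disjoint_left]
    intro a h1 h2
    exact (mem_setG.1 h2).2 h1

theorem rootPoly_sdiff_tset (hspan : H.yFirst - H.yLast ≤ (H.N : ℤ) - 1) {W : Finset ℤ}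
    (hW : W ⊆ H.setL) (z : ℂ) :
    rootPoly (H.X \ W) z = rootPoly H.setR z * rootPoly H.setC z * rootPoly (H.setL \ W) z := by
  rw [← rootPoly_union, ← rootPoly_union]
  · congr 1
    ext a
    have h1 := @mem_setC H a
    have h2 := @mem_setL H a
    have h3 := @mem_setR H a
    have h4 := @hW a
    simp only [mem_sdiff, mem_union, h1, h2, h3] at h4 ⊢
    constructor
    · rintro ⟨h5, h6⟩
      by_cases h7 : a < H.yFirst - H.N + 1
      · exact Or.inr ⟨⟨h5, h7⟩, h6⟩
      · by_cases h8 : H.yLast ≤ a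
        · exact Or.inl (Or.inl ⟨h5, h8⟩)
        · exact Or.inl (Or.inr ⟨h5, by omega, by omega⟩)
    · rintro ((h | h) | h)
      · refine ⟨h.1, fun h5 => ?_⟩
        have := (h4 h5).2
        have h6 := yLast_le_yFirst (H := H)
        omega
      · refine ⟨h.1, fun h5 => ?_⟩
        have := (h4 h5).2
        omega
      · exact ⟨h.1.1, h.2⟩
  · rw [disjoint_left]
    intro a h1 h2
    have h3 := mem_setL.1 (mem_sdiff.1 h2).1
    rcases mem_union.1 h1 with h | h
    · have := mem_setR.1 h
      omega
    · have := mem_setC.1 h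
      omega
  · rw [disjoint_left]
    intro a h1 h2
    have := mem_setR.1 h1
    have := mem_setC.1 h2
    omega

theorem rootPoly_setR_ne_zero (hspan : H.yFirst - H.yLast ≤ (H.N : ℤ) - 1) {a : ℤ}
    (ha : a ∈ H.setL) : rootPoly H.setR a ≠ 0 := rootPoly_ne_zero fun b hb h => by
  have h1 := mem_setR.1 hb
  have h2 := mem_setL.1 ha
  have h3 : a = b := Int.cast_injective h
  omega

theorem rootPoly_setC_ne_zero {a : ℤ} (ha : a ∈ H.setL) : rootPoly H.setC a ≠ 0 :=
  rootPoly_ne_zero fun b hb h => by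
    have h1 := mem_setC.1 hb
    have h2 := mem_setL.1 ha
    have h3 : a = b := Int.cast_injective h
    omega

theorem notMem_setG {a : ℤ} (ha : a ∈ H.setL) : a ∉ H.setG := fun h => by
  have h1 := mem_setG.1 h
  have h2 := mem_setL.1 ha
  omega

theorem rootPoly_setG_ne_zero {a : ℤ} (ha : a ∈ H.setL) : rootPoly H.setG a ≠ 0 :=
  rootPoly_ne_zero fun b hb h => notMem_setG ha (by rwa [Int.cast_injective h])

theorem rootPoly_erase_setL (hspan : H.yFirst - H.yLast ≤ (H.N : ℤ) - 1) {a : ℤ}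
    (ha : a ∈ H.setL) : rootPoly (H.X.erase a) a =
      rootPoly H.setR a * rootPoly H.setC a * rootPoly (H.setL.erase a) a := by
  have := rootPoly_sdiff_tset hspan (W := {a}) (by simpa using ha) a
  rwa [sdiff_singleton_eq_erase, sdiff_singleton_eq_erase] at this

/-- The functions in the determinant of the lower cuts, for an enumeration `y` of the integers in
the lower cuts. -/
def cutFun (H : CutHexagon) {n : ℕ} (y : Fin n → ℤ) (β : Fin n) (z : ℂ) : ℂ :=
  binom (H.N - 1) (z - y β)

theorem expressesCutPoly_iff {n : ℕ} (hn : n = H.d) (F : MvPolynomial ℕ ℂ) :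
    H.ExpressesCutPoly F ↔ ∀ w : Fin n → ℂ, valueDet (H.cutFun fun i => H.y (Fin.cast hn i)) w =
      H.cutConst * vandermondeProd w * MvPolynomial.eval (fun a : ℕ => ∑ i, w i ^ a) F *
        ∏ α, H.P (w α) := by
  subst hn
  rfl

theorem cutConst_ne_zero : H.cutConst ≠ 0 := by
  have h : Function.Injective fun i => (H.y i : ℂ) := by
    intro i j hij
    have h1 : H.y i = H.y j := Int.cast_injective hij
    exact Fin.rev_injective ((H.Y.orderEmbOfFin rfl).injective h1)
  refine mul_ne_zero (prod_ne_zero_iff.2 fun j _ => ?_)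
    (div_ne_zero (vandermondeProd_ne_zero h) (prod_ne_zero_iff.2 fun j _ => ?_))
  · exact one_div_ne_zero (by exact_mod_cast Nat.factorial_ne_zero _)
  · exact_mod_cast Nat.factorial_ne_zero _

/-- The normalization of `Ω⁺`. -/
def omegaConst (H : CutHexagon) : ℂ :=
  pairSign H.setL.card * (∏ a ∈ H.setL, rootPoly H.setR a / rootPoly H.setG a) / H.cutConst

theorem omegaConst_ne_zero (hspan : H.yFirst - H.yLast ≤ (H.N : ℤ) - 1) : H.omegaConst ≠ 0 := by
  refine div_ne_zero (mul_ne_zero (fun h => ?_) (prod_ne_zero_iff.2 fun a ha => ?_))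
    cutConst_ne_zero
  · have := pairSign_mul_self H.setL.card
    rw [h] at this
    simp at this
  · exact div_ne_zero (rootPoly_setR_ne_zero hspan ha) (rootPoly_setG_ne_zero ha)

/-- Here the form of `h` pays off: with `P = Q_𝓒 Q_𝓖`, the reciprocal weights on the complement are
residues of `1 / Q_X` times `P`, the factor needed to rebuild the determinant of the cut functions.
-/
theorem prod_inv_mul_P (hspan : H.yFirst - H.yLast ≤ (H.N : ℤ) - 1) {k : ℕ} (w : Fin k → H.setL) :
    ∏ α, 1 / (rootPoly H.setR (w α : ℤ) / rootPoly H.setG (w α : ℤ) *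
      rootPoly (H.setL.erase (w α)) ((w α : ℤ) : ℂ)) = mass H.X w * ∏ α, H.P (pt w α) := by
  rw [mass, ← prod_mul_distrib]
  refine prod_congr rfl fun α _ => ?_
  have h1 := rootPoly_setR_ne_zero hspan (w α).2
  have h2 := rootPoly_setG_ne_zero (w α).2
  have h3 := rootPoly_setC_ne_zero (w α).2
  have h4 := rootPoly_erase_ne_zero H.setL (w α)
  rw [rootPoly_erase_setL hspan (w α).2, P_eq_mul hspan]
  simp only [pt]
  field_simp

theorem compl_eq {F : MvPolynomial ℕ ℂ} {k : ℕ} {u : Fin k → H.setL} (hu : Function.Injective u) :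
    H.compl F (pt u) = MvPolynomial.eval (fun a : ℕ => ∑ b ∈ H.setL \ tset u, (b : ℂ) ^ a) F := by
  unfold compl
  congr 2
  funext a
  rw [powerSumL, ← sum_sdiff (tset_subset u), sum_tset hu]
  simp [pt]

theorem complWith_eq {F : MvPolynomial ℕ ℂ} {k : ℕ} {u : Fin k → H.setL} (z : ℂ)
    (hu : Function.Injective u) : H.complWith F z (pt u) =
      MvPolynomial.eval (fun a : ℕ => z ^ a + ∑ b ∈ H.setL \ tset u, (b : ℂ) ^ a) F := by
  unfold complWith
  congr 2
  funext a
  rw [powerSumL, ← sum_sdiff (tset_subset u), sum_tset hu]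
  simp only [pt]
  ring

/-- The sum over tuples that results from the contour integral `Ω⁺`, for the additional factor
`∏ a ∈ U, s a` with `U` the set of the variables. -/
theorem sum_omegaPlus (hspan : H.yFirst - H.yLast ≤ (H.N : ℤ) - 1) {n r : ℕ} (hn : n = H.d)
    (hr : H.setL.card = n + r) {F : MvPolynomial ℕ ℂ} (hF : H.ExpressesCutPoly F) (s : ℤ → ℂ) :
    ∑ u : Fin r → H.setL, (∏ α, rootPoly H.setR (u α : ℤ) / rootPoly H.setG (u α : ℤ) * s (u α) /
        rootPoly (H.setL.erase (u α)) ((u α : ℤ) : ℂ)) *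
        (vandermondeProd (pt u) ^ 2 * H.compl F (pt u)) =
      (r.factorial : ℂ) / (n.factorial : ℂ) * H.omegaConst *
        ∑ w : Fin n → H.setL, mass H.X w * vandermondeProd (pt w) *
          valueDet (H.cutFun fun i => H.y (Fin.cast hn i)) (pt w) *
            ∏ a ∈ H.setL \ tset w, s a := by
  have h := sum_complement H.setL (k := r) (n := n) (by omega)
    (fun a => rootPoly H.setR a / rootPoly H.setG a)
    (fun a ha => div_ne_zero (rootPoly_setR_ne_zero hspan ha) (rootPoly_setG_ne_zero ha))
    (fun U => (∏ a ∈ U, s a) *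
      MvPolynomial.eval (fun a : ℕ => ∑ b ∈ H.setL \ U, (b : ℂ) ^ a) F)
  have h1 : ∀ u : Fin r → H.setL,
      (∏ α, rootPoly H.setR (u α : ℤ) / rootPoly H.setG (u α : ℤ) * s (u α) /
        rootPoly (H.setL.erase (u α)) ((u α : ℤ) : ℂ)) *
        (vandermondeProd (pt u) ^ 2 * H.compl F (pt u)) =
      (∏ α, rootPoly H.setR (u α : ℤ) / rootPoly H.setG (u α : ℤ) /
        rootPoly (H.setL.erase (u α)) ((u α : ℤ) : ℂ)) *
        (vandermondeProd (pt u) ^ 2 * ((∏ a ∈ tset u, s a) *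
          MvPolynomial.eval (fun a : ℕ => ∑ b ∈ H.setL \ tset u, (b : ℂ) ^ a) F)) := by
    intro u
    by_cases hu : Function.Injective u
    · rw [compl_eq hu, prod_tset hu]
      simp only [mul_div_right_comm _ (s _)]
      rw [prod_mul_distrib]
      ring
    · rw [vandermondeProd_eq_zero fun h => hu (pt_injective.1 h)]
      ring
  rw [sum_congr rfl fun u _ => h1 u, h, omegaConst, mul_sum, mul_sum]
  refine sum_congr rfl fun w _ => ?_
  by_cases hw : Function.Injective w
  · have h2 := (expressesCutPoly_iff hn F).1 hF (pt w)
    have h3 : (fun a : ℕ => ∑ b ∈ H.setL \ (H.setL \ tset w), (b : ℂ) ^ a) =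
        fun a : ℕ => ∑ i, pt w i ^ a := by
      funext a
      rw [Finset.sdiff_sdiff_eq_self (tset_subset w), sum_tset hw]
      rfl
    have hc := cutConst_ne_zero (H := H)
    rw [prod_inv_mul_P hspan, h2, h3]
    field_simp
  · rw [vandermondeProd_eq_zero fun h => hw (pt_injective.1 h)]
    ring

/-- The sum over tuples that results from the contour integral `Ω⁻`. -/
theorem sum_omegaMinus (hspan : H.yFirst - H.yLast ≤ (H.N : ℤ) - 1) {n r : ℕ} (hn : n + 1 = H.d)
    (hr : H.setL.card = n + 1 + r) {F : MvPolynomial ℕ ℂ} (hF : H.ExpressesCutPoly F) {v z : ℂ}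
    (hz : ∀ a ∈ H.setL, z ≠ (a : ℤ)) :
    H.P z * rootPoly H.setL z * ∑ u : Fin (r + 1) → H.setL,
      (∏ α, rootPoly H.setR (u α : ℤ) / rootPoly H.setG (u α : ℤ) *
          ((z - (u α : ℤ))⁻¹ / (v - (u α : ℤ))) /
        rootPoly (H.setL.erase (u α)) ((u α : ℤ) : ℂ)) *
        (vandermondeProd (pt u) ^ 2 * H.complWith F z (pt u)) =
      ((r + 1).factorial : ℂ) / (n.factorial : ℂ) * H.omegaConst *
        ∑ w : Fin n → H.setL, mass H.X w * vandermondeProd (pt w) *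
          valueDet (H.cutFun fun i => H.y (Fin.cast hn i)) (Fin.cons z (pt w)) /
            rootPoly (H.setL \ tset w) v := by
  have h := sum_complement H.setL (k := r + 1) (n := n) (by omega)
    (fun a => rootPoly H.setR a / rootPoly H.setG a)
    (fun a ha => div_ne_zero (rootPoly_setR_ne_zero hspan ha) (rootPoly_setG_ne_zero ha))
    (fun U => (∏ a ∈ U, ((z - (a : ℂ))⁻¹ / (v - (a : ℂ)))) *
      MvPolynomial.eval (fun a : ℕ => z ^ a + ∑ b ∈ H.setL \ U, (b : ℂ) ^ a) F)
  have h1 : ∀ u : Fin (r + 1) → H.setL,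
      (∏ α, rootPoly H.setR (u α : ℤ) / rootPoly H.setG (u α : ℤ) *
          ((z - (u α : ℤ))⁻¹ / (v - (u α : ℤ))) /
        rootPoly (H.setL.erase (u α)) ((u α : ℤ) : ℂ)) *
        (vandermondeProd (pt u) ^ 2 * H.complWith F z (pt u)) =
      (∏ α, rootPoly H.setR (u α : ℤ) / rootPoly H.setG (u α : ℤ) /
        rootPoly (H.setL.erase (u α)) ((u α : ℤ) : ℂ)) *
        (vandermondeProd (pt u) ^ 2 * ((∏ a ∈ tset u, ((z - (a : ℂ))⁻¹ / (v - (a : ℂ)))) *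
          MvPolynomial.eval (fun a : ℕ => z ^ a + ∑ b ∈ H.setL \ tset u, (b : ℂ) ^ a) F)) := by
    intro u
    by_cases hu : Function.Injective u
    · rw [complWith_eq z hu, prod_tset hu]
      simp only [mul_div_right_comm _ (_ / _)]
      rw [prod_mul_distrib]
      ring
    · rw [vandermondeProd_eq_zero fun h => hu (pt_injective.1 h)]
      ring
  rw [sum_congr rfl fun u _ => h1 u, h, omegaConst, mul_sum, mul_sum, mul_sum]
  refine sum_congr rfl fun w _ => ?_
  by_cases hw : Function.Injective w
  -- The complement has only `d - 1` points; `z` serves as the missing variable of `E`. The factor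
  -- `P z` enters the determinant, and `Q_𝓛 z` supplies both the Vandermonde factor of `z` and the
  -- cancellation of the poles in `z`.
  · have h2 := (expressesCutPoly_iff hn F).1 hF (Fin.cons z (pt w))
    have h3 : (fun a : ℕ => z ^ a + ∑ b ∈ H.setL \ (H.setL \ tset w), (b : ℂ) ^ a) =
        fun a : ℕ => ∑ i, (Fin.cons z (pt w) : Fin (n + 1) → ℂ) i ^ a := by
      funext a
      rw [Finset.sdiff_sdiff_eq_self (tset_subset w), sum_tset hw, Fin.sum_univ_succ]
      simp [pt]
    have hc := cutConst_ne_zero (H := H)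
    have h4 : rootPoly H.setL z = rootPoly (H.setL \ tset w) z * ∏ α, (z - pt w α) := by
      have hu := rootPoly_union (sdiff_disjoint : Disjoint (H.setL \ tset w) (tset w)) z
      rw [sdiff_union_of_subset (tset_subset w)] at hu
      rw [hu]
      congr 1
      exact prod_tset hw _
    have h5 : ∏ a ∈ H.setL \ tset w, ((z - (a : ℂ))⁻¹ / (v - (a : ℂ))) =
        (rootPoly (H.setL \ tset w) z)⁻¹ / rootPoly (H.setL \ tset w) v := by
      rw [prod_div_distrib, prod_inv_distrib]
      rfl
    have h6 : rootPoly (H.setL \ tset w) z ≠ 0 :=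
      rootPoly_ne_zero fun a ha => hz a (mem_sdiff.1 ha).1
    rw [prod_inv_mul_P hspan, h2, h3, h4, h5, Fin.prod_univ_succ, vandermondeProd_cons]
    simp only [Fin.cons_zero, Fin.cons_succ]
    have key : ∀ p W D c q m p' V r' E C : ℂ, C ≠ 0 → W ≠ 0 →
        p * (W * D) * (c * q * (m * p' * (V ^ 2 * (W⁻¹ / r' * E)))) =
          c * (q / C) * (m * V * (C * (D * V) * E * (p * p')) / r') := by
      intro p W D c q m p' V r' E C hC hW
      simp only [div_eq_mul_inv]
      linear_combination (c * q * m * p' * V ^ 2 * r'⁻¹ * E * p * D) *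
        (mul_inv_cancel₀ hW - mul_inv_cancel₀ hC)
    exact key _ _ _ _ _ _ _ _ _ _ _ hc h6
  · rw [vandermondeProd_eq_zero fun h => hw (pt_injective.1 h)]
    ring

/-- The circles of radius `ε` about the points of `𝓛` do not enclose `v`. -/
def Avoids (H : CutHexagon) (ε : ℝ) (v : ℂ) : Prop :=
  ∀ p ∈ H.setL, ∀ u ∈ Metric.closedBall ((p : ℤ) : ℂ) ε, v - u ≠ 0

theorem avoids_of_mem_sphere {ε δ : ℝ} (h1 : ε < δ) (h2 : δ + ε < 1) {q : ℤ} {v : ℂ}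
    (hv : v ∈ Metric.sphere (q : ℂ) δ) : H.Avoids ε v := fun _ _ _ hu =>
  sub_ne_zero.2 (ne_of_mem_closedBall_of_mem_sphere h1 h2 hu hv).symm

theorem Avoids.ne_intCast {ε : ℝ} (h0 : 0 ≤ ε) {v : ℂ} (hv : H.Avoids ε v) :
    ∀ a ∈ H.setL, v ≠ (a : ℤ) := fun a ha =>
  sub_ne_zero.1 (hv a ha a (Metric.mem_closedBall_self h0))

theorem differentiableOn_setR_div_setG {ε : ℝ} (h1 : ε < 1) {p : ℤ} (hp : p ∈ H.setL) :
    DifferentiableOn ℂ (fun u => rootPoly H.setR u / rootPoly H.setG u)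
      (Metric.closedBall (p : ℂ) ε) :=
  (differentiable_rootPoly _).differentiableOn.div (differentiable_rootPoly _).differentiableOn
    fun _ hu => rootPoly_ne_zero fun a ha => ne_intCast_of_mem_closedBall h1
      (fun h : a = p => notMem_setG hp (h ▸ ha)) hu

theorem omegaPlus_eq (hspan : H.yFirst - H.yLast ≤ (H.N : ℤ) - 1) {n r : ℕ} (hn : n = H.d)
    (hr : H.setL.card = n + r) {F : MvPolynomial ℕ ℂ} (hF : H.ExpressesCutPoly F) {ε : ℝ}
    (h0 : 0 < ε) (h1 : ε < 1) {v : ℂ} (hv : H.Avoids ε v) (z : ℂ) :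
    H.omegaPlus F ε r v z = (r.factorial : ℂ) / (n.factorial : ℂ) * H.omegaConst *
      ∑ w : Fin n → H.setL, mass H.X w * vandermondeProd (pt w) *
        valueDet (H.cutFun fun i => H.y (Fin.cast hn i)) (pt w) *
          (rootPoly (H.setL \ tset w) z / rootPoly (H.setL \ tset w) v) := by
  rw [H.omegaPlus_eq_sum F h0 h1 r v z
    (fun u => rootPoly H.setR u / rootPoly H.setG u * ((z - u) / (v - u)))]
  · refine (sum_omegaPlus hspan hn hr hF fun a => (z - a) / (v - a)).trans ?_
    simp only [prod_div_distrib]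
    rfl
  · exact fun p hp => (differentiableOn_setR_div_setG h1 hp).mul
      (DifferentiableOn.div (by fun_prop) (by fun_prop) fun u hu => hv p hp u hu)
  · intro p _ u _
    simp only [h, div_eq_mul_inv, mul_inv]
    ring

theorem omegaPlus_zero (hspan : H.yFirst - H.yLast ≤ (H.N : ℤ) - 1) {n r : ℕ} (hn : n = H.d)
    (hr : H.setL.card = n + r) {F : MvPolynomial ℕ ℂ} (hF : H.ExpressesCutPoly F) {ε : ℝ}
    (h0 : 0 < ε) (h1 : ε < 1) :
    H.omegaPlus F ε r 0 0 = (r.factorial : ℂ) / (n.factorial : ℂ) * H.omegaConst *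
      ensembleSum H.X H.setL (H.cutFun fun i => H.y (Fin.cast hn i)) := by
  rw [H.omegaPlus_eq_sum F h0 h1 r 0 0 (fun u => rootPoly H.setR u / rootPoly H.setG u)]
  · have := sum_omegaPlus hspan hn hr hF fun _ => 1
    simp only [prod_const_one, mul_one] at this
    exact this
  · exact fun p hp => differentiableOn_setR_div_setG h1 hp
  · intro p _ u hu
    -- The circles have radius less than `1` about integers, so they miss `0`.
    have hu0 : (0 : ℂ) - u ≠ 0 := by
      have := ne_intCast_of_mem_sphere h0 h1 0 hu
      rw [Int.cast_zero] at this
      rwa [zero_sub, neg_ne_zero]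
    rw [mul_div_assoc, div_self hu0, mul_one, h, div_div]

theorem omegaMinus_eq (hspan : H.yFirst - H.yLast ≤ (H.N : ℤ) - 1) {n r : ℕ} (hn : n + 1 = H.d)
    (hr : H.setL.card = n + 1 + r) {F : MvPolynomial ℕ ℂ} (hF : H.ExpressesCutPoly F) {ε : ℝ}
    (h0 : 0 < ε) (h1 : ε < 1) {v z : ℂ} (hv : H.Avoids ε v) (hz : H.Avoids ε z) :
    H.P z * rootPoly H.setL z * H.omegaMinus F ε (r + 1) v z =
      ((r + 1).factorial : ℂ) / (n.factorial : ℂ) * H.omegaConst *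
        ∑ w : Fin n → H.setL, mass H.X w * vandermondeProd (pt w) *
          valueDet (H.cutFun fun i => H.y (Fin.cast hn i)) (Fin.cons z (pt w)) /
            rootPoly (H.setL \ tset w) v := by
  rw [H.omegaMinus_eq_sum F h0 h1 (r + 1) v z
    (fun u => rootPoly H.setR u / rootPoly H.setG u * ((z - u)⁻¹ / (v - u)))]
  · exact sum_omegaMinus hspan hn hr hF (hz.ne_intCast h0.le)
  · exact fun p hp => (differentiableOn_setR_div_setG h1 hp).mul
      (DifferentiableOn.div (DifferentiableOn.inv (by fun_prop) fun u hu => hz p hp u hu)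
        (by fun_prop) fun u hu => hv p hp u hu)
  · intro p _ u _
    simp only [h, div_eq_mul_inv, mul_inv]
    ring

theorem differentiable_binom (J : ℕ) : Differentiable ℂ (binom J) := by
  unfold binom rising
  exact ((Polynomial.differentiable (ascPochhammer ℂ J)).comp
    (differentiable_id.add_const (1 : ℂ))).div_const _

theorem differentiable_valueDet_cons {n : ℕ} (y : Fin (n + 1) → ℤ) (u : Fin n → ℂ) :
    Differentiable ℂ fun z => valueDet (H.cutFun y) (Fin.cons z u) := by
  simp only [valueDet, Matrix.det_apply]
  refine Differentiable.fun_sum fun σ _ => Differentiable.const_smul ?_ _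
  refine Differentiable.fun_finsetProd fun i _ => ?_
  simp only [Matrix.of_apply, cutFun]
  refine (differentiable_binom _).comp (Differentiable.sub_const ?_ _)
  refine Fin.cases ?_ (fun j => ?_) (σ i)
  · simp
  · simp

/-- One over the product `Q_𝓡 Q_𝓒 Q_{𝓛 \ W}` in terms of the numerator that cancels `W`. -/
theorem vandermondeProd_div (hspan : H.yFirst - H.yLast ≤ (H.N : ℤ) - 1) {k : ℕ}
    (w : Fin k → H.setL) {v : ℂ} (hv : ∀ a : ℤ, v ≠ a) :
    vandermondeProd (pt w) / (rootPoly H.setR v * rootPoly H.setC v *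
      rootPoly (H.setL \ tset w) v) =
        vandermondeProd (Fin.cons v (pt w) : Fin (k + 1) → ℂ) / rootPoly H.X v := by
  by_cases hw : Function.Injective w
  · have h1 := rootPoly_union (sdiff_disjoint : Disjoint (H.X \ tset w) (tset w)) v
    rw [sdiff_union_of_subset ((tset_subset w).trans setL_subset)] at h1
    have h2 : rootPoly (tset w) v = ∏ α, (v - pt w α) := prod_tset hw _
    have h3 : rootPoly (tset w) v ≠ 0 := rootPoly_ne_zero fun a _ => hv a
    have h4 : rootPoly (H.X \ tset w) v ≠ 0 := rootPoly_ne_zero fun a _ => hv a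
    rw [← rootPoly_sdiff_tset hspan (tset_subset w), vandermondeProd_cons, h1, ← h2]
    field_simp
  · rw [vandermondeProd_cons, vandermondeProd_eq_zero fun h => hw (pt_injective.1 h)]
    simp

/-- `Ω⁺` is a polynomial in `z`; its factors complete `Q_𝓡 Q_𝓒` to `Q` of `X \ tset w`. So the
integrand has poles only at `v` and at the nodes of the backward difference. -/
theorem inner_integral_infty (hspan : H.yFirst - H.yLast ≤ (H.N : ℤ) - 1) {n r : ℕ} (hn : n = H.d)
    (hr : H.setL.card = n + r) {F : MvPolynomial ℕ ℂ} (hF : H.ExpressesCutPoly F) {ε R : ℝ}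
    (h0 : 0 < ε) (h1 : ε < 1) {v : ℂ} (hv : H.Avoids ε v) (hv' : ∀ a : ℤ, v ≠ a)
    (hvR : v ∈ Metric.ball (0 : ℂ) R) (y : ℤ) (k : ℕ)
    (hZR : ∀ ζ ∈ Icc (y - k) y, ((ζ : ℤ) : ℂ) ∈ Metric.ball (0 : ℂ) R) :
    1 / (rootPoly H.setR v * rootPoly H.setC v) *
      circleInt 0 R (fun z => rootPoly H.setR z * rootPoly H.setC z /
        ((z - v) * rising (z - y) (k + 1)) * (H.omegaPlus F ε r v z / H.omegaPlus F ε r 0 0)) =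
    (∑ ζ ∈ Icc (y - k) y, 1 / rootPoly ((Icc (y - k) y).erase ζ) ζ * ∑ w : Fin n → H.setL,
      mass H.X w * vandermondeProd (Fin.cons v (pt w) : Fin (n + 1) → ℂ) *
        valueDet (H.cutFun fun i => H.y (Fin.cast hn i)) (pt w) *
          dslope (rootPoly (H.X \ tset w)) ζ v) /
      ensembleSum H.X H.setL (H.cutFun fun i => H.y (Fin.cast hn i)) / rootPoly H.X v := by
  set f := H.cutFun fun i => H.y (Fin.cast hn i) with hf
  have hrf : (r.factorial : ℂ) ≠ 0 := by exact_mod_cast r.factorial_ne_zero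
  have hnf : (n.factorial : ℂ) ≠ 0 := by exact_mod_cast n.factorial_ne_zero
  have hoc := omegaConst_ne_zero hspan
  have hc : (r.factorial : ℂ) / n.factorial * H.omegaConst ≠ 0 :=
    mul_ne_zero (div_ne_zero hrf hnf) hoc
  set A : ℂ → ℂ := fun z => ∑ w : Fin n → H.setL,
    mass H.X w * vandermondeProd (pt w) * valueDet f (pt w) / rootPoly (H.setL \ tset w) v /
      ensembleSum H.X H.setL f * rootPoly (H.X \ tset w) z with hA
  have hAd : Differentiable ℂ A :=
    Differentiable.fun_sum fun w _ => (differentiable_rootPoly _).const_mul _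
  have e1 : (fun z => rootPoly H.setR z * rootPoly H.setC z /
      ((z - v) * rising (z - y) (k + 1)) * (H.omegaPlus F ε r v z / H.omegaPlus F ε r 0 0)) =
      fun z => A z / ((z - v) * rootPoly (Icc (y - k) y) z) := by
    funext z
    rw [omegaPlus_eq hspan hn hr hF h0 h1 hv, omegaPlus_zero hspan hn hr hF h0 h1,
      mul_div_mul_left _ _ hc, rising_eq_rootPoly, div_mul_eq_mul_div, hA]
    congr 1
    rw [sum_div, mul_sum]
    refine sum_congr rfl fun w _ => ?_
    rw [rootPoly_sdiff_tset hspan (tset_subset w)]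
    ring
  rw [e1, circleInt_div_sub_mul_rootPoly _ ⟨y, by simp⟩ hAd hvR (fun ζ _ => hv' ζ) hZR,
    mul_sum, sum_div, sum_div]
  refine sum_congr rfl fun ζ _ => ?_
  have e2 : dslope A ζ v = ∑ w : Fin n → H.setL,
      mass H.X w * vandermondeProd (pt w) * valueDet f (pt w) / rootPoly (H.setL \ tset w) v /
        ensembleSum H.X H.setL f * dslope (rootPoly (H.X \ tset w)) ζ v := by
    simp only [dslope_of_ne _ (hv' ζ), slope_def_field, hA]
    rw [← sum_sub_distrib, sum_div]
    refine sum_congr rfl fun w _ => ?_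
    ring
  rw [e2, mul_sum, mul_sum, mul_sum, sum_div, sum_div]
  refine sum_congr rfl fun w _ => ?_
  have e3 := vandermondeProd_div hspan w hv'
  simp only [div_eq_mul_inv, mul_inv] at e3 ⊢
  linear_combination ((rootPoly ((Icc (y - k) y).erase ζ) ζ)⁻¹ * mass H.X w * valueDet f (pt w) *
    (ensembleSum H.X H.setL f)⁻¹ * dslope (rootPoly (H.X \ tset w)) ζ v) * e3

/-- Multiplied by `P Q_𝓛`, `Ω⁻` extends to an entire function of `z`, so only the simple poles at
the nodes contribute. The ratio of factorials is `(r + 1)(n + 1)`: the first factor cancels the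
prefactor of the kernel, the second is the one in `diffCoeff`. -/
theorem inner_integral_tau (hspan : H.yFirst - H.yLast ≤ (H.N : ℤ) - 1) {n r : ℕ} (hn : n + 1 = H.d)
    (hr : H.setL.card = n + 1 + r) {F : MvPolynomial ℕ ℂ} (hF : H.ExpressesCutPoly F) {ε δ : ℝ}
    (h0 : 0 < ε) (h1 : ε < δ) (h2 : δ + ε < 1) {v : ℂ} (hv : H.Avoids ε v) (hv' : ∀ a : ℤ, v ≠ a)
    (y : ℤ) (k : ℕ) {T : Finset ℤ} (hT : T ⊆ Icc (y - k) y) :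
    1 / (rootPoly H.setR v * rootPoly H.setC v) *
      (1 / ((r : ℂ) + 1) * contourInt T δ (fun z => H.P z * rootPoly H.setL z /
        rising (z - y) (k + 1) * (H.omegaMinus F ε (r + 1) v z / H.omegaPlus F ε r 0 0))) =
    (∑ ζ ∈ T, 1 / rootPoly ((Icc (y - k) y).erase ζ) ζ * (((n : ℂ) + 1) * ∑ w : Fin n → H.setL,
      mass H.X w * vandermondeProd (Fin.cons v (pt w) : Fin (n + 1) → ℂ) *
        valueDet (H.cutFun fun i => H.y (Fin.cast hn i)) (Fin.cons (ζ : ℂ) (pt w)))) /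
      ensembleSum H.X H.setL (H.cutFun fun i => H.y (Fin.cast hn i)) / rootPoly H.X v := by
  set f := H.cutFun fun i => H.y (Fin.cast hn i) with hf
  have hrf : (r.factorial : ℂ) ≠ 0 := by exact_mod_cast r.factorial_ne_zero
  have hnf : (n.factorial : ℂ) ≠ 0 := by exact_mod_cast n.factorial_ne_zero
  have hr1 : (r : ℂ) + 1 ≠ 0 := by exact_mod_cast r.succ_ne_zero
  have hn1 : (n : ℂ) + 1 ≠ 0 := by exact_mod_cast n.succ_ne_zero
  have hoc := omegaConst_ne_zero hspan
  set B : ℂ → ℂ := fun z => ((r : ℂ) + 1) * (((n : ℂ) + 1) * ∑ w : Fin n → H.setL,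
    mass H.X w * vandermondeProd (pt w) / rootPoly (H.setL \ tset w) v /
      ensembleSum H.X H.setL f * valueDet f (Fin.cons z (pt w))) with hB
  have hBd : Differentiable ℂ B :=
    ((Differentiable.fun_sum fun w _ =>
      (differentiable_valueDet_cons _ _).const_mul _).const_mul _).const_mul _
  have hBz : ∀ z, B z = ∑ w : Fin n → H.setL, ((r : ℂ) + 1) * (((n : ℂ) + 1) *
      (mass H.X w * vandermondeProd (pt w) / rootPoly (H.setL \ tset w) v /
        ensembleSum H.X H.setL f * valueDet f (Fin.cons z (pt w)))) := fun z => by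
    simp only [hB, mul_sum]
  have e1 : ∀ ζ ∈ T, circleInt ζ δ (fun z => H.P z * rootPoly H.setL z /
      rising (z - y) (k + 1) * (H.omegaMinus F ε (r + 1) v z / H.omegaPlus F ε r 0 0)) =
      B ζ / rootPoly ((Icc (y - k) y).erase ζ) ζ := by
    intro ζ hζ
    rw [circleInt_div_rootPoly (by linarith) (by linarith) (Icc (y - k) y) (G := B)
      hBd.differentiableOn, if_pos (hT hζ)]
    intro z hz
    have hm := omegaMinus_eq hspan hn hr hF h0 (by linarith) hv
      (avoids_of_mem_sphere (H := H) h1 h2 hz)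
    rw [div_mul_div_comm, hm, omegaPlus_zero hspan hn hr hF h0 (by linarith), rising_eq_rootPoly,
      hBz, mul_sum, sum_div, sum_div]
    refine sum_congr rfl fun w _ => ?_
    rw [Nat.factorial_succ, Nat.factorial_succ, ← hf]
    push_cast
    generalize rootPoly (H.setL \ tset w) v = a1
    generalize valueDet f (Fin.cons z (pt w)) = a2
    generalize ensembleSum H.X H.setL f = a3
    generalize rootPoly (Icc (y - k) y) z = a4
    generalize mass H.X w * vandermondeProd (pt w) = a5
    field_simp
  rw [contourInt, sum_congr rfl e1, mul_sum, mul_sum, sum_div, sum_div]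
  refine sum_congr rfl fun ζ _ => ?_
  rw [hBz, sum_div, mul_sum, mul_sum, mul_sum, mul_sum, sum_div, sum_div]
  refine sum_congr rfl fun w _ => ?_
  have e3 := vandermondeProd_div hspan w hv'
  simp only [div_eq_mul_inv, mul_inv] at e3 ⊢
  linear_combination (((n : ℂ) + 1) * (rootPoly ((Icc (y - k) y).erase ζ) ζ)⁻¹ * mass H.X w *
    valueDet f (Fin.cons ζ (pt w)) * (ensembleSum H.X H.setL f)⁻¹) * e3 +
    (((n : ℂ) + 1) * (rootPoly ((Icc (y - k) y).erase ζ) ζ)⁻¹ * mass H.X w *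
      valueDet f (Fin.cons ζ (pt w)) * (ensembleSum H.X H.setL f)⁻¹) * (vandermondeProd (pt w) *
        (rootPoly H.setR v)⁻¹ * (rootPoly H.setC v)⁻¹ * (rootPoly (H.setL \ tset w) v)⁻¹) *
        (mul_inv_cancel₀ hr1)

end CutHexagon

/-! ### The kernel as a column with explicit masses. -/

theorem differentiable_dslope_rootPoly (S : Finset ℤ) (ζ : ℂ) :
    Differentiable ℂ (dslope (rootPoly S) ζ) := by
  rw [← differentiableOn_univ, Complex.differentiableOn_dslope Filter.univ_mem]
  exact (differentiable_rootPoly S).differentiableOn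

theorem differentiable_vandermondeProd_cons {k : ℕ} (u : Fin k → ℂ) :
    Differentiable ℂ fun v => vandermondeProd (Fin.cons v u : Fin (k + 1) → ℂ) := by
  simp only [vandermondeProd_cons]
  exact (Differentiable.fun_finsetProd fun i _ => by fun_prop).mul_const _

/-- Where the Vandermonde product does not vanish, the divided difference at a node removes it. -/
theorem vandermondeProd_cons_mul_dslope {X L : Finset ℤ} {k : ℕ} (w : Fin k → L) {p : ℤ}
    (hp : p ∈ X) (ζ : ℂ) :
    vandermondeProd (Fin.cons (p : ℂ) (pt w) : Fin (k + 1) → ℂ) *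
        dslope (rootPoly (X \ tset w)) ζ p =
      vandermondeProd (Fin.cons (p : ℂ) (pt w) : Fin (k + 1) → ℂ) *
        rootPoly (X \ insert p (tset w)) ζ := by
  by_cases h : p ∈ tset w
  · have h0 : vandermondeProd (Fin.cons (p : ℂ) (pt w) : Fin (k + 1) → ℂ) = 0 := by
      obtain ⟨i, _, hi⟩ := mem_image.1 h
      refine vandermondeProd_eq_zero fun hinj => ?_
      have : (0 : Fin (k + 1)) = i.succ := hinj (by simp [pt, hi])
      exact (Fin.succ_ne_zero i).symm this
    rw [h0, zero_mul, zero_mul]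
  · rw [dslope_rootPoly _ _ (mem_sdiff.2 ⟨hp, h⟩)]
    congr 2
    ext a
    simp only [mem_erase, mem_sdiff, mem_insert]
    tauto

namespace CutHexagon

variable {H : CutHexagon}

/-- The residues of the kernel at the points of `X`. -/
def nodeCoeff (H : CutHexagon) {l : ℕ} (hl : l + 1 = H.d) (n : ℕ) (y a : ℤ) : ℂ :=
  ((H.N - n).factorial : ℂ) /
      ensembleSum H.X H.setL (H.cutFun fun i => H.y (Fin.cast hl i)) *
    (∑ ζ ∈ Icc (y - (H.N - n : ℕ)) y,
        interpCoeff H.X H.setL (H.cutFun fun i => H.y (Fin.cast hl i)) a ζ /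
          rootPoly ((Icc (y - (H.N - n : ℕ)) y).erase ζ) ζ +
      ∑ ζ ∈ H.tauSet n y,
        diffCoeff H.X H.setL (H.cutFun fun i => H.y (Fin.cast hl i)) a ζ /
          rootPoly ((Icc (y - (H.N - n : ℕ)) y).erase ζ) ζ)

/-- For `τ ≥ 0` all nodes exceed `y₁ - N`, so the case distinction changes nothing: the set always
consists of the nodes below the threshold of `𝓛`. -/
theorem mem_tauSet {n : ℕ} (hn : n ≤ H.N) {y ζ : ℤ} :
    ζ ∈ H.tauSet n y ↔ ζ ∈ Icc (y - (H.N - n : ℕ)) y ∧ ζ ≤ H.yFirst - H.N := by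
  unfold tauSet
  split_ifs with h <;> simp only [mem_Icc, le_min_iff, notMem_empty, false_iff] <;> omega

theorem kernel_eq_column (hspan : H.yFirst - H.yLast ≤ (H.N : ℤ) - 1) {l r : ℕ} (hl : l + 1 = H.d)
    (hr : H.setL.card = l + 1 + r) {F : MvPolynomial ℕ ℂ} (hF : H.ExpressesCutPoly F) {ε δ R : ℝ}
    (h0 : 0 < ε) (h1 : ε < δ) (h2 : δ + ε < 1) (hR : (H.d : ℝ) + H.N + H.M + 1 ≤ R)
    {m n : ℕ} {x y : ℤ} (hp : H.InQuad m x) (hq : H.InQuad n y) (hm : m < H.N) :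
    H.kernel r F ε δ R (m, x) (n, y) = H.column 1 n y (H.nodeCoeff hl n y) m x := by
  have hd1 : δ < 1 := by linarith
  have hd0 : 0 < δ := by linarith
  set f := H.cutFun fun i => H.y (Fin.cast hl i) with hf
  set Z := Icc (y - (H.N - n : ℕ)) y with hZ
  -- All relevant integers have absolute value at most `d + N + M` and `δ < 1`, whence the bound on
  -- `R`.
  have hball : ∀ p : ℤ, -(H.d : ℤ) - H.N ≤ p → p ≤ (H.M : ℤ) - 1 → ∀ v : ℂ,
      dist v p ≤ δ → v ∈ Metric.ball (0 : ℂ) R := by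
    intro p hp1 hp2 v hv
    rw [Metric.mem_ball]
    have h3 := dist_triangle v p 0
    rw [dist_zero_right (p : ℂ), Complex.norm_intCast] at h3
    have h4 : |p| ≤ (H.d : ℤ) + H.N + H.M := abs_le.2 ⟨by omega, by omega⟩
    have h5 : |(p : ℝ)| ≤ (H.d : ℝ) + H.N + H.M := by exact_mod_cast h4
    linarith
  obtain ⟨hn, hq1, hq2⟩ := hq
  obtain ⟨_, hp1, hp2⟩ := hp
  have hZR : ∀ ζ ∈ Z, ((ζ : ℤ) : ℂ) ∈ Metric.ball (0 : ℂ) R := by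
    intro ζ hζ
    rw [hZ, mem_Icc] at hζ
    exact hball ζ (by omega) (by omega) _ (by rw [dist_self]; exact hd0.le)
  have hT : H.tauSet n y ⊆ Z := fun ζ hζ => ((mem_tauSet hn).1 hζ).1
  -- The entire numerator of the `v`-integrand over `Q_X`; the Vandermonde factor with `v` absorbs
  -- the points of `w`, so all poles are simple and lie in `X`.
  set G : ℂ → ℂ := fun v => rising (v - x + 1) (H.N - m - 1) *
    ((∑ ζ ∈ Z, 1 / rootPoly (Z.erase ζ) ζ * ∑ w : Fin (l + 1) → H.setL,
      mass H.X w * vandermondeProd (Fin.cons v (pt w) : Fin (l + 1 + 1) → ℂ) *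
        valueDet f (pt w) * dslope (rootPoly (H.X \ tset w)) ζ v) / ensembleSum H.X H.setL f +
    (∑ ζ ∈ H.tauSet n y, 1 / rootPoly (Z.erase ζ) ζ * (((l : ℂ) + 1) * ∑ w : Fin l → H.setL,
      mass H.X w * vandermondeProd (Fin.cons v (pt w) : Fin (l + 1) → ℂ) *
        valueDet f (Fin.cons (ζ : ℂ) (pt w)))) / ensembleSum H.X H.setL f) with hG
  have hGd : Differentiable ℂ G := by
    refine Differentiable.mul ?_ (Differentiable.add ?_ ?_)
    · unfold rising
      exact (Polynomial.differentiable _).comp (by fun_prop : Differentiable ℂ fun v : ℂ => v - x + 1)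
    · refine Differentiable.div_const (Differentiable.fun_sum fun ζ _ =>
        Differentiable.const_mul (Differentiable.fun_sum fun w _ => ?_) _) _
      exact (((differentiable_vandermondeProd_cons _).const_mul _).mul_const _).mul
        (differentiable_dslope_rootPoly _ _)
    · refine Differentiable.div_const (Differentiable.fun_sum fun ζ _ =>
        Differentiable.const_mul (Differentiable.const_mul (Differentiable.fun_sum fun w _ => ?_) _)
          _) _
      exact ((differentiable_vandermondeProd_cons _).const_mul _).mul_const _
  have hGX : ∀ p ∈ H.X, ((H.N - n).factorial : ℂ) * (G p / rootPoly (H.X.erase p) p) =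
      rising ((p : ℂ) - x + 1) (H.N - m - 1) * H.nodeCoeff hl n y p := by
    intro p hp
    have e1 : ∑ ζ ∈ Z, 1 / rootPoly (Z.erase ζ) ζ * ∑ w : Fin (l + 1) → H.setL,
        mass H.X w * vandermondeProd (Fin.cons (p : ℂ) (pt w) : Fin (l + 1 + 1) → ℂ) *
        valueDet f (pt w) * dslope (rootPoly (H.X \ tset w)) ζ p =
        rootPoly (H.X.erase p) p * ∑ ζ ∈ Z, interpCoeff H.X H.setL f p ζ / rootPoly (Z.erase ζ) ζ := by
      rw [mul_sum]
      refine sum_congr rfl fun ζ _ => ?_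
      have e2 := rootPoly_erase_ne_zero H.X p
      rw [interpCoeff, ← mul_div_assoc, ← mul_assoc, mul_one_div_cancel e2, one_mul, one_div_mul_eq_div]
      congr 1
      refine sum_congr rfl fun w _ => ?_
      linear_combination mass H.X w * valueDet f (pt w) * vandermondeProd_cons_mul_dslope w hp ζ
    have e2 : ∑ ζ ∈ H.tauSet n y, 1 / rootPoly (Z.erase ζ) ζ * (((l : ℂ) + 1) *
        ∑ w : Fin l → H.setL,
          mass H.X w * vandermondeProd (Fin.cons (p : ℂ) (pt w) : Fin (l + 1) → ℂ) *
          valueDet f (Fin.cons (ζ : ℂ) (pt w))) =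
        rootPoly (H.X.erase p) p *
          ∑ ζ ∈ H.tauSet n y, diffCoeff H.X H.setL f p ζ / rootPoly (Z.erase ζ) ζ := by
      rw [mul_sum]
      refine sum_congr rfl fun ζ _ => ?_
      have e2 := rootPoly_erase_ne_zero H.X p
      rw [diffCoeff, ← mul_div_assoc, ← mul_assoc (rootPoly (H.X.erase p) p),
        mul_one_div_cancel e2, one_mul, one_div_mul_eq_div]
    have e3 := rootPoly_erase_ne_zero H.X p
    simp only [hG, nodeCoeff]
    rw [e1, e2, ← hf, ← hZ]
    field_simp
  have hcirc : ∀ p ∈ Icc x ((H.M : ℤ) - 1), circleInt p δ (fun v =>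
      rising (v - x + 1) (H.N - m - 1) / (rootPoly H.setR v * rootPoly H.setC v) *
          (circleInt 0 R (fun z =>
              rootPoly H.setR z * rootPoly H.setC z /
                ((z - v) * rising (z - y) (H.N - n + 1)) *
                (H.omegaPlus F ε r v z / H.omegaPlus F ε r 0 0)) +
            1 / ((r : ℂ) + 1) * contourInt (H.tauSet n y) δ (fun z =>
              H.P z * rootPoly H.setL z / rising (z - y) (H.N - n + 1) *
                (H.omegaMinus F ε (r + 1) v z / H.omegaPlus F ε r 0 0)))) =
      if p ∈ H.X then G p / rootPoly (H.X.erase p) p else 0 := by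
    intro p hp
    rw [mem_Icc] at hp
    refine circleInt_div_rootPoly hd0 hd1 H.X hGd.differentiableOn fun v hv => ?_
    have hv1 := ne_intCast_of_mem_sphere hd0 hd1 (p := p) (u := v)
    have hv2 := avoids_of_mem_sphere (H := H) h1 h2 hv
    have i1 := inner_integral_infty hspan hl hr hF h0 (by linarith) hv2 (fun a => hv1 a hv)
      (hball p (by omega) (by omega) v (le_of_eq hv)) y (H.N - n) hZR
    have i2 := inner_integral_tau hspan hl hr hF h0 h1 h2 hv2 (fun a => hv1 a hv) y (H.N - n) hT
    rw [div_eq_mul_one_div (rising _ _), mul_assoc, mul_add (1 / _), i1, i2]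
    simp only [hG]
    ring
  unfold kernel column
  simp only
  rw [if_pos hm, if_pos hm, contourInt, sum_congr rfl hcirc]
  congr 1
  · rw [one_mul]
    split_ifs with h3 h4 h4
    · rw [truncBinom, if_pos (by omega), binom]
      push_cast
      rfl
    · exact absurd h3.1 h4
    · rw [truncBinom_of_neg (by omega), neg_zero]
    · rw [neg_zero]
  · rw [← sum_filter, mul_sum]
    have e4 : ∀ a ∈ H.X, truncBinom (H.N - m - 1) (a - x) * H.nodeCoeff hl n y a =
        if x ≤ a then ((H.N - n).factorial : ℂ) / ((H.N - m - 1).factorial : ℂ) *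
          (G a / rootPoly (H.X.erase a) a) else 0 := by
      intro a ha
      rw [truncBinom]
      have := hGX a ha
      split_ifs with h3 h4 h4
      · rw [binom, div_mul_eq_mul_div, div_mul_eq_mul_div, this]
        push_cast
        rfl
      · omega
      · omega
      · rw [zero_mul]
    rw [sum_congr rfl e4, ← sum_filter]
    refine sum_congr ?_ fun _ _ => rfl
    ext a
    rw [mem_filter, mem_filter, mem_Icc]
    have := @H.X_subset a
    rw [mem_Icc] at this
    constructor
    · rintro ⟨h3, h4⟩
      exact ⟨h4, h3.1⟩
    · rintro ⟨h3, h4⟩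
      exact ⟨⟨h4, (this h3).2⟩, h3⟩

theorem kernel_top (r : ℕ) (F : MvPolynomial ℕ ℂ) (ε δ R : ℝ) (x : ℤ) (q : ℕ × ℤ)
    (hq : q.1 ≤ H.N) : H.kernel r F ε δ R (H.N, x) q = 0 := by
  unfold kernel
  simp only [lt_irrefl, if_false, zero_mul, add_zero]
  rw [if_neg (by omega)]

/-! ### Boundary conditions, nonvanishing and the determinantal formula. -/

/-- The interpolation part reproduces `binom J` at every node `ζ` of the difference, and the divided
difference part kills it; both use `J < N`. -/
theorem sum_binom_mul_nodeCoeff {l : ℕ} (hl : l + 1 = H.d)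
    (hS : ensembleSum H.X H.setL (H.cutFun fun i => H.y (Fin.cast hl i)) ≠ 0)
    (n : ℕ) (y x : ℤ) {J : ℕ} (hJ : J < H.N) :
    ∑ a ∈ H.X, binom J ((a : ℂ) - x) * H.nodeCoeff hl n y a =
      backDiff (H.N - n) y (fun t => binom J ((t : ℂ) - x)) := by
  obtain ⟨g, hg, hgJ⟩ := exists_polynomial_binom J x
  have hcard : H.X.card = l + 1 + H.N := by rw [H.X_card, hl]; rfl
  simp only [nodeCoeff, ← hgJ]
  set f := H.cutFun fun i => H.y (Fin.cast hl i) with hf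
  have e1 := fun ζ => sum_eval_mul_interpCoeff (setL_subset (H := H)) f g (by omega) ζ
  have e2 := fun ζ => sum_eval_mul_diffCoeff (L := H.setL) f g (X := H.X) (by omega) ζ
  simp only [mul_left_comm (Polynomial.eval _ g), ← mul_sum, mul_add, sum_add_distrib]
  rw [← mul_add]
  simp only [mul_sum]
  rw [sum_comm, sum_comm (t := H.tauSet n y)]
  simp only [← mul_div_assoc, ← sum_div, e1, e2, zero_div, sum_const_zero, add_zero, backDiff]
  rw [mul_sum, mul_sum]
  refine sum_congr rfl fun ζ _ => ?_
  unfold rootPoly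
  field_simp

/-- The roles are reversed: antisymmetry kills the interpolation part, and Cramer's rule evaluates
the other at the nodes below the threshold. -/
theorem sum_setL_cutFun_mul_nodeCoeff {l : ℕ} (hl : l + 1 = H.d)
    (hS : ensembleSum H.X H.setL (H.cutFun fun i => H.y (Fin.cast hl i)) ≠ 0)
    (n : ℕ) (y : ℤ) (j : Fin (l + 1)) :
    ∑ a ∈ H.setL, H.cutFun (fun i => H.y (Fin.cast hl i)) j a * H.nodeCoeff hl n y a =
      ((H.N - n).factorial : ℂ) * ∑ ζ ∈ H.tauSet n y,
        H.cutFun (fun i => H.y (Fin.cast hl i)) j ζ /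
          rootPoly ((Icc (y - (H.N - n : ℕ)) y).erase ζ) ζ := by
  simp only [nodeCoeff]
  set f := H.cutFun fun i => H.y (Fin.cast hl i) with hf
  have e1 := fun ζ => sum_mul_interpCoeff_eq_zero (L := H.setL) H.X f j ζ
  have e2 := fun ζ => sum_mul_diffCoeff (L := H.setL) H.X f j ζ
  simp only [mul_left_comm (f j _), ← mul_sum, mul_add, sum_add_distrib]
  rw [← mul_add]
  simp only [mul_sum]
  rw [sum_comm, sum_comm (t := H.tauSet n y)]
  simp only [← mul_div_assoc, ← sum_div, e1, e2, zero_div, sum_const_zero, zero_add]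
  rw [mul_sum]
  refine sum_congr rfl fun ζ _ => ?_
  field_simp

theorem exists_y_eq {l : ℕ} (hl : l + 1 = H.d) {y' : ℤ} (hy : y' ∈ H.Y) :
    ∃ j : Fin (l + 1), H.y (Fin.cast hl j) = y' := by
  have h : y' ∈ Set.range (H.Y.orderEmbOfFin rfl) := by
    rw [range_orderEmbOfFin]
    exact hy
  obtain ⟨i, rfl⟩ := h
  refine ⟨Fin.cast hl.symm (Fin.rev i), ?_⟩
  simp only [CutHexagon.y, Fin.cast_cast, Fin.cast_eq_self]
  exact congrArg _ (Fin.rev_rev i)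

/-- The span condition gives `y₁ - N + 1 ≤ y_d ≤ y'`, so below the threshold all the functions are
truncated to `0`, while above it `a - y' ≥ -(N - 1)` and they are polynomials. One threshold thus
serves every `y'`. -/
theorem truncBinom_sub_eq (hspan : H.yFirst - H.yLast ≤ (H.N : ℤ) - 1) {y' : ℤ} (hy : y' ∈ H.Y)
    (a : ℤ) : truncBinom (H.N - 1) (a - y') =
      if a < H.yFirst - H.N + 1 then 0 else binom (H.N - 1) ((a : ℂ) - y') := by
  have h1 : y' ≤ H.yFirst := H.Y.le_max' _ hy
  have h2 : H.yLast ≤ y' := H.Y.min'_le _ hy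
  have h3 := yLast_le_yFirst (H := H)
  split_ifs with h
  · exact truncBinom_of_neg (by omega)
  · rw [truncBinom_eq_binom (by omega)]
    push_cast
    rfl

/-- A sum against the lower boundary functions in terms of the polynomials `binom`. -/
theorem sum_truncBinom_mul (hspan : H.yFirst - H.yLast ≤ (H.N : ℤ) - 1) {y' : ℤ} (hy : y' ∈ H.Y)
    (c : ℤ → ℂ) : ∑ a ∈ H.X, truncBinom (H.N - 1) (a - y') * c a =
      ∑ a ∈ H.X, binom (H.N - 1) ((a : ℂ) - y') * c a -
        ∑ a ∈ H.setL, binom (H.N - 1) ((a : ℂ) - y') * c a := by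
  rw [setL, sum_filter, ← sum_sub_distrib]
  refine sum_congr rfl fun a _ => ?_
  rw [truncBinom_sub_eq hspan hy]
  split_ifs <;> ring

theorem sum_truncBinom_mul_nodeCoeff (hspan : H.yFirst - H.yLast ≤ (H.N : ℤ) - 1) {l : ℕ}
    (hl : l + 1 = H.d)
    (hS : ensembleSum H.X H.setL (H.cutFun fun i => H.y (Fin.cast hl i)) ≠ 0)
    {n : ℕ} (hn : n ≤ H.N) (y : ℤ) {y' : ℤ} (hy : y' ∈ H.Y) :
    ∑ a ∈ H.X, truncBinom (H.N - 1) (a - y') * H.nodeCoeff hl n y a =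
      backDiff (H.N - n) y (fun t => truncBinom (H.N - 1) (t - y')) := by
  have h3 := yLast_le_yFirst (H := H)
  rw [sum_truncBinom_mul hspan hy, sum_binom_mul_nodeCoeff hl hS n y y' (by omega)]
  obtain ⟨j, rfl⟩ := exists_y_eq hl hy
  have h := sum_setL_cutFun_mul_nodeCoeff hl hS n y j
  simp only [cutFun] at h
  rw [h, backDiff, backDiff, ← mul_sub]
  congr 1
  have hT : H.tauSet n y = (Icc (y - (H.N - n : ℕ)) y).filter fun ζ => ζ < H.yFirst - H.N + 1 := by
    ext ζ
    rw [mem_tauSet hn, mem_filter]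
    refine and_congr_right fun _ => by omega
  rw [hT, sum_filter, ← sum_sub_distrib]
  refine sum_congr rfl fun ζ _ => ?_
  rw [truncBinom_sub_eq hspan hy]
  unfold rootPoly
  split_ifs <;> ring

theorem N_pos (hspan : H.yFirst - H.yLast ≤ (H.N : ℤ) - 1) : 0 < H.N :=
  (d_pos (H := H)).trans_le (d_le_N hspan)

/-- By Andréief's identity, vanishing would give a left null vector, hence a polynomial of degree
less than `d` whose masses on `X` solve the homogeneous boundary equations. Invertibility of the
Kasteleyn matrix makes these masses zero, and a polynomial of degree less than `d` with the `d + N`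
roots `X` is zero. -/
theorem ensembleSum_ne_zero (hspan : H.yFirst - H.yLast ≤ (H.N : ℤ) - 1)
    (hT : H.tilings.Nonempty) {l : ℕ} (hl : l + 1 = H.d) :
    ensembleSum H.X H.setL (H.cutFun fun i => H.y (Fin.cast hl i)) ≠ 0 := by
  intro hS
  have hN := N_pos hspan
  have hcard : H.X.card = l + 1 + H.N := by rw [H.X_card, hl]; rfl
  rw [ensembleSum_eq_det, mul_eq_zero, or_iff_right (by exact_mod_cast Nat.factorial_ne_zero _)]
    at hS
  obtain ⟨v, hv0, hv⟩ := Matrix.exists_vecMul_eq_zero_iff.2 hS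
  -- The signs appear because the Andréief matrix is written in powers of `-x`.
  set α : Polynomial ℂ := ∑ a : Fin (l + 1), Polynomial.monomial (a : ℕ) (v a * (-1) ^ (a : ℕ))
    with hα
  have hdeg : α.natDegree ≤ l := Polynomial.natDegree_sum_le_of_forall_le _ _ fun a _ =>
    (Polynomial.natDegree_monomial_le _).trans (by omega)
  have heval : ∀ z : ℂ, α.eval z = ∑ a : Fin (l + 1), v a * (-z) ^ (a : ℕ) := by
    intro z
    simp only [hα, Polynomial.eval_finsetSum, Polynomial.eval_monomial]
    refine sum_congr rfl fun a _ => ?_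
    rw [mul_assoc, ← mul_pow, neg_one_mul]
  set c : ℤ → ℂ := fun x => α.eval (x : ℂ) / rootPoly (H.X.erase x) x with hc
  have hA : ∀ (x : ℤ) (J : ℕ), J < H.N → ∑ a ∈ H.X, binom J ((a : ℂ) - x) * c a = 0 := by
    intro x J hJ
    obtain ⟨g, hg, hgJ⟩ := exists_polynomial_binom J x
    rw [← sum_eval_div_eq_zero H.X (g * α) (by
      have := Polynomial.natDegree_mul_le (p := g) (q := α)
      omega)]
    refine sum_congr rfl fun a _ => ?_
    rw [Polynomial.eval_mul, hgJ, hc, mul_div_assoc]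
  have hB : ∀ y' ∈ H.Y, ∑ a ∈ H.X, truncBinom (H.N - 1) (a - y') * c a = 0 := by
    intro y' hy
    rw [sum_truncBinom_mul hspan hy, hA y' _ (by omega), zero_sub, neg_eq_zero]
    obtain ⟨j, rfl⟩ := exists_y_eq hl hy
    have h := congrFun hv j
    simp only [Matrix.vecMul, dotProduct, Matrix.of_apply, mul_sum, cutFun] at h
    rw [sum_comm, sum_coe_sort H.setL fun x : ℤ => ∑ a : Fin (l + 1), v a *
      (1 / rootPoly (H.X.erase x) (x : ℂ) * binom (H.N - 1) (x - H.y (Fin.cast hl j)) *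
        (-(x : ℂ)) ^ (a : ℕ))] at h
    rw [Pi.zero_apply] at h
    rw [← h]
    refine sum_congr rfl fun x _ => ?_
    simp only [hc, heval]
    rw [mul_div_assoc', mul_sum, sum_div]
    refine sum_congr rfl fun a _ => ?_
    ring
  have hq : H.InQuad 0 H.yFirst := by
    have h1 := H.Y_subset (H.Y.max'_mem H.Y_nonempty)
    have h2 : H.d = H.Y.card := rfl
    rw [mem_Icc] at h1
    refine ⟨Nat.zero_le _, ?_, h1.2⟩
    rw [h2]
    push_cast
    rw [zero_add]
    exact h1.1
  -- With source strength `0` the position of the source is irrelevant; any point below the upper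
  -- edge would do.
  have hcol := kasteleyn_mulVec_column hN 0 hq hN c
    (fun x J hJ => by rw [zero_mul]; exact hA x J hJ)
    (fun y' hy => by rw [zero_mul]; exact hB y' hy)
  have hcol0 := Matrix.eq_zero_of_mulVec_eq_zero (det_kasteleyn_ne_zero hN (d_le_N hspan) hT)
    (hcol.trans (by simp only [ite_self]; rfl))
  have hroot : ∀ x ∈ H.X, α.eval (x : ℂ) = 0 := by
    intro x hx
    have h1 := H.X_subset hx
    have h2 : H.d = H.Y.card := rfl
    rw [mem_Icc] at h1
    have h3 := congrFun hcol0 ⟨(H.N, x), mem_quad.2 ⟨le_rfl, by simp only; omega, h1.2⟩⟩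
    simp only [column, lt_irrefl, if_false, hx, if_true, Pi.zero_apply, hc] at h3
    exact (div_eq_zero_iff.1 h3).resolve_right (rootPoly_erase_ne_zero _ _)
  have hα0 : α = 0 := by
    refine Polynomial.eq_zero_of_natDegree_lt_card_of_eval_eq_zero' α
      (H.X.image fun x : ℤ => (x : ℂ)) (fun z hz => ?_) ?_
    · obtain ⟨x, hx, rfl⟩ := mem_image.1 hz
      exact hroot x hx
    · rw [card_image_of_injective _ Int.cast_injective]
      omega
  refine hv0 (funext fun a => ?_)
  have h1 : α.coeff a = v a * (-1) ^ (a : ℕ) := by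
    rw [hα, Polynomial.finsetSum_coeff, sum_eq_single a]
    · simp
    · intro b _ hb
      rw [Polynomial.coeff_monomial, if_neg]
      exact fun h => hb (Fin.ext h)
    · simp
  rw [hα0, Polynomial.coeff_zero] at h1
  exact (mul_eq_zero.1 h1.symm).resolve_right (pow_ne_zero _ (by norm_num))

theorem omegaPlus_ne_zero (hspan : H.yFirst - H.yLast ≤ (H.N : ℤ) - 1) {r : ℕ}
    (hr : H.setL.card = H.d + r) (hT : H.tilings.Nonempty) {F : MvPolynomial ℕ ℂ}
    (hF : H.ExpressesCutPoly F) {ε : ℝ} (h0 : 0 < ε) (h1 : ε < 1) : H.omegaPlus F ε r 0 0 ≠ 0 := by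
  obtain ⟨l, hl⟩ : ∃ l, l + 1 = H.d := ⟨H.d - 1, Nat.sub_add_cancel d_pos⟩
  rw [omegaPlus_zero hspan hl (by omega) hF h0 h1]
  exact mul_ne_zero (mul_ne_zero (div_ne_zero (by exact_mod_cast Nat.factorial_ne_zero _)
    (by exact_mod_cast Nat.factorial_ne_zero _)) (omegaConst_ne_zero hspan))
    (ensembleSum_ne_zero hspan hT hl)

theorem step_self_iff (hN : 0 < H.N) {p : ℕ × ℤ} (hp : H.IsSite p) :
    H.Step p p ↔ p.1 < H.N ∧ (p.1 = 0 → p.2 ∈ H.Y) := by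
  constructor
  · rintro (⟨-, h1, h2⟩ | h | ⟨j, h1, h2⟩)
    · exact ⟨lt_of_le_of_ne hp.1.1 fun h => hp.2 h (h2 h), h1⟩
    · omega
    · rw [h1] at h2
      have := congrArg Prod.fst h2
      simp only at this
      omega
  · rintro ⟨h1, h2⟩
    exact Or.inl ⟨rfl, h2, fun h => absurd h h1.ne⟩

/-- The correlation functions of the red dots are the minors of the kernel. -/
theorem correlation_eq_det_kernel (hspan : H.yFirst - H.yLast ≤ (H.N : ℤ) - 1) {r : ℕ}
    (hr : H.setL.card = H.d + r) (hT : H.tilings.Nonempty) {F : MvPolynomial ℕ ℂ}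
    (hF : H.ExpressesCutPoly F) {ε δ R : ℝ} (h0 : 0 < ε) (h1 : ε < δ) (h2 : δ + ε < 1)
    (hR : (H.d : ℝ) + H.N + H.M + 1 ≤ R) {k : ℕ} (p : Fin k → ℕ × ℤ)
    (hp : Function.Injective p) (hsite : ∀ i, H.IsSite (p i)) :
    (H.correlation p : ℂ) =
      (Matrix.of fun i j : Fin k => H.kernel r F ε δ R (p i) (p j)).det := by
  obtain ⟨l, hl⟩ : ∃ l, l + 1 = H.d := ⟨H.d - 1, Nat.sub_add_cancel d_pos⟩
  have hN := N_pos hspan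
  have hd := d_le_N hspan
  have hS := ensembleSum_ne_zero hspan hT hl
  have hdet := det_kasteleyn_ne_zero hN hd hT
  set s : Fin k → H.Site := fun i => ⟨p i, mem_quad.2 (hsite i).1⟩ with hs
  -- On the upper edge the kernel is `0` while the column carries the masses at `X`; the two agree
  -- there because the fixed upper points are not sites.
  have hker : ∀ i j, H.kernel r F ε δ R (p i) (p j) =
      H.column 1 (p j).1 (p j).2 (H.nodeCoeff hl (p j).1 (p j).2) (p i).1 (p i).2 := by
    intro i j
    rcases (hsite i).1.1.lt_or_eq with h | h
    · exact kernel_eq_column hspan hl (by omega) hF h0 h1 h2 hR (hsite i).1 (hsite j).1 h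
    · have h3 := kernel_top r F ε δ R (p i).2 (p j) (hsite j).1.1
      have h4 : (H.N, (p i).2) = p i := Prod.ext h.symm rfl
      rw [h4] at h3
      rw [h3, column, if_neg (by omega), if_neg ((hsite i).2 h)]
  have hcol : ∀ j, (p j).1 < H.N → H.kasteleyn.mulVec (fun a => H.column 1 (p j).1 (p j).2
      (H.nodeCoeff hl (p j).1 (p j).2) a.1.1 a.1.2) =
        fun a => if a.1 = p j ∧ ((p j).1 = 0 → (p j).2 ∈ H.Y) then 1 else 0 := fun j hj =>
    kasteleyn_mulVec_column hN 1 (hsite j).1 hj _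
      (fun x J hJ => by rw [one_mul]; exact sum_binom_mul_nodeCoeff hl hS _ _ _ hJ)
      (fun y' hy => by
        rw [one_mul]
        exact sum_truncBinom_mul_nodeCoeff hspan hl hS hj.le _ hy)
  by_cases hstep : ∀ i, H.Step (p i) (p i)
  · have h3 : (H.correlation p : ℂ) = _ := correlation_eq_det_inv hN hd hT s
      (fun i j hij => hp (congrArg Subtype.val hij)) hstep
    rw [h3]
    congr 1
    ext i j
    obtain ⟨h4, h5⟩ := (step_self_iff hN (hsite j)).1 (hstep j)
    rw [Matrix.of_apply, Matrix.submatrix_apply, hker]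
    have h6 : (fun a : H.Site => if a.1 = p j ∧ ((p j).1 = 0 → (p j).2 ∈ H.Y) then (1 : ℂ) else 0) =
        Pi.single (s j) 1 := by
      funext a
      rw [Pi.single_apply]
      refine if_congr ?_ rfl rfl
      rw [Subtype.ext_iff]
      exact ⟨fun h => h.1, fun h => ⟨h, h5⟩⟩
    have h7 := congrArg (H.kasteleyn⁻¹.mulVec ·) ((hcol j h4).trans h6)
    simp only [Matrix.mulVec_mulVec, Matrix.nonsing_inv_mul _ (isUnit_iff_ne_zero.2 hdet),
      Matrix.one_mulVec, Matrix.mulVec_single_one] at h7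
    exact (congrFun h7 (s i)).symm
  · push Not at hstep
    obtain ⟨i, hi⟩ := hstep
    have h3 : H.correlation p = 0 := correlation_eq_zero hN hd s i hi
    rw [h3, Complex.ofReal_zero]
    symm
    rcases (hsite i).1.1.lt_or_eq with h | h
    · refine Matrix.det_eq_zero_of_column_eq_zero i fun a => ?_
      have h4 : ¬ ((p i).1 = 0 → (p i).2 ∈ H.Y) := fun h5 =>
        hi ((step_self_iff hN (hsite i)).2 ⟨h, h5⟩)
      -- A free point of the lower edge yields no source, so its column solves the homogeneous
      -- system.
      have h5 := Matrix.eq_zero_of_mulVec_eq_zero hdet ((hcol i h).trans (by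
        simp only [h4, and_false, if_false]; rfl))
      rw [Matrix.of_apply, hker]
      exact congrFun h5 (s a)
    · refine Matrix.det_eq_zero_of_row_eq_zero i fun a => ?_
      rw [Matrix.of_apply, hker, column, if_neg (by omega), if_neg ((hsite i).2 h)]

end CutHexagon

/-! ### Existence of the polynomial in the power sums. -/

/-- The functions of `n` variables that are polynomials in the power sums. -/
def powerSumAlgebra (n : ℕ) : Subalgebra ℂ ((Fin n → ℂ) → ℂ) :=
  (MvPolynomial.aeval fun (a : ℕ) (w : Fin n → ℂ) => ∑ i, w i ^ a).range

theorem aeval_powerSum_apply {n : ℕ} (F : MvPolynomial ℕ ℂ) (w : Fin n → ℂ) :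
    MvPolynomial.aeval (fun (a : ℕ) (w : Fin n → ℂ) => ∑ i, w i ^ a) F w =
      MvPolynomial.eval (fun a : ℕ => ∑ i, w i ^ a) F := by
  have h := MvPolynomial.map_aeval (fun (a : ℕ) (w : Fin n → ℂ) => ∑ i, w i ^ a)
    (Pi.evalRingHom (fun _ : Fin n → ℂ => ℂ) w) F
  exact h

theorem powerSum_mem (n a : ℕ) : (fun w : Fin n → ℂ => ∑ i, w i ^ a) ∈ powerSumAlgebra n :=
  ⟨MvPolynomial.X a, by simp⟩

/-- Newton's identities; in characteristic zero they can be solved for the elementary symmetric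
functions. -/
theorem esymm_mem_powerSumAlgebra (n k : ℕ) :
    (fun w : Fin n → ℂ => (univ.val.map w).esymm k) ∈ powerSumAlgebra n := by
  induction k using Nat.strong_induction_on with
  | _ k ih =>
    rcases Nat.eq_zero_or_pos k with rfl | hk
    · convert one_mem (powerSumAlgebra n) using 1
      funext w
      simp [Multiset.esymm]
    · have hk0 : (k : ℂ) ≠ 0 := by exact_mod_cast hk.ne'
      have h : (fun w : Fin n → ℂ => (univ.val.map w).esymm k) = (k : ℂ)⁻¹ • ((-1 : ℂ) ^ (k + 1) •
          ∑ a ∈ antidiagonal k with a.1 < k, (-1 : ℂ) ^ a.1 •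
            ((fun w : Fin n → ℂ => (univ.val.map w).esymm a.1) *
              fun w : Fin n → ℂ => ∑ i, w i ^ a.2)) := by
        funext w
        have h1 := congrArg (MvPolynomial.aeval w) (MvPolynomial.mul_esymm_eq_sum (Fin n) ℂ k)
        simp only [map_mul, map_natCast, map_pow, map_neg, map_one, map_sum,
          MvPolynomial.aeval_esymm_eq_multiset_esymm, MvPolynomial.psum, MvPolynomial.aeval_X] at h1
        simp only [Pi.smul_apply, Finset.sum_apply, Pi.mul_apply, smul_eq_mul]
        rw [eq_inv_mul_iff_mul_eq₀ hk0, h1]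
        simp only [mul_assoc]
      rw [h]
      refine Subalgebra.smul_mem _ (Subalgebra.smul_mem _ (Subalgebra.sum_mem _ fun a ha =>
        Subalgebra.smul_mem _ (Subalgebra.mul_mem _ (ih _ (mem_filter.1 ha).2)
          (powerSum_mem n _)) _) _) _

/-- The functions `φ w (w α)` whose values are interpolated by polynomials in `w α` of degree less
than `n` with coefficients that are polynomials in the power sums of `w`. -/
def IsReduced (n : ℕ) (φ : (Fin n → ℂ) → Fin n → ℂ) : Prop :=
  ∃ c : Fin n → powerSumAlgebra n, ∀ w α, φ w α = ∑ i, (c i).1 w * w α ^ (i : ℕ)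

theorem IsReduced.sum {n : ℕ} {ι : Type*} (s : Finset ι) (e : ι → powerSumAlgebra n)
    (φ : ι → (Fin n → ℂ) → Fin n → ℂ) (h : ∀ j ∈ s, IsReduced n (φ j)) :
    IsReduced n fun w α => ∑ j ∈ s, (e j).1 w * φ j w α := by
  choose! c hc using h
  refine ⟨fun i => ∑ j ∈ s, e j * c j i, fun w α => ?_⟩
  simp only [AddSubmonoidClass.coe_finsetSum, Subalgebra.coe_mul, Finset.sum_apply, Pi.mul_apply,
    sum_mul]
  rw [sum_comm]
  refine sum_congr rfl fun j hj => ?_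
  rw [hc j hj, mul_sum]
  exact sum_congr rfl fun i _ => by ring

/-- Each `w α` is a root of `∏ (X - w i)`, whose coefficients are the signed elementary symmetric
functions. This lets powers from the `n`-th on be reduced. -/
theorem pow_eq_sum_esymm {n k : ℕ} (hk : n ≤ k) (w : Fin n → ℂ) (α : Fin n) :
    w α ^ k = ∑ j ∈ range n, (-1) ^ j * (univ.val.map w).esymm (j + 1) * w α ^ (k - 1 - j) := by
  have h := congrArg (Polynomial.eval (w α))
    (Multiset.prod_X_sub_X_eq_sum_esymm (univ.val.map w))
  have h0 : Polynomial.eval (w α)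
      ((Multiset.map (fun t => Polynomial.X - Polynomial.C t) (univ.val.map w)).prod) = 0 := by
    rw [Polynomial.eval_multiset_prod, Multiset.prod_eq_zero]
    rw [Multiset.map_map, Multiset.map_map, Multiset.mem_map]
    exact ⟨α, by simp, by simp⟩
  rw [h0] at h
  simp only [Multiset.card_map, card_val, card_univ, Fintype.card_fin, Polynomial.eval_finsetSum,
    Polynomial.eval_mul, Polynomial.eval_pow, Polynomial.eval_neg, Polynomial.eval_one,
    Polynomial.eval_C, Polynomial.eval_X] at h
  rw [sum_range_succ'] at h
  have h2 : (univ.val.map w).esymm 0 = 1 := by simp [Multiset.esymm]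
  rw [h2] at h
  have h3 : w α ^ k = w α ^ n * w α ^ (k - n) := by rw [← pow_add]; congr 1; omega
  have h4 : ∑ j ∈ range n, (-1) ^ j * (univ.val.map w).esymm (j + 1) * w α ^ (k - 1 - j) =
      -(∑ j ∈ range n, (-1) ^ (j + 1) * ((univ.val.map w).esymm (j + 1) * w α ^ (n - (j + 1)))) *
        w α ^ (k - n) := by
    rw [neg_mul, sum_mul, ← sum_neg_distrib]
    refine sum_congr rfl fun j hj => ?_
    rw [mem_range] at hj
    rw [show k - 1 - j = n - (j + 1) + (k - n) by omega, pow_add]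
    ring
  rw [h3, h4]
  congr 1
  rw [eq_neg_iff_add_eq_zero, add_comm, h]
  simp

theorem isReduced_pow (n k : ℕ) : IsReduced n fun w α => w α ^ k := by
  induction k using Nat.strong_induction_on with
  | _ k ih =>
    by_cases hk : k < n
    · refine ⟨Pi.single ⟨k, hk⟩ 1, fun w α => ?_⟩
      rw [sum_eq_single ⟨k, hk⟩]
      · simp
      · intro b _ hb
        rw [Pi.single_eq_of_ne hb]
        simp
      · simp
    · obtain ⟨c, hc⟩ := IsReduced.sum (range n) (fun j => (-1) ^ j *
        (⟨_, esymm_mem_powerSumAlgebra n (j + 1)⟩ : powerSumAlgebra n))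
        (fun j w α => w α ^ (k - 1 - j)) fun j hj => by
          rw [mem_range] at hj
          exact ih _ (by omega)
      refine ⟨c, fun w α => ?_⟩
      refine Eq.trans ?_ (hc w α)
      simp only
      rw [pow_eq_sum_esymm (not_lt.1 hk)]
      refine sum_congr rfl fun j _ => ?_
      simp

theorem isReduced_eval (n : ℕ) (g : Polynomial ℂ) : IsReduced n fun w α => g.eval (w α) := by
  obtain ⟨c, hc⟩ := IsReduced.sum (range (g.natDegree + 1))
    (fun j => algebraMap ℂ (powerSumAlgebra n) (g.coeff j)) (fun j w α => w α ^ j)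
    fun j _ => isReduced_pow n j
  refine ⟨c, fun w α => ?_⟩
  refine Eq.trans ?_ (hc w α)
  simp only [Polynomial.eval_eq_sum_range]
  refine sum_congr rfl fun j _ => ?_
  simp

/-- An alternating determinant of polynomials is the Vandermonde product times a polynomial in the
power sums. -/
theorem exists_powerSum_det_eq {n : ℕ} (g : Fin n → Polynomial ℂ) :
    ∃ F : MvPolynomial ℕ ℂ, ∀ w : Fin n → ℂ,
      (Matrix.of fun α β => (g β).eval (w α)).det =
        vandermondeProd w * MvPolynomial.eval (fun a : ℕ => ∑ i, w i ^ a) F := by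
  choose c hc using fun β => isReduced_eval n (g β)
  -- The reduced coefficients factor the matrix as a Vandermonde matrix times `C`; the signs match
  -- the Vandermonde matrix in `-w`. No division by the Vandermonde product is needed.
  set C : Matrix (Fin n) (Fin n) (powerSumAlgebra n) :=
    Matrix.of fun i β => (-1) ^ (i : ℕ) * c β i with hC
  obtain ⟨F, hF⟩ := C.det.2
  refine ⟨F, fun w => ?_⟩
  have h1 : C.det.1 w = (Matrix.of fun i β : Fin n => (-1) ^ (i : ℕ) * (c β i).1 w).det := by
    have h2 := RingHom.map_det ((Pi.evalRingHom (fun _ : Fin n → ℂ => ℂ) w).comp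
      (powerSumAlgebra n).subtype) C
    refine h2.trans (congrArg Matrix.det ?_)
    ext i β
    simp [hC]
  rw [← aeval_powerSum_apply]
  have h3 : MvPolynomial.aeval (fun (a : ℕ) (w : Fin n → ℂ) => ∑ i, w i ^ a) F w = C.det.1 w :=
    congrFun hF w
  rw [h3, h1, vandermondeProd_eq_det, ← Matrix.det_mul]
  congr 1
  ext α β
  simp only [Matrix.of_apply, Matrix.mul_apply, Matrix.vandermonde_apply]
  refine (hc β w α).trans (sum_congr rfl fun i _ => ?_)
  rw [← mul_assoc, ← mul_pow, mul_neg_one, neg_neg, mul_comm]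

namespace CutHexagon

variable {H : CutHexagon}

theorem rising_eq_P_mul (hspan : H.yFirst - H.yLast ≤ (H.N : ℤ) - 1) {b : ℤ} (hb : b ∈ H.Y)
    (z : ℂ) : rising (z - b + 1) (H.N - 1) = H.P z * rootPoly
      (Icc (b - H.N + 1) (b - 1) \ Icc (H.yFirst - H.N + 1) (H.yLast - 1)) z := by
  have h1 : b ≤ H.yFirst := H.Y.le_max' _ hb
  have h2 : H.yLast ≤ b := H.Y.min'_le _ hb
  have h3 := yLast_le_yFirst (H := H)
  rw [P_eq_rootPoly hspan, ← rootPoly_union disjoint_sdiff, union_sdiff_of_subset]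
  · obtain ⟨k, hk⟩ : ∃ k, H.N = k + 1 := ⟨H.N - 1, by omega⟩
    rw [hk, Nat.add_sub_cancel]
    rcases k with _ | k
    · rw [rising_zero, Icc_eq_empty (by push_cast; omega)]
      simp [rootPoly]
    · have h := rising_eq_rootPoly z (b - 1) k
      rw [show z - (b : ℂ) + 1 = z - ((b - 1 : ℤ) : ℂ) by push_cast; ring, h]
      congr 2
      push_cast
      ring
  · exact Icc_subset_Icc (by omega) (by omega)

theorem exists_expressesCutPoly (hspan : H.yFirst - H.yLast ≤ (H.N : ℤ) - 1) :
    ∃ F : MvPolynomial ℕ ℂ, H.ExpressesCutPoly F := by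
  set g : Fin H.d → Polynomial ℂ := fun β => Polynomial.C (((H.N - 1).factorial : ℂ)⁻¹) *
    ∏ a ∈ Icc (H.y β - H.N + 1) (H.y β - 1) \ Icc (H.yFirst - H.N + 1) (H.yLast - 1),
      (Polynomial.X - Polynomial.C (a : ℂ)) with hg
  obtain ⟨F, hF⟩ := exists_powerSum_det_eq g
  refine ⟨MvPolynomial.C (H.cutConst⁻¹) * F, fun w => ?_⟩
  have hc := cutConst_ne_zero (H := H)
  have h1 : (Matrix.of fun α β : Fin H.d =>
      rising (w α - (H.y β : ℂ) + 1) (H.N - 1) / ((H.N - 1).factorial : ℂ)) =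
      Matrix.of fun α β => H.P (w α) * (Matrix.of fun α β => (g β).eval (w α)) α β := by
    ext α β
    simp only [Matrix.of_apply, hg]
    have hy : H.y β ∈ H.Y := orderEmbOfFin_mem _ _ _
    rw [rising_eq_P_mul hspan hy, Polynomial.eval_mul, Polynomial.eval_C, Polynomial.eval_prod]
    simp only [Polynomial.eval_sub, Polynomial.eval_X, Polynomial.eval_C, rootPoly]
    ring
  rw [h1, Matrix.det_mul_column, hF, MvPolynomial.eval_mul, MvPolynomial.eval_C]
  field_simp

end CutHexagon

end RedDots

end

theorem theorem1p1 (H : RedDots.CutHexagon) (r : ℕ)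
    (hspan : H.yFirst - H.yLast ≤ (H.N : ℤ) - 1)
    (hr : H.setL.card = H.d + r)
    (htil : H.tilings.Nonempty) :
    (∃ F : MvPolynomial ℕ ℂ, H.ExpressesCutPoly F) ∧
    ∀ F : MvPolynomial ℕ ℂ, H.ExpressesCutPoly F →
    ∀ ε δ R : ℝ, 0 < ε → ε < δ → δ + ε < 1 → (H.d : ℝ) + H.N + H.M + 1 ≤ R →
      H.omegaPlus F ε r 0 0 ≠ 0 ∧
      ∀ (k : ℕ) (p : Fin k → ℕ × ℤ), Function.Injective p → (∀ i, H.IsSite (p i)) →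
        (H.correlation p : ℂ) =
          (Matrix.of fun i j : Fin k => H.kernel r F ε δ R (p i) (p j)).det :=
  ⟨RedDots.CutHexagon.exists_expressesCutPoly hspan, fun _ hF _ _ _ h0 h1 h2 hR =>
    ⟨RedDots.CutHexagon.omegaPlus_ne_zero hspan hr htil hF h0 (by linarith), fun _ p hp hs =>
      RedDots.CutHexagon.correlation_eq_det_kernel hspan hr htil hF h0 h1 h2 hR p hp hs⟩⟩
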